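/- Let $H$ be a real separable Hilbert space and $A:D(A)\subset H\to H$ a negative definite self-adjoint operator such that $(-A)^{-1+\delta}$ is of trace class for some $\delta\in(0,1)$; thus there are an orthonormal basis $(e_k)$ and $\alpha_k>0$ with $Ae_k=-\alpha_ke_k$. Let $\mu=N(0,-\tfrac12A^{-1})$, let $R_t\varphi(x)=\int_H\varphi(y)\,N(e^{tA}x,Q_t)(dy)$, with $Q_t=-\tfrac12A^{-1}(I-e^{2tA})$, be the Ornstein–Uhlenbeck semigroup, and let $L_2$ be the infinitesimal generator of its extension to $L^2(H,\mu)$. $D$ denotes the gradient (in the sense of $W^{1,2}(H,\mu)$ on $D(L_2)\subset W^{1,2}(H,\mu)$), $B_b$ the bounded Borel maps, $\|\cdot\|_0$ the $\mu$-essential supremum norm, and $C^1_b(H)$ the bounded $C^1$ functions with bounded derivative. There are constants $C_{1,\varepsilon}>0$, $\varepsilon\in[0,\tfrac12)$, such that for all $\lambda>0$ $$\|(-A)^\varepsilon D(\lambda-L_2)^{-1}\varphi\|_{0}\le\frac{C_{1,\varepsilon}}{\lambda^{1/2-\varepsilon}}\|\varphi\|_{0}\ \ (\varphi\in B_b(H)),\qquad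 \|(-A)^\varepsilon D(\lambda-L_2)^{-1}\varphi\|_{L^2(\mu)}\le\frac{C_{1,\varepsilon}}{\lambda^{1/2-\varepsilon}}\|\varphi\|_{L^2(\mu)}\ \ (\varphi\in L^2(\mu)).$$ Fix any such constants. Let $f,f_n\in B_b(H)$ and $B,B_n\in B_b(H,H)$ $(n\in\mathbb N)$ satisfy $f_n\to f$ and $B_n\to B$ $\mu$-a.e., and $\|f_n\|_0\le M$, $\|B_n\|_0\le M$ for all $n$. Let $\lambda>0$ with $\lambda\ge 4\,C_{1,0}^2\sup_n\|B_n\|_0^2$ (for instance $\lambda\ge4M^2C_{1,0}^2$). Then: 1. The equation $\lambda u-L_2u-\langle B,Du\rangle=f$ has a unique solution $u$ in $D(L_2)$, and $u\in C^1_b(H)$. 2. For every $n$ the equation $\lambda u_n-L_2u_n-\langle B_n,Du_n\rangle=f_n$ has a unique solution $u_n\in C^1_b(H)\cap D(L_2)$; it is also the only solution in $D(L_2)$, and $$u_n=(\lambda-L_2)^{-1}(I-T_{n,\lambda})^{-1}f_n,\qquad T_{n,\lambda}\varphi:=\langle B_n,D(\lambda-L_2)^{-1}\varphi\rangle,$$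 where $T_{n,\lambda}$ is a bounded operator on $L^2(H,\mu)$ and $I-T_{n,\lambda}$ is boundedly invertible. 3. For every $n$ and every $\varepsilon\in[0,\tfrac12)$, $Du_n$ takes its values in $D((-A)^\varepsilon)$, and for all $x\in H$ $$|u_n(x)|\le\frac{2M}{\lambda},\qquad |(-A)^\varepsilon Du_n(x)|\le\frac{2C_{1,\varepsilon}}{\lambda^{1/2-\varepsilon}}M .$$ 4. As $n\to\infty$, $u_n\to u$ in $L^2(H,\mu)$ and $Du_n\to Du$ in $L^2(H,\mu;H)$. -/

import Mathlib

open MeasureTheory ProbabilityTheory Filter Topology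
open scoped ENNReal InnerProductSpace

noncomputable section

namespace KolmogorovOU

variable {H : Type*} [NormedAddCommGroup H] [InnerProductSpace ℝ H] [CompleteSpace H]
  [MeasurableSpace H] {ι : Type*}

/-- The standing hypothesis on `A`: it is a self-adjoint operator with an orthonormal basis `e` of
eigenvectors, `A e_k = -α_k e_k` with `α_k > 0` (so `A` is negative definite), and
`(-A)^(-1+δ)` is of trace class for some `δ ∈ (0,1)`, i.e. `∑ α_k^(-1+δ) < ∞`. -/
structure Hypothesis1 (A : H →ₗ.[ℝ] H) (e : HilbertBasis ι ℝ H) (α : ι → ℝ) : Prop where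
  selfAdjoint : IsSelfAdjoint A
  pos : ∀ k, 0 < α k
  eigen : ∀ k, (e k, -(α k) • e k) ∈ A.graph
  traceClass : ∃ δ ∈ Set.Ioo (0 : ℝ) 1, Summable fun k => α k ^ (-1 + δ)

/-- The (possibly unbounded) diagonal operator with eigenvalues `g k` in the basis `e`.
It represents the operator only on the domain `InDiagDomain e g`. -/
def diagOp (e : HilbertBasis ι ℝ H) (g : ι → ℝ) (w : H) : H :=
  ∑' k, (g k * ⟪e k, w⟫_ℝ) • e k

/-- The domain of the diagonal operator: the square-summability of the coefficients. -/
def InDiagDomain (e : HilbertBasis ι ℝ H) (g : ι → ℝ) (w : H) : Prop :=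
  Summable fun k => (g k * ⟪e k, w⟫_ℝ) ^ 2

/-- `e^{tA}`. -/
def expA (e : HilbertBasis ι ℝ H) (α : ι → ℝ) (t : ℝ) (x : H) : H :=
  diagOp e (fun k => Real.exp (-t * α k)) x

/-- `(-A)^ε`. -/
def powNegA (e : HilbertBasis ι ℝ H) (α : ι → ℝ) (ε : ℝ) (w : H) : H :=
  diagOp e (fun k => α k ^ ε) w

/-- `w ∈ D((-A)^ε)`. -/
def InDomPowNegA (e : HilbertBasis ι ℝ H) (α : ι → ℝ) (ε : ℝ) (w : H) : Prop :=
  InDiagDomain e (fun k => α k ^ ε) w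

/-- The Gaussian measure `N(m, Q)` on `H`, where `Q` is the trace class operator with
`Q e_k = q_k e_k`, `q_k ≥ 0`: the law of `m + ∑ ξ_k e_k` with independent `ξ_k ∼ N(0, q_k)`. -/
def gaussian (e : HilbertBasis ι ℝ H) (m : H) (q : ι → ℝ) : Measure H :=
  (Measure.infinitePi fun k => gaussianReal 0 (q k).toNNReal).map
    fun ξ : ι → ℝ => m + ∑' k, ξ k • e k

/-- The invariant measure `μ = N(0, Q)`, `Q = -(1/2) A⁻¹`. -/
def invMeasure (e : HilbertBasis ι ℝ H) (α : ι → ℝ) : Measure H :=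
  gaussian e 0 fun k => 1 / (2 * α k)

/-- The Ornstein-Uhlenbeck semigroup
`R_t φ(x) = ∫ φ(y) N(e^{tA}x, Q_t)(dy)`, `Q_t = -(1/2) A⁻¹ (I - e^{2tA})`.
By invariance of `μ`, for `φ ∈ L²(μ)` the integral exists for `μ`-a.e. `x`, depends (up to null
sets) only on the class of `φ`, and is the continuous extension of `R_t` to `L²(μ)`. -/
def ouSemigroup (e : HilbertBasis ι ℝ H) (α : ι → ℝ) (t : ℝ) (φ : H → ℝ) (x : H) : ℝ :=
  ∫ y, φ y ∂(gaussian e (expA e α t x) fun k => (1 - Real.exp (-2 * t * α k)) / (2 * α k))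

/-- `u ∈ D(L₂)` and `L₂ u = g`, where `L₂` is the infinitesimal generator of the
Ornstein-Uhlenbeck semigroup in `L²(μ)`. -/
def IsGenerator (e : HilbertBasis ι ℝ H) (α : ι → ℝ) (u g : H → ℝ) : Prop :=
  MemLp u 2 (invMeasure e α) ∧ MemLp g 2 (invMeasure e α) ∧
  Tendsto (fun t : ℝ => eLpNorm (fun x => t⁻¹ * (ouSemigroup e α t u x - u x) - g x) 2
    (invMeasure e α)) (𝓝[>] 0) (𝓝 0)

/-- The space `C¹_b(H)`. -/
def IsC1b (u : H → ℝ) : Prop :=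
  ContDiff ℝ 1 u ∧ (∃ K : ℝ, ∀ x, |u x| ≤ K) ∧ ∃ K : ℝ, ∀ x, ‖fderiv ℝ u x‖ ≤ K

/-- `u ∈ W^{1,2}(H, μ)` with `Du = g`: the closure in `L²(μ)` of the gradient, defined on
`C¹_b(H)`. (This core gives the same space as smooth cylindrical functions; `g` is unique
`μ`-a.e. because the gradient is closable.) -/
def HasSobolevGradient (μ : Measure H) (u : H → ℝ) (g : H → H) : Prop :=
  MemLp u 2 μ ∧ MemLp g 2 μ ∧ ∃ φ : ℕ → H → ℝ, (∀ n, IsC1b (φ n)) ∧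
    Tendsto (fun n => eLpNorm (fun x => φ n x - u x) 2 μ) atTop (𝓝 0) ∧
    Tendsto (fun n => eLpNorm (fun x => gradient (φ n) x - g x) 2 μ) atTop (𝓝 0)

/-- Bounded Borel maps from `H` to `F`: the spaces `B_b(H)` and `B_b(H, H)`. -/
def IsBoundedBorel {F : Type*} [NormedAddCommGroup F] [MeasurableSpace F] (f : H → F) : Prop :=
  Measurable f ∧ ∃ K : ℝ, ∀ x, ‖f x‖ ≤ K

/-- The essential supremum norm `‖f‖₀` of a bounded Borel map. -/
def supNorm {F : Type*} [NormedAddCommGroup F] (μ : Measure H) (f : H → F) : ℝ :=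
  (eLpNormEssSup f μ).toReal

/-- `v ∈ D(L₂)` and `λ v - L₂ v = φ`, that is, `v = (λ - L₂)⁻¹ φ`. -/
def IsResolventOf (e : HilbertBasis ι ℝ H) (α : ι → ℝ) (lam : ℝ) (φ v : H → ℝ) : Prop :=
  ∃ Lv : H → ℝ, IsGenerator e α v Lv ∧ ∀ᵐ x ∂(invMeasure e α), lam * v x - Lv x = φ x

/-- `u ∈ D(L₂)` solves `λ u - L₂ u - ⟨B, Du⟩ = f` (in `L²(μ)`). -/
def IsSolution (e : HilbertBasis ι ℝ H) (α : ι → ℝ) (lam : ℝ) (B : H → H) (f u : H → ℝ) : Prop :=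
  ∃ (Lu : H → ℝ) (Du : H → H), IsGenerator e α u Lu ∧
    HasSobolevGradient (invMeasure e α) u Du ∧
    ∀ᵐ x ∂(invMeasure e α), lam * u x - Lu x - ⟪B x, Du x⟫_ℝ = f x

/-- `C ε` (`0 ≤ ε < 1/2`) are admissible constants `C_{1,ε}` in the gradient estimates of the
resolvent of `L₂`: for every `λ > 0`,
`‖(-A)^ε D(λ - L₂)⁻¹φ‖₀ ≤ C_{1,ε} λ^{-(1/2-ε)} ‖φ‖₀` for `φ ∈ B_b(H)`, and the same in the norm
of `L²(μ)` for `φ ∈ L²(μ)`. -/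
structure IsGradientConstant (e : HilbertBasis ι ℝ H) (α : ι → ℝ) (C : ℝ → ℝ) : Prop where
  pos : ∀ ε ∈ Set.Ico (0 : ℝ) (1 / 2), 0 < C ε
  sup_bound : ∀ ε ∈ Set.Ico (0 : ℝ) (1 / 2), ∀ lam : ℝ, 0 < lam → ∀ φ v : H → ℝ,
    IsBoundedBorel φ → IsC1b v → IsResolventOf e α lam φ v →
    ∀ x, InDomPowNegA e α ε (gradient v x) ∧
      ‖powNegA e α ε (gradient v x)‖ ≤
        C ε / lam ^ (1 / 2 - ε) * supNorm (invMeasure e α) φ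
  L2_bound : ∀ ε ∈ Set.Ico (0 : ℝ) (1 / 2), ∀ lam : ℝ, 0 < lam → ∀ (φ v : H → ℝ) (Dv : H → H),
    MemLp φ 2 (invMeasure e α) → IsResolventOf e α lam φ v →
    HasSobolevGradient (invMeasure e α) v Dv →
    (∀ᵐ x ∂(invMeasure e α), InDomPowNegA e α ε (Dv x)) ∧
      eLpNorm (fun x => powNegA e α ε (Dv x)) 2 (invMeasure e α) ≤
        ENNReal.ofReal (C ε / lam ^ (1 / 2 - ε)) * eLpNorm φ 2 (invMeasure e α)

/-- `G` is the bounded operator `(λ - L₂)⁻¹` on `L²(μ)`. -/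
def IsResolvent (e : HilbertBasis ι ℝ H) (α : ι → ℝ) (lam : ℝ)
    (G : Lp ℝ 2 (invMeasure e α) →L[ℝ] Lp ℝ 2 (invMeasure e α)) : Prop :=
  ∀ φ v : Lp ℝ 2 (invMeasure e α), G φ = v ↔ IsResolventOf e α lam φ v

/-- `T` is the bounded operator `φ ↦ ⟨B, D G φ⟩` on `L²(μ)`. -/
def IsDriftOperator (e : HilbertBasis ι ℝ H) (α : ι → ℝ) (B : H → H)
    (G T : Lp ℝ 2 (invMeasure e α) →L[ℝ] Lp ℝ 2 (invMeasure e α)) : Prop :=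
  ∀ φ : Lp ℝ 2 (invMeasure e α), ∃ Dv : H → H,
    HasSobolevGradient (invMeasure e α) (G φ) Dv ∧
    ∀ᵐ x ∂(invMeasure e α), T φ x = ⟪B x, Dv x⟫_ℝ

end KolmogorovOU

end

open KolmogorovOU

namespace KolmogorovOU

set_option linter.unusedSectionVars false

/-! ### Square-summable series and diagonal operators in an orthonormal basis. -/

section Coordinates

variable {H : Type*} [NormedAddCommGroup H] [InnerProductSpace ℝ H] [CompleteSpace H]
  {ι : Type*} (e : HilbertBasis ι ℝ H)

/-! Since `λ - L₂` is invertible, the equation is solved for `φ = λu - L₂u` rather than for `u`: it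
becomes `φ - Tφ = f` with `Tφ = ⟨B, D(λ - L₂)⁻¹φ⟩` (`isSolution_iff`). The gradient estimate with `ε
= 0` and the lower bound on `λ` give `‖T‖ ≤ 1/2` on `L²(μ)`, so `1 - T` is invertible and the
solution is unique in `D(L₂)`. The sup-norm version of the same estimate halves essential bounds, so
the partial sums of the Neumann series, and with them `φ`, are essentially bounded by `2‖f‖₀`
(`ae_abs_le_of_sub_driftOp`). The resolvent maps bounded functions into `C¹_b(H)`, which gives the
regularity of `u` and the pointwise bounds. For the convergence, the operators `T_n` tend to `T`
only strongly, by dominated convergence; together with the uniform contraction factor `1/2` this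
suffices (`tendsto_inverse_one_sub`), and the bounded operators `(λ - L₂)⁻¹` and `D(λ - L₂)⁻¹` carry
the limit over to `u_n` and `Du_n`.

The bulk of the proof is the linear theory behind this. The process is realised for all times and
starting points on one probability space, as `e^{tA}x + ∑ √q_k(t) ξ_k e_k` with independent standard
Gaussian `ξ_k` (`ouMap`). Characteristic functions yield the Markov property and the invariance of
`μ`, so that `ouOp` is a strongly continuous contraction semigroup on `L²(μ)`. Its Laplace transform
is the resolvent, and on bounded functions the transform may be computed pointwise
(`isResolventOf_ouResFun`).

Smoothing comes from differentiating the Gaussian density in one coordinate: `∂_k R_tφ(x) =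
e^{-tα_k} q_k(t)^{-1/2} E[φ(X) ξ_k]`. Bessel's inequality for the orthonormal `ξ_k` and the scalar
bound `rpow_mul_smoothCoef_le` give `|(-A)^ε D R_tφ(x)| ≤ t^{-1/2-ε} (E φ(X)²)^{1/2}`. Integration
against `e^{-λt}` yields the sup estimate and, with Cauchy-Schwarz and invariance, the `L²`
estimate, both with the constant `Γ(1/2 - ε)` (`isGradientConstant_gamma`).

Two facts tie functions and classes together. The gradient is closable
(`snd_eq_zero_of_mem_sobolevGraph`), so `D(λ - L₂)⁻¹` is a well-defined bounded operator `ouResD`.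
And `μ` charges every nonempty open set (`isOpenPosMeasure_gaussian`), so `C¹_b` functions that
agree almost everywhere agree everywhere. -/

theorem exists_coe_eq_of_summable_sq {c : ι → ℝ} (hc : Summable fun k => c k ^ 2) :
    ∃ f : lp (fun _ : ι => ℝ) 2, (f : ι → ℝ) = c := by
  refine ⟨⟨c, memℓp_gen ?_⟩, rfl⟩
  simpa using hc

theorem hasSum_series {c : ι → ℝ} (hc : Summable fun k => c k ^ 2) :
    HasSum (fun k => c k • e k) (∑' k, c k • e k) := by
  obtain ⟨f, rfl⟩ := exists_coe_eq_of_summable_sq hc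
  exact (e.hasSum_repr_symm f).summable.hasSum

theorem inner_series {c : ι → ℝ} (hc : Summable fun k => c k ^ 2) (k : ι) :
    ⟪e k, ∑' j, c j • e j⟫_ℝ = c k := by
  obtain ⟨f, rfl⟩ := exists_coe_eq_of_summable_sq hc
  rw [(e.hasSum_repr_symm f).tsum_eq, ← e.repr_apply_apply]
  simp

theorem hasSum_sq_inner (x : H) : HasSum (fun k => ⟪e k, x⟫_ℝ ^ 2) (‖x‖ ^ 2) := by
  have h := e.hasSum_inner_mul_inner x x
  rw [real_inner_self_eq_norm_sq] at h
  refine h.congr_fun fun k => ?_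
  rw [real_inner_comm x (e k), sq]

theorem norm_sq_series {c : ι → ℝ} (hc : Summable fun k => c k ^ 2) :
    ‖∑' j, c j • e j‖ ^ 2 = ∑' k, c k ^ 2 := by
  rw [← (hasSum_sq_inner e _).tsum_eq]
  simp_rw [inner_series e hc]

theorem ext_inner_basis {x y : H} (h : ∀ k, ⟪e k, x⟫_ℝ = ⟪e k, y⟫_ℝ) : x = y := by
  apply e.repr.injective
  ext k
  simpa [e.repr_apply_apply] using h k

theorem series_inner (x : H) : ∑' k, ⟪e k, x⟫_ℝ • e k = x :=
  ext_inner_basis e fun k => inner_series e (hasSum_sq_inner e x).summable k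

theorem summable_series_iff {c : ι → ℝ} :
    (Summable fun k => c k • e k) ↔ Summable fun k => c k ^ 2 := by
  have := e.orthonormal.orthogonalFamily.summable_iff_norm_sq_summable c
  simpa [LinearIsometry.toSpanSingleton_apply] using this

theorem norm_le_of_sum_sq_le {x : H} {K : ℝ} (hK : 0 ≤ K)
    (h : ∀ F : Finset ι, ∑ k ∈ F, ⟪e k, x⟫_ℝ ^ 2 ≤ K ^ 2) : ‖x‖ ≤ K := by
  refine abs_le_of_sq_le_sq' ?_ hK |>.2
  rw [← (hasSum_sq_inner e x).tsum_eq]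
  exact (hasSum_sq_inner e x).summable.tsum_le_of_sum_le h

/-- The vector series converges exactly where the squares of the coefficients are summable, and
`tsum` is zero elsewhere. Finite partial sums, set to zero off that measurable set, therefore
converge at every point, so no summability hypothesis is needed. -/
theorem measurable_series [Countable ι] [MeasurableSpace H] [BorelSpace H]
    [SecondCountableTopology H] {Ω : Type*} [MeasurableSpace Ω] {c : Ω → ι → ℝ}
    (hc : ∀ k, Measurable fun ω => c ω k) : Measurable fun ω => ∑' k, c ω k • e k := by
  classical
  have hS : MeasurableSet {ω | Summable fun k => c ω k ^ 2} := by
    have : {ω | Summable fun k => c ω k ^ 2}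
        = {ω | ∑' k, ENNReal.ofReal (c ω k ^ 2) ≠ ∞} := by
      ext ω
      constructor
      · intro h
        exact h.tsum_ofReal_ne_top
      · intro h
        have := ENNReal.summable_toReal h
        simpa [ENNReal.toReal_ofReal (sq_nonneg _)] using this
    rw [this]
    refine MeasurableSet.compl (measurableSet_eq_fun (Measurable.tsum fun k => ?_)
      measurable_const)
    exact ((hc k).pow_const 2).ennreal_ofReal
  have hlim : Tendsto (fun (F : Finset ι) ω =>
      Set.indicator {ω | Summable fun k => c ω k ^ 2} (fun ω => ∑ k ∈ F, c ω k • e k) ω) atTop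
      (𝓝 fun ω => ∑' k, c ω k • e k) := by
    refine tendsto_pi_nhds.2 fun ω => ?_
    by_cases h : Summable fun k => c ω k ^ 2
    · simp only [Set.indicator, Set.mem_ofPred_eq, h, if_true]
      exact hasSum_series e h
    · simp only [Set.indicator, Set.mem_ofPred_eq, h, if_false]
      rw [tsum_eq_zero_of_not_summable (mt (summable_series_iff e).1 h)]
      exact tendsto_const_nhds
  refine measurable_of_tendsto_metrizable' atTop (fun F => ?_) hlim
  exact (Finset.measurable_fun_sum _ fun k _ => (hc k).smul_const _).indicator hS

theorem summable_diag {g : ι → ℝ} {K : ℝ} (hg : ∀ k, |g k| ≤ K) (x : H) :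
    Summable fun k => (g k * ⟪e k, x⟫_ℝ) ^ 2 := by
  refine Summable.of_nonneg_of_le (fun _ => sq_nonneg _) (fun k => ?_)
    ((hasSum_sq_inner e x).summable.mul_left (K ^ 2))
  rw [mul_pow]
  exact mul_le_mul_of_nonneg_right (sq_le_sq.2 ((hg k).trans (le_abs_self K))) (sq_nonneg _)

theorem inner_diagOp {g : ι → ℝ} {x : H} (hx : InDiagDomain e g x) (k : ι) :
    ⟪e k, diagOp e g x⟫_ℝ = g k * ⟪e k, x⟫_ℝ :=
  inner_series e hx k

theorem norm_sq_diagOp {g : ι → ℝ} {x : H} (hx : InDiagDomain e g x) :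
    ‖diagOp e g x‖ ^ 2 = ∑' k, (g k * ⟪e k, x⟫_ℝ) ^ 2 :=
  norm_sq_series e hx

theorem inDiagDomain_of_sum_le {g : ι → ℝ} {x : H} {K : ℝ} (hK : 0 ≤ K)
    (h : ∀ F : Finset ι, ∑ k ∈ F, (g k * ⟪e k, x⟫_ℝ) ^ 2 ≤ K ^ 2) :
    InDiagDomain e g x ∧ ‖diagOp e g x‖ ≤ K := by
  have hs : InDiagDomain e g x := summable_of_sum_le (fun _ => sq_nonneg _) h
  refine ⟨hs, abs_le_of_sq_le_sq' ?_ hK |>.2⟩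
  rw [norm_sq_diagOp e hs]
  exact hs.tsum_le_of_sum_le h

end Coordinates

/-! ### Independent standard Gaussian coordinates. -/

section Noise

/-- The law of a sequence of independent standard Gaussian variables. -/
noncomputable def whiteNoise (ι : Type*) : Measure (ι → ℝ) :=
  Measure.infinitePi fun _ : ι => gaussianReal 0 1

instance (ι : Type*) : IsProbabilityMeasure (whiteNoise ι) := by
  unfold whiteNoise; infer_instance

theorem whiteNoise_map_eval {ι : Type*} (k : ι) :
    (whiteNoise ι).map (fun ξ => ξ k) = gaussianReal 0 1 :=
  Measure.infinitePi_map_eval _ k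

theorem memLp_coord {ι : Type*} (k : ι) :
    MemLp (fun ξ : ι → ℝ => ξ k) 2 (whiteNoise ι) := by
  have h := memLp_id_gaussianReal (μ := 0) (v := 1) 2
  rw [← whiteNoise_map_eval k, memLp_map_measure_iff (by fun_prop)
    (f := fun ξ : ι → ℝ => ξ k) (measurable_pi_apply k).aemeasurable] at h
  exact h

theorem integral_coord_sq {ι : Type*} (k : ι) :
    ∫ ξ, ξ k ^ 2 ∂(whiteNoise ι) = 1 := by
  have h1 : ∫ x, x ^ 2 ∂(gaussianReal 0 1) = 1 := by
    have h := variance_fun_id_gaussianReal (μ := 0) (v := 1)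
    rw [variance_eq_integral (by fun_prop)] at h
    simpa using h
  rw [← whiteNoise_map_eval k, integral_map (measurable_pi_apply k).aemeasurable (by fun_prop)] at h1
  exact h1

theorem lintegral_coord_sq {ι : Type*} (k : ι) :
    ∫⁻ ξ, ENNReal.ofReal (ξ k ^ 2) ∂(whiteNoise ι) = 1 := by
  rw [← ofReal_integral_eq_lintegral_ofReal (memLp_coord k).integrable_sq
    (ae_of_all _ fun _ => sq_nonneg _), integral_coord_sq, ENNReal.ofReal_one]

theorem integral_coord {ι : Type*} (k : ι) : ∫ ξ, ξ k ∂(whiteNoise ι) = 0 := by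
  have h := integral_id_gaussianReal (μ := 0) (v := 1)
  rw [← whiteNoise_map_eval k, integral_map (measurable_pi_apply k).aemeasurable (by fun_prop)] at h
  exact h

theorem iIndepFun_coord (ι : Type*) :
    iIndepFun (fun k (ξ : ι → ℝ) => ξ k) (whiteNoise ι) :=
  iIndepFun_infinitePi (X := fun _ x => x) fun _ => measurable_id

theorem integral_coord_mul {ι : Type*} {j k : ι} (h : j ≠ k) :
    ∫ ξ, ξ j * ξ k ∂(whiteNoise ι) = 0 := by
  have := ((iIndepFun_coord ι).indepFun h).integral_mul_eq_mul_integral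
    (measurable_pi_apply j).aestronglyMeasurable (measurable_pi_apply k).aestronglyMeasurable
  simp only [Pi.mul_apply, integral_coord, mul_zero] at this
  exact this

/-- Bessel's inequality for the coordinates of the white noise. -/
theorem sum_sq_integral_mul_coord_le {ι : Type*} {Φ : (ι → ℝ) → ℝ}
    (hΦ : MemLp Φ 2 (whiteNoise ι)) (F : Finset ι) :
    ∑ k ∈ F, (∫ ξ, Φ ξ * ξ k ∂(whiteNoise ι)) ^ 2 ≤ ∫ ξ, Φ ξ ^ 2 ∂(whiteNoise ι) := by
  classical
  set c : ι → ℝ := fun k => ∫ ξ, Φ ξ * ξ k ∂(whiteNoise ι) with hc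
  have hi : ∀ k, Integrable (fun ξ : ι → ℝ => Φ ξ * ξ k) (whiteNoise ι) := fun k =>
    hΦ.integrable_mul (memLp_coord k)
  have hij : ∀ j k, Integrable (fun ξ : ι → ℝ => ξ j * ξ k) (whiteNoise ι) := fun j k =>
    (memLp_coord j).integrable_mul (memLp_coord k)
  have hij' : ∀ j k, ∫ ξ, ξ j * ξ k ∂(whiteNoise ι) = if j = k then 1 else 0 := by
    intro j k
    split_ifs with h
    · subst h; simpa [sq] using integral_coord_sq j
    · exact integral_coord_mul h
  have h0 : 0 ≤ ∫ ξ, (Φ ξ - ∑ k ∈ F, c k * ξ k) ^ 2 ∂(whiteNoise ι) :=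
    integral_nonneg fun _ => sq_nonneg _
  -- The inequality is the nonnegativity of the squared distance from `Φ` to its projection on the
  -- span of the coordinates in `F`.
  have hexp : ∀ ξ : ι → ℝ, (Φ ξ - ∑ k ∈ F, c k * ξ k) ^ 2 = Φ ξ ^ 2
      - ∑ k ∈ F, 2 * c k * (Φ ξ * ξ k) + ∑ j ∈ F, ∑ k ∈ F, c j * c k * (ξ j * ξ k) := by
    intro ξ
    have h1 : (∑ k ∈ F, c k * ξ k) ^ 2 = ∑ j ∈ F, ∑ k ∈ F, c j * c k * (ξ j * ξ k) := by
      rw [sq, Finset.sum_mul_sum]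
      exact Finset.sum_congr rfl fun j _ => Finset.sum_congr rfl fun k _ => by ring
    have h2 : ∑ k ∈ F, 2 * c k * (Φ ξ * ξ k) = 2 * Φ ξ * ∑ k ∈ F, c k * ξ k := by
      rw [Finset.mul_sum]
      exact Finset.sum_congr rfl fun k _ => by ring
    rw [← h1, h2]; ring
  have hI1 : Integrable (fun ξ : ι → ℝ => ∑ k ∈ F, 2 * c k * (Φ ξ * ξ k)) (whiteNoise ι) :=
    integrable_finsetSum _ fun k _ => (hi k).const_mul _
  have hI2 : Integrable (fun ξ : ι → ℝ => ∑ j ∈ F, ∑ k ∈ F, c j * c k * (ξ j * ξ k))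
      (whiteNoise ι) :=
    integrable_finsetSum _ fun j _ => integrable_finsetSum _ fun k _ => (hij j k).const_mul _
  have hI0 : Integrable (fun ξ : ι → ℝ => Φ ξ ^ 2 - ∑ k ∈ F, 2 * c k * (Φ ξ * ξ k))
      (whiteNoise ι) := hΦ.integrable_sq.sub hI1
  simp_rw [hexp] at h0
  rw [integral_add hI0 hI2, integral_sub hΦ.integrable_sq hI1,
    integral_finsetSum _ (fun k _ => (hi k).const_mul _),
    integral_finsetSum _ (fun j _ => integrable_finsetSum _ fun k _ => (hij j k).const_mul _)] at h0
  simp_rw [integral_finsetSum F (fun k _ => (hij _ k).const_mul _), integral_const_mul, hij'] at h0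
  simp only [mul_ite, mul_one, mul_zero, Finset.sum_ite_eq] at h0
  rw [Finset.sum_congr rfl (fun k hk => if_pos hk)] at h0
  have : ∑ k ∈ F, 2 * c k * ∫ ξ, Φ ξ * ξ k ∂(whiteNoise ι) = 2 * ∑ k ∈ F, c k * c k := by
    rw [Finset.mul_sum]
    exact Finset.sum_congr rfl fun k _ => by rw [hc]; ring
  rw [this] at h0
  have h3 : ∑ k ∈ F, c k ^ 2 = ∑ k ∈ F, c k * c k := Finset.sum_congr rfl fun k _ => sq _
  linarith

/-- The expectation of the sum is `∑ q_k`, which is finite. -/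
theorem ae_summable_coord {ι : Type*} [Countable ι] {q : ι → ℝ} (hq0 : ∀ k, 0 ≤ q k)
    (hq : Summable q) : ∀ᵐ ξ ∂(whiteNoise ι), Summable fun k => q k * ξ k ^ 2 := by
  have h : ∫⁻ ξ, ∑' k, ENNReal.ofReal (q k * ξ k ^ 2) ∂(whiteNoise ι) ≠ ∞ := by
    rw [lintegral_tsum fun k => (((measurable_pi_apply k).pow_const 2).const_mul _).ennreal_ofReal.aemeasurable]
    simp_rw [ENNReal.ofReal_mul (hq0 _)]
    simp_rw [lintegral_const_mul' _ _ ENNReal.ofReal_ne_top, lintegral_coord_sq, mul_one]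
    exact hq.tsum_ofReal_ne_top
  filter_upwards [ae_lt_top (Measurable.tsum fun k =>
    (((measurable_pi_apply k).pow_const 2).const_mul _).ennreal_ofReal) h] with ξ hξ
  have := ENNReal.summable_toReal hξ.ne
  refine this.congr fun k => ?_
  rw [ENNReal.toReal_ofReal (mul_nonneg (hq0 k) (sq_nonneg _))]

/-- Resampling one coordinate independently does not change a product law; on boxes the fresh
variable supplies the missing factor. This is what isolates a single coordinate in `exists_slice`.
-/
theorem map_update_whiteNoise {ι : Type*} [DecidableEq ι] (k : ι) :
    ((gaussianReal 0 1).prod (whiteNoise ι)).map (fun p => Function.update p.2 k p.1)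
      = whiteNoise ι := by
  have hm : Measurable fun p : ℝ × (ι → ℝ) => Function.update p.2 k p.1 := by
    refine measurable_pi_lambda _ fun j => ?_
    by_cases h : j = k
    · subst h; simpa using measurable_fst
    · simp only [Function.update_of_ne h]
      exact (measurable_pi_apply j).comp measurable_snd
  refine Measure.eq_infinitePi _ fun s t ht => ?_
  rw [Measure.map_apply hm (.pi s.countable_toSet fun i _ => ht i)]
  by_cases hk : k ∈ s
  · have : (fun p : ℝ × (ι → ℝ) => Function.update p.2 k p.1) ⁻¹' (Set.pi s t)
        = t k ×ˢ Set.pi (s.erase k : Finset ι) t := by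
      ext ⟨r, ξ⟩
      simp only [Set.mem_preimage, Set.mem_pi, Finset.mem_coe, Set.mem_prod, Finset.mem_erase]
      constructor
      · intro h
        refine ⟨by simpa using h k hk, fun i hi => ?_⟩
        simpa [Function.update_of_ne hi.1] using h i hi.2
      · rintro ⟨h1, h2⟩ i hi
        by_cases hik : i = k
        · subst hik; simpa using h1
        · simpa [Function.update_of_ne hik] using h2 i ⟨hik, hi⟩
    rw [this, Measure.prod_prod, whiteNoise, Measure.infinitePi_pi _ fun i _ => ht i,
      Finset.mul_prod_erase s (fun i => gaussianReal 0 1 (t i)) hk]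
  · have : (fun p : ℝ × (ι → ℝ) => Function.update p.2 k p.1) ⁻¹' (Set.pi s t)
        = Set.univ ×ˢ Set.pi s t := by
      ext ⟨r, ξ⟩
      simp only [Set.mem_preimage, Set.mem_pi, Finset.mem_coe, Set.mem_prod, Set.mem_univ,
        true_and]
      refine forall₂_congr fun i hi => ?_
      rw [Function.update_of_ne (ne_of_mem_of_not_mem hi hk)]
    rw [this, Measure.prod_prod, whiteNoise, Measure.infinitePi_pi _ fun i _ => ht i]
    simp

end Noise

/-! ### Gaussian measures as laws of random series; characteristic functions. -/

section GaussianSeries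

variable {H : Type*} [NormedAddCommGroup H] [InnerProductSpace ℝ H] [CompleteSpace H]
  [MeasurableSpace H] [BorelSpace H] [SecondCountableTopology H]
  {ι : Type*} [Countable ι] (e : HilbertBasis ι ℝ H)

/-- The random series `∑ √q_k ξ_k e_k`, of law `N(0, Q)`. -/
noncomputable def gaussSeries (q : ι → ℝ) (ξ : ι → ℝ) : H := ∑' k, (√(q k) * ξ k) • e k

theorem measurable_gaussSeries (q : ι → ℝ) : Measurable (gaussSeries e q) :=
  measurable_series e fun k => by fun_prop

/-- Scaling the standard variables couples the Gaussian measures of all means and covariances on one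
space. Limits and derivatives in the mean or the covariance can then be taken for fixed noise. A
negative `q k` is harmless: both `toNNReal` and the square root send it to zero. -/
theorem gaussian_eq_map (m : H) (q : ι → ℝ) :
    gaussian e m q = (whiteNoise ι).map fun ξ => m + gaussSeries e q ξ := by
  have h1 : (Measure.infinitePi fun k => gaussianReal 0 (q k).toNNReal)
      = (whiteNoise ι).map fun ξ k => √(q k) * ξ k := by
    rw [whiteNoise, Measure.infinitePi_map_pi (f := fun k x => √(q k) * x) _
      fun k => by fun_prop]
    congr with k : 1
    rw [gaussianReal_map_const_mul, mul_zero]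
    congr 1
    ext
    rcases le_total 0 (q k) with h | h
    · simp [h]
    · simp [h, Real.sqrt_eq_zero_of_nonpos h]
  have hm : Measurable fun c : ι → ℝ => m + ∑' k, c k • e k :=
    (measurable_series e fun k => measurable_pi_apply k).const_add m
  rw [gaussian, h1, Measure.map_map hm (by fun_prop)]
  rfl

theorem integral_gaussian (m : H) (q : ι → ℝ) {φ : H → ℝ}
    (hφ : Measurable φ) :
    ∫ y, φ y ∂(gaussian e m q) = ∫ ξ, φ (m + gaussSeries e q ξ) ∂(whiteNoise ι) := by
  rw [gaussian_eq_map e m q, integral_map _ hφ.aestronglyMeasurable]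
  exact ((measurable_gaussSeries e q).const_add m).aemeasurable

theorem ae_summable_gaussSeries {q : ι → ℝ} (hq0 : ∀ k, 0 ≤ q k) (hq : Summable q) :
    ∀ᵐ ξ ∂(whiteNoise ι), Summable fun k => (√(q k) * ξ k) ^ 2 := by
  filter_upwards [ae_summable_coord hq0 hq] with ξ hξ
  refine hξ.congr fun k => ?_
  rw [mul_pow, Real.sq_sqrt (hq0 k)]

theorem charFun_finset_sum_coord (c : ι → ℝ) (F : Finset ι) :
    ∫ ξ, Complex.exp ((∑ k ∈ F, c k * ξ k : ℝ) * Complex.I) ∂(whiteNoise ι)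
      = Complex.exp (((-(∑ k ∈ F, c k ^ 2) / 2 : ℝ) : ℂ)) := by
  classical
  have hlaw : ∀ F : Finset ι, (whiteNoise ι).map (fun ξ => ∑ k ∈ F, c k * ξ k)
      = gaussianReal 0 (∑ k ∈ F, (c k ^ 2).toNNReal) := by
    intro F
    induction F using Finset.induction_on with
    | empty => simp [Measure.map_const, gaussianReal_zero_var]
    | insert k F hk ih =>
      have hind : iIndepFun (fun k (ξ : ι → ℝ) => c k * ξ k) (whiteNoise ι) :=
        (iIndepFun_coord ι).comp (fun k x => c k * x) fun k => by fun_prop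
      have h2 := (hind.indepFun_finsetSum_of_notMem (fun k => by fun_prop) hk).symm
      have hk' : (whiteNoise ι).map (fun ξ => c k * ξ k)
          = gaussianReal 0 (c k ^ 2).toNNReal := by
        have : (fun ξ : ι → ℝ => c k * ξ k) = (fun x => c k * x) ∘ fun ξ => ξ k := rfl
        rw [this, ← Measure.map_map (by fun_prop) (by fun_prop), whiteNoise_map_eval,
          gaussianReal_map_const_mul, mul_zero]
        congr 1
        ext
        simp [sq_nonneg]
      have h3 := gaussianReal_add_gaussianReal_of_indepFun h2 hk' (by
        convert ih using 2; ext ξ; simp)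
      simp only [Finset.sum_insert hk]
      convert h3 using 2
      · ext ξ; simp
      · simp
  have h := charFun_gaussianReal (μ := 0) (v := ∑ k ∈ F, (c k ^ 2).toNNReal) 1
  rw [← hlaw F, charFun_apply_real, integral_map
    (Finset.measurable_fun_sum _ fun k _ => (measurable_pi_apply k).const_mul _).aemeasurable
    (by fun_prop)] at h
  simp only [Complex.ofReal_one, one_mul] at h
  rw [h]
  congr 1
  rw [NNReal.coe_sum]
  simp_rw [Real.coe_toNNReal _ (sq_nonneg _)]
  push_cast
  ring

/-- Finite partial sums have an explicit Gaussian law; the integrands have modulus one, so dominated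
convergence along finite index sets gives the limit. -/
theorem charFun_gaussSeries {q : ι → ℝ} (hq0 : ∀ k, 0 ≤ q k) (hq : Summable q) (h : H) :
    charFun ((whiteNoise ι).map (gaussSeries e q)) h
      = Complex.exp ((-(∑' k, q k * ⟪e k, h⟫_ℝ ^ 2) / 2 : ℝ) : ℂ) := by
  rw [charFun_apply, integral_map (measurable_gaussSeries e q).aemeasurable (by fun_prop)]
  have hsum : Summable fun k => q k * ⟪e k, h⟫_ℝ ^ 2 := by
    refine Summable.of_nonneg_of_le (fun k => mul_nonneg (hq0 k) (sq_nonneg _)) (fun k => ?_)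
      (hq.mul_right (‖h‖ ^ 2))
    refine mul_le_mul_of_nonneg_left ?_ (hq0 k)
    exact (hasSum_sq_inner e h).summable.le_tsum k (fun _ _ => sq_nonneg _) |>.trans
      (hasSum_sq_inner e h).tsum_eq.le
  have hl : Tendsto (fun F : Finset ι => ∫ ξ, Complex.exp
      ((∑ k ∈ F, (√(q k) * ⟪e k, h⟫_ℝ) * ξ k : ℝ) * Complex.I) ∂(whiteNoise ι)) atTop
      (𝓝 (∫ ξ, Complex.exp (⟪gaussSeries e q ξ, h⟫_ℝ * Complex.I) ∂(whiteNoise ι))) := by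
    refine tendsto_integral_filter_of_dominated_convergence (fun _ => 1)
      (.of_forall fun F => Measurable.aestronglyMeasurable (by fun_prop)) (.of_forall fun F => ae_of_all _ fun ξ => ?_)
      (integrable_const _) ?_
    · rw [Complex.norm_exp_ofReal_mul_I]
    · filter_upwards [ae_summable_gaussSeries hq0 hq] with ξ hξ
      have h1 := (hasSum_series e hξ).mapL (innerSL ℝ h)
      refine ((Complex.continuous_exp.tendsto _).comp
        (((Complex.continuous_ofReal.tendsto _).comp ?_).mul_const Complex.I))
      rw [real_inner_comm]
      refine Tendsto.congr (fun F => ?_) h1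
      refine Finset.sum_congr rfl fun k _ => ?_
      simp only [innerSL_apply_apply, inner_smul_right, real_inner_comm]
      ring
  refine tendsto_nhds_unique hl ?_
  simp_rw [charFun_finset_sum_coord]
  refine (Complex.continuous_exp.tendsto _).comp ((Complex.continuous_ofReal.tendsto _).comp ?_)
  refine Tendsto.div_const (Tendsto.neg ?_) 2
  refine Tendsto.congr (fun F => ?_) hsum.hasSum
  refine Finset.sum_congr rfl fun k _ => ?_
  rw [mul_pow, Real.sq_sqrt (hq0 k)]

/-- `a X + X'` has the law `N(0, a² Q + Q')` for independent `X ∼ N(0, Q)`, `X' ∼ N(0, Q')` and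
a diagonal contraction `a`. -/
theorem map_diagOp_gaussSeries_add {q q' a : ι → ℝ} (hq0 : ∀ k, 0 ≤ q k) (hq : Summable q)
    (hq0' : ∀ k, 0 ≤ q' k) (hq' : Summable q') (ha : ∀ k, |a k| ≤ 1) :
    ((whiteNoise ι).prod (whiteNoise ι)).map
        (fun p => diagOp e a (gaussSeries e q p.1) + gaussSeries e q' p.2)
      = (whiteNoise ι).map (gaussSeries e fun k => a k ^ 2 * q k + q' k) := by
  have hmd : Measurable fun ξ => diagOp e a (gaussSeries e q ξ) :=
    measurable_series e fun k => by
      have := measurable_gaussSeries e q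
      fun_prop
  have hma := measurable_gaussSeries e q'
  have hs : Summable fun k => a k ^ 2 * q k := by
    refine Summable.of_nonneg_of_le (fun k => mul_nonneg (sq_nonneg _) (hq0 k)) (fun k => ?_) hq
    exact mul_le_of_le_one_left (hq0 k) ((sq_le_one_iff_abs_le_one _).2 (ha k))
  have hab : (whiteNoise ι).map (fun ξ => diagOp e a (gaussSeries e q ξ))
      = (whiteNoise ι).map (gaussSeries e fun k => a k ^ 2 * q k) := by
    refine Measure.ext_of_charFun (funext fun h => ?_)
    have hsum : ∀ k, √(a k ^ 2 * q k) = |a k| * √(q k) := fun k => by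
      rw [Real.sqrt_mul (sq_nonneg _), Real.sqrt_sq_eq_abs]
    rw [charFun_gaussSeries e (fun k => mul_nonneg (sq_nonneg _) (hq0 k)) hs]
    have hmeas : ∀ h : H, ∀ᵐ ξ ∂(whiteNoise ι), ⟪diagOp e a (gaussSeries e q ξ), h⟫_ℝ
        = ⟪gaussSeries e q ξ, diagOp e a h⟫_ℝ := by
      intro h
      refine ae_of_all _ fun ξ => ?_
      rw [← (e.hasSum_inner_mul_inner _ _).tsum_eq, ← (e.hasSum_inner_mul_inner _ _).tsum_eq]
      refine tsum_congr fun k => ?_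
      rw [real_inner_comm, inner_diagOp e (summable_diag e ha _),
        inner_diagOp e (summable_diag e ha _), real_inner_comm]
      ring
    -- A diagonal operator is symmetric, so the characteristic function of `a X` at `h` is that of
    -- `X` at `a h`.
    have := charFun_gaussSeries e hq0 hq (diagOp e a h)
    rw [charFun_apply, integral_map (measurable_gaussSeries e q).aemeasurable (by fun_prop)] at this
    rw [charFun_apply, integral_map hmd.aemeasurable (by fun_prop),
      integral_congr_ae (g := fun ξ => Complex.exp (⟪gaussSeries e q ξ, diagOp e a h⟫_ℝ * Complex.I))
        ((hmeas h).mono fun ξ hξ => by simp only [hξ]), this]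
    congr 4
    refine tsum_congr fun k => ?_
    rw [inner_diagOp e (summable_diag e ha _)]
    ring
  refine Measure.ext_of_charFun (funext fun h => ?_)
  have := Measure.isProbabilityMeasure_map (μ := whiteNoise ι) hmd.aemeasurable
  have := Measure.isProbabilityMeasure_map (μ := whiteNoise ι) hma.aemeasurable
  have h1 := charFun_map_add_prod_eq_mul (μ := (whiteNoise ι).map
    (fun ξ => diagOp e a (gaussSeries e q ξ))) (ν := (whiteNoise ι).map (gaussSeries e q'))
  have h2 : ((whiteNoise ι).prod (whiteNoise ι)).map
        (fun p => diagOp e a (gaussSeries e q p.1) + gaussSeries e q' p.2)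
      = (((whiteNoise ι).map (fun ξ => diagOp e a (gaussSeries e q ξ))).prod
          ((whiteNoise ι).map (gaussSeries e q'))).map (fun p => p.1 + p.2) := by
    rw [Measure.map_prod_map _ _ hmd hma, Measure.map_map (by fun_prop) (by fun_prop)]
    rfl
  rw [h2, h1, Pi.mul_apply, hab, charFun_gaussSeries e (fun k => mul_nonneg (sq_nonneg _) (hq0 k)) hs,
    charFun_gaussSeries e hq0' hq',
    charFun_gaussSeries e (fun k => add_nonneg (mul_nonneg (sq_nonneg _) (hq0 k)) (hq0' k))
      (hs.add hq'), ← Complex.exp_add, ← Complex.ofReal_add]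
  have hb : ∀ k, ⟪e k, h⟫_ℝ ^ 2 ≤ ‖h‖ ^ 2 := fun k =>
    (hasSum_sq_inner e h).summable.le_tsum k (fun _ _ => sq_nonneg _) |>.trans
      (hasSum_sq_inner e h).tsum_eq.le
  have hS : ∀ {p : ι → ℝ}, (∀ k, 0 ≤ p k) → Summable p →
      Summable fun k => p k * ⟪e k, h⟫_ℝ ^ 2 := fun {p} hp0 hp =>
    Summable.of_nonneg_of_le (fun k => mul_nonneg (hp0 k) (sq_nonneg _))
      (fun k => mul_le_mul_of_nonneg_left (hb k) (hp0 k)) (hp.mul_right (‖h‖ ^ 2))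
  congr 2
  simp_rw [add_mul]
  rw [(hS (fun k => mul_nonneg (sq_nonneg _) (hq0 k)) hs).tsum_add (hS hq0' hq')]
  ring

instance isProbabilityMeasure_gaussian (m : H) (q : ι → ℝ) :
    IsProbabilityMeasure (gaussian e m q) := by
  rw [gaussian_eq_map e m q]
  exact Measure.isProbabilityMeasure_map
    ((measurable_gaussSeries e q).const_add m).aemeasurable

end GaussianSeries

/-! ### Translations of the one-dimensional Gaussian measure. -/

section Shift

/-- Translation invariance of Lebesgue measure and completion of the square. The dependence on `h`
moves from `ψ`, which need not be regular, to a smooth density. -/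
theorem integral_gaussianReal_shift (ψ : ℝ → ℝ) (h : ℝ) :
    ∫ r, ψ (r + h) ∂(gaussianReal 0 1)
      = ∫ r, ψ r * Real.exp (r * h - h ^ 2 / 2) ∂(gaussianReal 0 1) := by
  rw [integral_gaussianReal_eq_integral_smul one_ne_zero,
    integral_gaussianReal_eq_integral_smul one_ne_zero,
    ← integral_sub_right_eq_self (fun r => gaussianPDFReal 0 1 r • ψ (r + h)) h]
  congr with r
  simp only [gaussianPDFReal, smul_eq_mul, sub_add_cancel, NNReal.coe_one, mul_one, sub_zero]
  have : Real.exp (-(r - h) ^ 2 / 2) = Real.exp (-r ^ 2 / 2) * Real.exp (r * h - h ^ 2 / 2) := by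
    rw [← Real.exp_add]; congr 1; ring
  rw [this]; ring

theorem hasDerivAt_integral_shift_zero {ψ : ℝ → ℝ} (hψ : Measurable ψ) {K : ℝ}
    (hK : ∀ r, |ψ r| ≤ K) :
    HasDerivAt (fun h => ∫ r, ψ (r + h) ∂(gaussianReal 0 1))
      (∫ r, ψ r * r ∂(gaussianReal 0 1)) 0 := by
  simp_rw [integral_gaussianReal_shift ψ]
  have hK0 : 0 ≤ K := (abs_nonneg _).trans (hK 0)
  -- For `|h| < 1` the density and the factor `r - h` are each at most `e^{|r|}`, and `e^{2|r|}` is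
  -- at most the sum of the two exponentials, which are Gaussian integrable.
  have hI : Integrable (fun r : ℝ => K * (Real.exp (2 * r) + Real.exp (-2 * r)))
      (gaussianReal 0 1) :=
    ((integrable_exp_mul_gaussianReal 2).add (integrable_exp_mul_gaussianReal (-2))).const_mul K
  have h := hasDerivAt_integral_of_dominated_loc_of_deriv_le (μ := gaussianReal 0 1)
    (F := fun h r => ψ r * Real.exp (r * h - h ^ 2 / 2))
    (F' := fun h r => ψ r * (Real.exp (r * h - h ^ 2 / 2) * (r - h))) (x₀ := 0)
    (bound := fun r : ℝ => K * (Real.exp (2 * r) + Real.exp (-2 * r)))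
    (Metric.ball_mem_nhds 0 one_pos)
    (.of_forall fun h => Measurable.aestronglyMeasurable (by fun_prop))
    ?_ (Measurable.aestronglyMeasurable (by fun_prop)) ?_ hI ?_
  · simpa using h.2
  · simp only [mul_zero, ne_eq, OfNat.ofNat_ne_zero, not_false_eq_true, zero_pow, zero_div,
      sub_zero, Real.exp_zero, mul_one]
    exact Integrable.of_bound hψ.aestronglyMeasurable K (ae_of_all _ hK)
  · refine ae_of_all _ fun r h hh => ?_
    rw [Metric.mem_ball, dist_zero_right, Real.norm_eq_abs] at hh
    rw [norm_mul, norm_mul, Real.norm_eq_abs, Real.norm_eq_abs, Real.norm_eq_abs, Real.abs_exp]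
    refine mul_le_mul (hK r) ?_ (by positivity) hK0
    have h1 : Real.exp (r * h - h ^ 2 / 2) ≤ Real.exp |r| := by
      refine Real.exp_le_exp.2 ?_
      have : r * h ≤ |r| := by
        calc r * h ≤ |r * h| := le_abs_self _
          _ = |r| * |h| := abs_mul _ _
          _ ≤ |r| * 1 := by gcongr
          _ = |r| := mul_one _
      nlinarith [sq_nonneg h]
    have h2 : |r - h| ≤ Real.exp |r| := by
      have := abs_sub r h
      have := Real.add_one_le_exp |r|
      linarith
    have h3 : Real.exp |r| * Real.exp |r| ≤ Real.exp (2 * r) + Real.exp (-2 * r) := by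
      rw [← Real.exp_add]
      rcases abs_cases r with ⟨hr, _⟩ | ⟨hr, _⟩ <;> rw [hr]
      · rw [show r + r = 2 * r by ring]; linarith [Real.exp_pos (-2 * r)]
      · rw [show -r + -r = -2 * r by ring]; linarith [Real.exp_pos (2 * r)]
    exact (mul_le_mul h1 h2 (abs_nonneg _) (Real.exp_pos _).le).trans h3
  · refine ae_of_all _ fun r h _ => ?_
    have : HasDerivAt (fun h : ℝ => r * h - h ^ 2 / 2) (r - h) h := by
      have h1 : HasDerivAt (fun h : ℝ => h ^ 2 / 2) h h := by
        simpa using (hasDerivAt_pow 2 h).div_const 2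
      have h2 : HasDerivAt (fun h : ℝ => r * h) r h := by
        simpa using (hasDerivAt_id h).const_mul r
      exact h2.sub h1
    exact (this.exp).const_mul (ψ r)

theorem hasDerivAt_integral_shift {ψ : ℝ → ℝ} (hψ : Measurable ψ) {K : ℝ}
    (hK : ∀ r, |ψ r| ≤ K) (s : ℝ) :
    HasDerivAt (fun h => ∫ r, ψ (r + h) ∂(gaussianReal 0 1))
      (∫ r, ψ (r + s) * r ∂(gaussianReal 0 1)) s := by
  have h := hasDerivAt_integral_shift_zero (ψ := fun r => ψ (r + s)) (by fun_prop)
    (fun r => hK _)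
  have h2 : HasDerivAt (fun x : ℝ => x - s) 1 s := (hasDerivAt_id s).sub_const s
  have h3 := HasDerivAt.comp_of_eq s h h2 (sub_self s).symm
  rw [mul_one] at h3
  refine h3.congr_of_eventuallyEq (.of_forall fun x => ?_)
  simp only [Function.comp]
  congr with r
  congr 1
  ring

/-- A nonnegative function of integral zero vanishes almost everywhere, and the shifted integral
differs only by a density. -/
theorem integral_shift_eq_zero {ψ : ℝ → ℝ} (hψ : Measurable ψ) (hψ0 : ∀ r, 0 ≤ ψ r) {K : ℝ}
    (hK : ∀ r, |ψ r| ≤ K) (h0 : ∫ r, ψ r ∂(gaussianReal 0 1) = 0) (s : ℝ) :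
    ∫ r, ψ (r + s) ∂(gaussianReal 0 1) = 0 := by
  have hI : Integrable ψ (gaussianReal 0 1) :=
    Integrable.of_bound hψ.aestronglyMeasurable K (ae_of_all _ hK)
  rw [integral_eq_zero_iff_of_nonneg hψ0 hI] at h0
  rw [integral_gaussianReal_shift]
  refine integral_eq_zero_of_ae (h0.mono fun r hr => ?_)
  simp only [Pi.zero_apply] at hr ⊢
  rw [hr, zero_mul]

end Shift

/-! ### Translations along basis vectors; full support of Gaussian measures. -/

section GaussianSeriesShift

variable {H : Type*} [NormedAddCommGroup H] [InnerProductSpace ℝ H] [CompleteSpace H]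
  [MeasurableSpace H] [BorelSpace H] [SecondCountableTopology H]
  {ι : Type*} [Countable ι] (e : HilbertBasis ι ℝ H)

/-- Conditioning on all coordinates of the noise but one reduces expectations over the Gaussian
series to one-dimensional Gaussian integrals. -/
theorem exists_slice {φ : H → ℝ} (hφ : Measurable φ) {K : ℝ} (hK : ∀ x, |φ x| ≤ K) (z : H)
    {q : ι → ℝ} (hq0 : ∀ k, 0 ≤ q k) (hq : Summable q) (k : ι) :
    ∃ ψ : ℝ → ℝ, Measurable ψ ∧ (∀ r, |ψ r| ≤ K) ∧ ((∀ x, 0 ≤ φ x) → ∀ r, 0 ≤ ψ r) ∧ ∀ s,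
      (∫ ξ, φ (z + (s * √(q k)) • e k + gaussSeries e q ξ) ∂(whiteNoise ι)
        = ∫ r, ψ (r + s) ∂(gaussianReal 0 1)) ∧
      (∫ ξ, φ (z + (s * √(q k)) • e k + gaussSeries e q ξ) * ξ k ∂(whiteNoise ι)
        = ∫ r, ψ (r + s) * r ∂(gaussianReal 0 1)) := by
  classical
  -- The series without its `k`-th term, hence unaffected by resampling `ξ k`.
  set Y : (ι → ℝ) → H := fun ξ => ∑' j, (if j = k then 0 else √(q j) * ξ j) • e j with hY
  have hYm : Measurable Y := measurable_series e fun j => by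
    by_cases h : j = k
    · simp [h]
    · simp only [h, if_false]; fun_prop
  have hX := measurable_gaussSeries e q
  have hJ : Measurable fun p : ℝ × (ι → ℝ) => φ (z + (√(q k) * p.1) • e k + Y p.2) := by
    fun_prop
  have hum : Measurable fun p : ℝ × (ι → ℝ) => Function.update p.2 k p.1 := by
    refine measurable_pi_lambda _ fun j => ?_
    by_cases h : j = k
    · subst h; simpa using measurable_fst
    · simp only [Function.update_of_ne h]
      exact (measurable_pi_apply j).comp measurable_snd
  -- A translation by `s √q_k` along `e k` is absorbed into the `k`-th noise coordinate as a shift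
  -- by `s`. Coordinates may be compared only where the series converges, hence almost surely;
  -- changing one coordinate does not affect convergence.
  have key : ∀ᵐ ξ ∂(whiteNoise ι), ∀ s r, z + (s * √(q k)) • e k
      + gaussSeries e q (Function.update ξ k r) = z + (√(q k) * (r + s)) • e k + Y ξ := by
    filter_upwards [ae_summable_gaussSeries hq0 hq] with ξ hξ s r
    have h1 : Summable fun j => (√(q j) * Function.update ξ k r j) ^ 2 := by
      refine (summable_congr_cofinite ?_).2 hξ
      filter_upwards [(Set.finite_singleton k).compl_mem_cofinite] with j hj
      rw [Function.update_of_ne (by simpa using hj)]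
    have h2 : Summable fun j => (if j = k then 0 else √(q j) * ξ j) ^ 2 := by
      refine (summable_congr_cofinite ?_).2 hξ
      filter_upwards [(Set.finite_singleton k).compl_mem_cofinite] with j hj
      rw [if_neg (by simpa using hj)]
    refine ext_inner_basis e fun j => ?_
    simp only [inner_add_right, inner_smul_right, gaussSeries, hY]
    rw [inner_series e h1, inner_series e h2]
    by_cases h : j = k
    · subst h
      have : ⟪e j, e j⟫_ℝ = 1 := by
        rw [real_inner_self_eq_norm_sq, e.orthonormal.1, one_pow]
      simp only [Function.update_self, if_true, this]
      ring
    · rw [Function.update_of_ne h, if_neg h, e.orthonormal.2 h]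
      ring
  have hprod : ∀ s, ∀ᵐ p ∂((gaussianReal 0 1).prod (whiteNoise ι)),
      z + (s * √(q k)) • e k + gaussSeries e q (Function.update p.2 k p.1)
        = z + (√(q k) * (p.1 + s)) • e k + Y p.2 := by
    intro s
    have := Measure.quasiMeasurePreserving_snd (μ := gaussianReal 0 1) (ν := whiteNoise ι)
    filter_upwards [this.ae key] with p hp
    exact hp s p.1
  refine ⟨fun r => ∫ ξ, φ (z + (√(q k) * r) • e k + Y ξ) ∂(whiteNoise ι),
    (hJ.stronglyMeasurable.integral_prod_right').measurable, fun r => ?_,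
    fun h0 r => integral_nonneg fun ξ => h0 _, fun s => ⟨?_, ?_⟩⟩
  · have := norm_integral_le_of_norm_le_const (μ := whiteNoise ι)
      (f := fun ξ => φ (z + (√(q k) * r) • e k + Y ξ)) (ae_of_all _ fun ξ => hK _)
    simpa using this
  · rw [← map_update_whiteNoise k, integral_map hum.aemeasurable
      (Measurable.aestronglyMeasurable (by fun_prop)),
      integral_congr_ae (g := fun p : ℝ × (ι → ℝ) =>
        φ (z + (√(q k) * (p.1 + s)) • e k + Y p.2)) ((hprod s).mono fun p hp => by simp only [hp]),
      integral_prod, map_update_whiteNoise k]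
    exact Integrable.of_bound (Measurable.aestronglyMeasurable (by fun_prop)) K
      (ae_of_all _ fun _ => hK _)
  · have hmeas : Measurable fun p : ℝ × (ι → ℝ) => φ (z + (√(q k) * (p.1 + s)) • e k + Y p.2) := by
      fun_prop
    rw [← map_update_whiteNoise k, integral_map hum.aemeasurable
      (Measurable.aestronglyMeasurable (by fun_prop)),
      integral_congr_ae (g := fun p : ℝ × (ι → ℝ) =>
        φ (z + (√(q k) * (p.1 + s)) • e k + Y p.2) * p.1)
        ((hprod s).mono fun p hp => by simp only [hp, Function.update_self]),
      integral_prod, map_update_whiteNoise k]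
    · simp_rw [integral_mul_const]
    · have h1 : Integrable (fun p : ℝ × (ι → ℝ) => p.1)
          ((gaussianReal 0 1).prod (whiteNoise ι)) := by
        have := (memLp_id_gaussianReal (μ := 0) (v := 1) 1).integrable (by simp)
        exact this.comp_fst (whiteNoise ι)
      exact h1.bdd_mul hmeas.aestronglyMeasurable (ae_of_all _ fun _ => hK _)

theorem hasDerivAt_gaussSeries_shift {φ : H → ℝ} (hφ : Measurable φ) {K : ℝ}
    (hK : ∀ x, |φ x| ≤ K) (z : H) {q : ι → ℝ} (hq0 : ∀ k, 0 ≤ q k) (hq : Summable q) {k : ι}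
    (hk : 0 < q k) (s : ℝ) :
    HasDerivAt (fun s => ∫ ξ, φ (z + s • e k + gaussSeries e q ξ) ∂(whiteNoise ι))
      ((√(q k))⁻¹ * ∫ ξ, φ (z + s • e k + gaussSeries e q ξ) * ξ k ∂(whiteNoise ι)) s := by
  obtain ⟨ψ, hψ, hψK, -, h⟩ := exists_slice e hφ hK z hq0 hq k
  have hc : √(q k) ≠ 0 := (Real.sqrt_pos.2 hk).ne'
  have hs : ∀ s, s = (s * (√(q k))⁻¹) * √(q k) := fun s => by field_simp
  have h1 : ∀ s, ∫ ξ, φ (z + s • e k + gaussSeries e q ξ) ∂(whiteNoise ι)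
      = ∫ r, ψ (r + s * (√(q k))⁻¹) ∂(gaussianReal 0 1) := fun s => by
    rw [← (h _).1, ← hs]
  have h2 : ∫ ξ, φ (z + s • e k + gaussSeries e q ξ) * ξ k ∂(whiteNoise ι)
      = ∫ r, ψ (r + s * (√(q k))⁻¹) * r ∂(gaussianReal 0 1) := by
    rw [← (h _).2, ← hs]
  simp_rw [h1, h2]
  have h3 : HasDerivAt (fun x : ℝ => x * (√(q k))⁻¹) (√(q k))⁻¹ s := by
    simpa using (hasDerivAt_id s).mul_const (√(q k))⁻¹
  rw [mul_comm]
  exact (hasDerivAt_integral_shift hψ hψK _).comp s h3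

theorem gaussian_shift_null {q : ι → ℝ} (hq0 : ∀ k, 0 < q k) (hq : Summable q) (k : ι) (s : ℝ)
    {U : Set H} (hU : MeasurableSet U) (h0 : gaussian e 0 q U = 0) :
    gaussian e 0 q {y | s • e k + y ∈ U} = 0 := by
  have hq0' := fun k => (hq0 k).le
  have hφ : Measurable (U.indicator (fun _ => (1 : ℝ))) := measurable_const.indicator hU
  have hφ0 : ∀ x, 0 ≤ U.indicator (fun _ => (1 : ℝ)) x := fun x =>
    Set.indicator_nonneg (fun _ _ => zero_le_one) x
  have hφ1 : ∀ x, |U.indicator (fun _ => (1 : ℝ)) x| ≤ 1 := fun x => by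
    rw [abs_of_nonneg (hφ0 x)]; exact Set.indicator_le_self' (fun _ _ => zero_le_one) x
  obtain ⟨ψ, hψ, hψK, hψ0, h⟩ := exists_slice e hφ hφ1 0 hq0' hq k
  have hc : √(q k) ≠ 0 := (Real.sqrt_pos.2 (hq0 k)).ne'
  have hgen : ∀ s : ℝ, ∫ ξ, U.indicator (fun _ => (1 : ℝ)) (0 + (s * √(q k)) • e k
      + gaussSeries e q ξ) ∂(whiteNoise ι)
      = (gaussian e 0 q).real {y | (s * √(q k)) • e k + y ∈ U} := by
    intro s
    have hV : MeasurableSet {y | (s * √(q k)) • e k + y ∈ U} :=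
      (measurable_const_add ((s * √(q k)) • e k)) hU
    rw [← integral_indicator_one hV, integral_gaussian e 0 q (measurable_one.indicator hV)]
    congr with ξ
    rw [zero_add, zero_add]
    rfl
  have hz : ∫ r, ψ r ∂(gaussianReal 0 1) = 0 := by
    have := (h 0).1
    rw [hgen 0] at this
    simp only [zero_mul, zero_smul, zero_add, add_zero] at this
    rw [← this]
    simp [Measure.real, h0]
  have h1 := integral_shift_eq_zero hψ (hψ0 hφ0) hψK hz (s * (√(q k))⁻¹)
  rw [← (h _).1, hgen, mul_assoc, inv_mul_cancel₀ hc, mul_one] at h1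
  exact (measureReal_eq_zero_iff).1 h1

/-- A nondegenerate Gaussian measure has full support. -/
theorem isOpenPosMeasure_gaussian {q : ι → ℝ} (hq0 : ∀ k, 0 < q k) (hq : Summable q) :
    (gaussian e 0 q).IsOpenPosMeasure := by
  refine ⟨fun U hU hne h0 => ?_⟩
  -- Null sets stay null under translation along each basis vector, hence, by composing
  -- translations, along every finite combination.
  have hspan : ∀ h ∈ Submodule.span ℝ (Set.range e), ∀ s : ℝ, ∀ V : Set H, MeasurableSet V →
      gaussian e 0 q V = 0 → gaussian e 0 q {y | s • h + y ∈ V} = 0 := by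
    intro h hh
    induction hh using Submodule.span_induction with
    | mem x hx =>
      obtain ⟨k, rfl⟩ := hx
      exact fun s V hV hV0 => gaussian_shift_null e hq0 hq k s hV hV0
    | zero => intro s V hV hV0; simpa using hV0
    | add x y _ _ hx hy =>
      intro s V hV hV0
      have := hy s _ ((measurable_const_add (s • x)) hV) (hx s V hV hV0)
      convert this using 2
      ext z
      simp [smul_add, add_assoc]
    | smul a x _ hx =>
      intro s V hV hV0
      have := hx (s * a) V hV hV0
      simpa [mul_smul] using this
  obtain ⟨x, hx⟩ := hne
  -- The span is dense, so its translates of a nonempty open set cover the space. By the Lindelöf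
  -- property countably many suffice, and a null `U` would make the whole space null.
  have hcov : ⋃ h : Submodule.span ℝ (Set.range e), {y : H | (h : H) + y ∈ U} = Set.univ := by
    refine Set.eq_univ_of_forall fun y => ?_
    have hd : Dense (Submodule.span ℝ (Set.range e) : Set H) := by
      rw [dense_iff_closure_eq, ← Submodule.topologicalClosure_coe, e.dense_span]; rfl
    have hV : IsOpen {h : H | h + y ∈ U} := hU.preimage (continuous_add_const y)
    obtain ⟨h, hh, hhs⟩ := hd.exists_mem_open hV ⟨x - y, by simpa using hx⟩
    exact Set.mem_iUnion.2 ⟨⟨h, hh⟩, hhs⟩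
  obtain ⟨T, hT, hTU⟩ := TopologicalSpace.isOpen_iUnion_countable
    (fun h : Submodule.span ℝ (Set.range e) => {y : H | (h : H) + y ∈ U})
    (fun h => hU.preimage (continuous_const_add (h : H)))
  rw [hcov] at hTU
  have hzero : gaussian e 0 q (⋃ i ∈ T, {y : H | (i : H) + y ∈ U}) = 0 := by
    refine (measure_biUnion_null_iff hT).2 fun h _ => ?_
    simpa using hspan h h.2 1 U hU.measurableSet h0
  rw [hTU, measure_univ] at hzero
  exact one_ne_zero hzero

end GaussianSeriesShift

/-! ### Second moments and Cauchy-Schwarz for the extended nonnegative integral. -/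

section Lintegral

theorem eLpNorm_two_sq {Ω F : Type*} [MeasurableSpace Ω] [NormedAddCommGroup F] (f : Ω → F)
    (ν : Measure Ω) : eLpNorm f 2 ν ^ 2 = ∫⁻ x, ‖f x‖ₑ ^ 2 ∂ν := by
  have := eLpNorm_nnreal_pow_eq_lintegral (f := f) (μ := ν) (p := 2) two_ne_zero
  norm_num at this
  exact_mod_cast this

theorem eLpNorm_two_le_of_lintegral_le {Ω F Ω' F' : Type*} [MeasurableSpace Ω]
    [NormedAddCommGroup F] [MeasurableSpace Ω'] [NormedAddCommGroup F'] {f : Ω → F}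
    {ν : Measure Ω} {f' : Ω' → F'} {ν' : Measure Ω'} {c : ℝ≥0∞}
    (h : ∫⁻ x, ‖f x‖ₑ ^ 2 ∂ν ≤ c ^ 2 * ∫⁻ x, ‖f' x‖ₑ ^ 2 ∂ν') :
    eLpNorm f 2 ν ≤ c * eLpNorm f' 2 ν' := by
  rw [← eLpNorm_two_sq, ← eLpNorm_two_sq, ← mul_pow] at h
  exact (ENNReal.pow_le_pow_left_iff two_ne_zero).1 h

theorem tendsto_eLpNorm_two_zero_iff {Ω F β : Type*} [MeasurableSpace Ω] [NormedAddCommGroup F]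
    {ν : Measure Ω} {f : β → Ω → F} {l : Filter β} :
    Tendsto (fun n => eLpNorm (f n) 2 ν) l (𝓝 0)
      ↔ Tendsto (fun n => ∫⁻ x, ‖f n x‖ₑ ^ 2 ∂ν) l (𝓝 0) := by
  simp_rw [← eLpNorm_two_sq]
  constructor
  · intro h
    have := ((ENNReal.continuous_pow 2).tendsto 0).comp h
    simpa [Function.comp_def] using this
  · intro h
    have := ((ENNReal.continuous_rpow_const (y := 1 / 2)).tendsto 0).comp h
    rw [ENNReal.zero_rpow_of_pos (by norm_num)] at this
    refine this.congr fun n => ?_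
    simp only [Function.comp]
    rw [← ENNReal.rpow_natCast, ← ENNReal.rpow_mul]
    norm_num

/-- The Cauchy-Schwarz inequality. -/
theorem sq_lintegral_mul_le {Ω : Type*} [MeasurableSpace Ω] (ν : Measure Ω) {f g : Ω → ℝ≥0∞}
    (hf : AEMeasurable f ν) (hg : AEMeasurable g ν) :
    (∫⁻ x, f x * g x ∂ν) ^ 2 ≤ (∫⁻ x, f x ^ 2 ∂ν) * ∫⁻ x, g x ^ 2 ∂ν := by
  have h := ENNReal.lintegral_mul_le_Lp_mul_Lq ν Real.HolderConjugate.two_two hf hg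
  simp only [Pi.mul_apply] at h
  refine (pow_le_pow_left' h 2).trans ?_
  rw [mul_pow, ← ENNReal.rpow_natCast, ← ENNReal.rpow_natCast, ← ENNReal.rpow_mul,
    ← ENNReal.rpow_mul]
  norm_num

theorem sq_lintegral_le {Ω : Type*} [MeasurableSpace Ω] (ν : Measure Ω) [IsProbabilityMeasure ν]
    {f : Ω → ℝ≥0∞} (hf : AEMeasurable f ν) :
    (∫⁻ x, f x ∂ν) ^ 2 ≤ ∫⁻ x, f x ^ 2 ∂ν := by
  simpa using sq_lintegral_mul_le ν hf (g := fun _ => 1) aemeasurable_const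

/-- The weighted Cauchy-Schwarz inequality. -/
theorem sq_lintegral_weight_mul_le {Ω : Type*} [MeasurableSpace Ω] (ν : Measure Ω)
    {w f : Ω → ℝ≥0∞} (hw : AEMeasurable w ν) (hf : AEMeasurable f ν) :
    (∫⁻ x, w x * f x ∂ν) ^ 2 ≤ (∫⁻ x, w x ∂ν) * ∫⁻ x, w x * f x ^ 2 ∂ν := by
  have h := sq_lintegral_mul_le ν (hw.pow_const (1 / 2 : ℝ)) ((hw.pow_const (1 / 2 : ℝ)).mul hf)
  have h2 : ∀ x, (w x ^ (1 / 2 : ℝ)) ^ 2 = w x := fun x => by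
    rw [← ENNReal.rpow_natCast, ← ENNReal.rpow_mul]; norm_num
  have h3 : ∀ x, w x ^ (1 / 2 : ℝ) * (w x ^ (1 / 2 : ℝ) * f x) = w x * f x := fun x => by
    rw [← mul_assoc, ← sq, h2]
  simpa only [Pi.mul_apply, mul_pow, h2, h3] using h

end Lintegral

/-! ### The Ornstein-Uhlenbeck process: Markov property, invariance, continuity at time zero. -/

section OrnsteinUhlenbeck

variable {H : Type*} [NormedAddCommGroup H] [InnerProductSpace ℝ H] [CompleteSpace H]
  [MeasurableSpace H] [BorelSpace H] [SecondCountableTopology H]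
  {ι : Type*} [Countable ι] (e : HilbertBasis ι ℝ H) {α : ι → ℝ}

/-- The eigenvalues of `Q_t`. -/
noncomputable def ouVar (α : ι → ℝ) (t : ℝ) (k : ι) : ℝ :=
  (1 - Real.exp (-2 * t * α k)) / (2 * α k)

/-- The Ornstein-Uhlenbeck process at time `t`, started at `x`, driven by the noise `ξ`. -/
noncomputable def ouMap (e : HilbertBasis ι ℝ H) (α : ι → ℝ) (t : ℝ) (x : H) (ξ : ι → ℝ) : H :=
  expA e α t x + gaussSeries e (ouVar α t) ξ

theorem ouVar_nonneg (hα : ∀ k, 0 < α k) {t : ℝ} (ht : 0 ≤ t) (k : ι) : 0 ≤ ouVar α t k := by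
  have h1 := hα k
  refine div_nonneg (sub_nonneg.2 (Real.exp_le_one_iff.2 ?_)) (by positivity)
  nlinarith [mul_nonneg ht h1.le]

theorem ouVar_pos (hα : ∀ k, 0 < α k) {t : ℝ} (ht : 0 < t) (k : ι) : 0 < ouVar α t k := by
  have h1 := hα k
  refine div_pos (sub_pos.2 (Real.exp_lt_one_iff.2 ?_)) (by positivity)
  nlinarith [mul_pos ht h1]

theorem ouVar_le (hα : ∀ k, 0 < α k) (t : ℝ) (k : ι) : ouVar α t k ≤ 1 / (2 * α k) := by
  have h1 := hα k
  refine div_le_div_of_nonneg_right ?_ (by positivity)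
  linarith [Real.exp_pos (-2 * t * α k)]

theorem summable_ouVar (hα : ∀ k, 0 < α k) (hs : Summable fun k => 1 / (2 * α k)) {t : ℝ}
    (ht : 0 ≤ t) : Summable (ouVar α t) :=
  Summable.of_nonneg_of_le (ouVar_nonneg hα ht) (ouVar_le hα t) hs

/-- The identity `e^{sA} Q_t e^{sA} + Q_s = Q_{s+t}` on eigenvalues; it is the covariance side of
the Markov property. -/
theorem ouVar_add (hα : ∀ k, 0 < α k) (s t : ℝ) (k : ι) :
    Real.exp (-s * α k) ^ 2 * ouVar α t k + ouVar α s k = ouVar α (s + t) k := by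
  have h1 := (hα k).ne'
  have h2 : Real.exp (-2 * (s + t) * α k) = Real.exp (-s * α k) ^ 2 * Real.exp (-2 * t * α k) := by
    rw [← Real.exp_nat_mul, ← Real.exp_add]; congr 1; push_cast; ring
  have h3 : Real.exp (-2 * s * α k) = Real.exp (-s * α k) ^ 2 := by
    rw [← Real.exp_nat_mul]; congr 1; push_cast; ring
  rw [ouVar, ouVar, ouVar, h2, h3]
  field_simp
  ring

/-- The identity `e^{tA} Q e^{tA} + Q_t = Q` on eigenvalues, with `Q` the covariance of `μ`; it is
the reason for invariance. -/
theorem ouVar_add_inv (hα : ∀ k, 0 < α k) (t : ℝ) (k : ι) :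
    Real.exp (-t * α k) ^ 2 * (1 / (2 * α k)) + ouVar α t k = 1 / (2 * α k) := by
  have h1 := (hα k).ne'
  have h3 : Real.exp (-2 * t * α k) = Real.exp (-t * α k) ^ 2 := by
    rw [← Real.exp_nat_mul]; congr 1; push_cast; ring
  rw [ouVar, h3]
  field_simp
  ring

theorem abs_exp_le_one (hα : ∀ k, 0 < α k) {t : ℝ} (ht : 0 ≤ t) (k : ι) :
    |Real.exp (-t * α k)| ≤ 1 := by
  rw [Real.abs_exp, Real.exp_le_one_iff]
  nlinarith [mul_nonneg ht (hα k).le]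

theorem inner_expA (hα : ∀ k, 0 < α k) {t : ℝ} (ht : 0 ≤ t) (x : H) (k : ι) :
    ⟪e k, expA e α t x⟫_ℝ = Real.exp (-t * α k) * ⟪e k, x⟫_ℝ :=
  inner_diagOp e (summable_diag e (abs_exp_le_one hα ht) x) k

theorem expA_add (hα : ∀ k, 0 < α k) {t : ℝ} (ht : 0 ≤ t) (x y : H) :
    expA e α t (x + y) = expA e α t x + expA e α t y :=
  ext_inner_basis e fun k => by
    simp only [inner_expA e hα ht, inner_add_right]; ring

theorem expA_smul (hα : ∀ k, 0 < α k) {t : ℝ} (ht : 0 ≤ t) (c : ℝ) (x : H) :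
    expA e α t (c • x) = c • expA e α t x :=
  ext_inner_basis e fun k => by
    simp only [inner_expA e hα ht, inner_smul_right]; ring

theorem norm_expA_le (hα : ∀ k, 0 < α k) {t : ℝ} (ht : 0 ≤ t) (x : H) :
    ‖expA e α t x‖ ≤ ‖x‖ := by
  refine abs_le_of_sq_le_sq' ?_ (norm_nonneg _) |>.2
  have hd := summable_diag e (abs_exp_le_one hα ht) x
  rw [expA, norm_sq_diagOp e hd, ← (hasSum_sq_inner e x).tsum_eq]
  refine hd.tsum_le_tsum (fun k => ?_) (hasSum_sq_inner e x).summable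
  rw [mul_pow]
  exact mul_le_of_le_one_left (sq_nonneg _) ((sq_le_one_iff_abs_le_one _).2 (abs_exp_le_one hα ht k))

/-- `e^{tA}` as a bounded operator. -/
noncomputable def expCLM (hα : ∀ k, 0 < α k) {t : ℝ} (ht : 0 ≤ t) : H →L[ℝ] H :=
  LinearMap.mkContinuous
    { toFun := expA e α t
      map_add' := expA_add e hα ht
      map_smul' := expA_smul e hα ht } 1 fun x => by
    rw [one_mul]; exact norm_expA_le e hα ht x

theorem continuous_expA (hα : ∀ k, 0 < α k) {t : ℝ} (ht : 0 ≤ t) :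
    Continuous (expA e α t) := (expCLM e hα ht).continuous

theorem expA_basis (hα : ∀ k, 0 < α k) {t : ℝ} (ht : 0 ≤ t) (k : ι) :
    expA e α t (e k) = Real.exp (-t * α k) • e k :=
  ext_inner_basis e fun j => by
    rw [inner_expA e hα ht, inner_smul_right]
    by_cases h : j = k
    · subst h; rfl
    · rw [e.orthonormal.2 h, mul_zero, mul_zero]

theorem expA_expA (hα : ∀ k, 0 < α k) {s t : ℝ} (hs : 0 ≤ s) (ht : 0 ≤ t) (x : H) :
    expA e α s (expA e α t x) = expA e α (s + t) x :=
  ext_inner_basis e fun k => by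
    rw [inner_expA e hα hs, inner_expA e hα ht, inner_expA e hα (add_nonneg hs ht), ← mul_assoc,
      ← Real.exp_add]
    congr 2; ring

theorem measurable_ouMap_uncurry (α : ι → ℝ) :
    Measurable fun p : ℝ × H × (ι → ℝ) => ouMap e α p.1 p.2.1 p.2.2 := by
  unfold ouMap expA diagOp gaussSeries ouVar
  refine Measurable.add (measurable_series e fun k => ?_) (measurable_series e fun k => ?_)
  · fun_prop
  · have : Measurable fun p : ℝ × H × (ι → ℝ) => p.2.2 k :=
      (measurable_pi_apply k).comp (measurable_snd.comp measurable_snd)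
    fun_prop

theorem measurable_ouMap (α : ι → ℝ) (t : ℝ) :
    Measurable fun p : H × (ι → ℝ) => ouMap e α t p.1 p.2 :=
  (measurable_ouMap_uncurry e α).comp (measurable_const.prodMk measurable_id)

theorem measurable_ouMap_right (α : ι → ℝ) (t : ℝ) (x : H) : Measurable (ouMap e α t x) :=
  (measurable_ouMap e α t).comp (measurable_const.prodMk measurable_id)

theorem ouSemigroup_eq (α : ι → ℝ) (t : ℝ) {φ : H → ℝ} (hφ : Measurable φ) (x : H) :
    ouSemigroup e α t φ x = ∫ ξ, φ (ouMap e α t x ξ) ∂(whiteNoise ι) :=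
  integral_gaussian e _ _ hφ

theorem measurable_ouSemigroup_uncurry (α : ι → ℝ) {φ : H → ℝ} (hφ : Measurable φ) :
    Measurable fun p : ℝ × H => ouSemigroup e α p.1 φ p.2 := by
  simp_rw [ouSemigroup_eq e α _ hφ]
  have h : Measurable fun p : (ℝ × H) × (ι → ℝ) => φ (ouMap e α p.1.1 p.1.2 p.2) :=
    hφ.comp ((measurable_ouMap_uncurry e α).comp (f := fun p : (ℝ × H) × (ι → ℝ) =>
      (p.1.1, p.1.2, p.2)) (by fun_prop))
  exact h.stronglyMeasurable.integral_prod_right'.measurable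

theorem measurable_ouSemigroup (α : ι → ℝ) (t : ℝ) {φ : H → ℝ} (hφ : Measurable φ) :
    Measurable (ouSemigroup e α t φ) :=
  (measurable_ouSemigroup_uncurry e α hφ).comp (measurable_const.prodMk measurable_id)

theorem abs_ouSemigroup_le (α : ι → ℝ) (t : ℝ) {φ : H → ℝ} {K : ℝ}
    (hK : ∀ x, |φ x| ≤ K) (x : H) : |ouSemigroup e α t φ x| ≤ K := by
  have := norm_integral_le_of_norm_le_const (μ := gaussian e (expA e α t x)
    fun k => (1 - Real.exp (-2 * t * α k)) / (2 * α k)) (f := φ) (ae_of_all _ fun ξ => hK _)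
  rw [probReal_univ, mul_one] at this
  exact this

theorem invMeasure_eq_map (α : ι → ℝ) : invMeasure e α
    = (whiteNoise ι).map (gaussSeries e fun k => 1 / (2 * α k)) := by
  rw [invMeasure, gaussian_eq_map]
  simp

instance (α : ι → ℝ) : IsProbabilityMeasure (invMeasure e α) := by
  unfold invMeasure; infer_instance

theorem isOpenPosMeasure_invMeasure (hα : ∀ k, 0 < α k) (hs : Summable fun k => 1 / (2 * α k)) :
    (invMeasure e α).IsOpenPosMeasure :=
  isOpenPosMeasure_gaussian e (fun k => by have := hα k; positivity) hs

/-- The measure `μ` is invariant. -/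
theorem measurePreserving_ouMap (hα : ∀ k, 0 < α k) (hs : Summable fun k => 1 / (2 * α k))
    {t : ℝ} (ht : 0 ≤ t) :
    MeasurePreserving (fun p : H × (ι → ℝ) => ouMap e α t p.1 p.2)
      ((invMeasure e α).prod (whiteNoise ι)) (invMeasure e α) := by
  refine ⟨measurable_ouMap e α t, ?_⟩
  have h := map_diagOp_gaussSeries_add e (q := fun k => 1 / (2 * α k)) (q' := ouVar α t)
    (a := fun k => Real.exp (-t * α k)) (fun k => by have := hα k; positivity) hs
    (ouVar_nonneg hα ht) (summable_ouVar hα hs ht) (abs_exp_le_one hα ht)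
  simp_rw [ouVar_add_inv hα] at h
  rw [← invMeasure_eq_map] at h
  have hid : (invMeasure e α).prod (whiteNoise ι) = ((whiteNoise ι).prod (whiteNoise ι)).map
      (Prod.map (gaussSeries e fun k => 1 / (2 * α k)) id) := by
    rw [← Measure.map_prod_map _ _ (measurable_gaussSeries e _) measurable_id, Measure.map_id,
      invMeasure_eq_map]
  rw [hid, Measure.map_map (measurable_ouMap e α t)
    ((measurable_gaussSeries e _).prodMap measurable_id)]
  exact h

/-- The Markov property. -/
theorem map_ouMap_ouMap (hα : ∀ k, 0 < α k) (hs : Summable fun k => 1 / (2 * α k))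
    {s t : ℝ} (hs0 : 0 ≤ s) (ht : 0 ≤ t) (x : H) :
    ((whiteNoise ι).prod (whiteNoise ι)).map
        (fun p => ouMap e α s (ouMap e α t x p.1) p.2)
      = (whiteNoise ι).map (ouMap e α (s + t) x) := by
  have h := map_diagOp_gaussSeries_add e (q := ouVar α t) (q' := ouVar α s)
    (a := fun k => Real.exp (-s * α k)) (ouVar_nonneg hα ht) (summable_ouVar hα hs ht)
    (ouVar_nonneg hα hs0) (summable_ouVar hα hs hs0) (abs_exp_le_one hα hs0)
  simp_rw [ouVar_add hα] at h
  have h1 : ouMap e α (s + t) x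
      = (fun y => expA e α (s + t) x + y) ∘ gaussSeries e (ouVar α (s + t)) := rfl
  have h2 : (fun p : (ι → ℝ) × (ι → ℝ) => ouMap e α s (ouMap e α t x p.1) p.2)
      = (fun y => expA e α (s + t) x + y) ∘ fun p : (ι → ℝ) × (ι → ℝ) =>
        expA e α s (gaussSeries e (ouVar α t) p.1) + gaussSeries e (ouVar α s) p.2 := by
    ext p
    simp only [ouMap, Function.comp, expA_add e hα hs0, expA_expA e hα hs0 ht, add_assoc]
  have h3 : Measurable fun p : (ι → ℝ) × (ι → ℝ) =>
        expA e α s (gaussSeries e (ouVar α t) p.1) + gaussSeries e (ouVar α s) p.2 :=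
    (((continuous_expA e hα hs0).measurable.comp (measurable_gaussSeries e _)).comp
      measurable_fst).add ((measurable_gaussSeries e _).comp measurable_snd)
  rw [h1, h2, ← Measure.map_map (measurable_const_add _) h3,
    ← Measure.map_map (measurable_const_add _) (measurable_gaussSeries e _)]
  congr 1

theorem ouSemigroup_ouSemigroup (hα : ∀ k, 0 < α k) (hs : Summable fun k => 1 / (2 * α k))
    {s t : ℝ} (hs0 : 0 ≤ s) (ht : 0 ≤ t) {φ : H → ℝ} (hφ : Measurable φ) (x : H)
    (hi : Integrable (fun ξ => φ (ouMap e α (s + t) x ξ)) (whiteNoise ι)) :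
    ouSemigroup e α t (ouSemigroup e α s φ) x = ouSemigroup e α (s + t) φ x := by
  rw [ouSemigroup_eq e α t (measurable_ouSemigroup e α s hφ), ouSemigroup_eq e α _ hφ]
  simp_rw [ouSemigroup_eq e α s hφ]
  have hm := measurable_ouMap_right e α (s + t) x
  have hm2 : Measurable fun p : (ι → ℝ) × (ι → ℝ) => ouMap e α s (ouMap e α t x p.1) p.2 :=
    (measurable_ouMap e α s).comp
      (((measurable_ouMap_right e α t x).comp measurable_fst).prodMk measurable_snd)
  have hi' : Integrable φ ((whiteNoise ι).map (ouMap e α (s + t) x)) :=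
    (integrable_map_measure hφ.aestronglyMeasurable hm.aemeasurable).2 hi
  rw [← integral_map (φ := ouMap e α (s + t) x) hm.aemeasurable hφ.aestronglyMeasurable]
  rw [← map_ouMap_ouMap e hα hs hs0 ht x] at hi' ⊢
  rw [integral_map hm2.aemeasurable hφ.aestronglyMeasurable]
  exact (integral_prod _ ((integrable_map_measure hφ.aestronglyMeasurable
    hm2.aemeasurable).1 hi')).symm

theorem lintegral_lintegral_ouMap (hα : ∀ k, 0 < α k) (hs : Summable fun k => 1 / (2 * α k))
    {t : ℝ} (ht : 0 ≤ t) {f : H → ℝ≥0∞} (hf : Measurable f) :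
    ∫⁻ x, ∫⁻ ξ, f (ouMap e α t x ξ) ∂(whiteNoise ι) ∂(invMeasure e α)
      = ∫⁻ x, f x ∂(invMeasure e α) := by
  have h := lintegral_prod (μ := invMeasure e α) (ν := whiteNoise ι) _
    (hf.comp (measurable_ouMap e α t)).aemeasurable
  exact h.symm.trans ((measurePreserving_ouMap e hα hs ht).lintegral_comp hf)

theorem ae_ae_ouMap (hα : ∀ k, 0 < α k) (hs : Summable fun k => 1 / (2 * α k))
    {t : ℝ} (ht : 0 ≤ t) {p : H → Prop} (hp : ∀ᵐ x ∂(invMeasure e α), p x) :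
    ∀ᵐ x ∂(invMeasure e α), ∀ᵐ ξ ∂(whiteNoise ι), p (ouMap e α t x ξ) :=
  Measure.ae_ae_of_ae_prod ((measurePreserving_ouMap e hα hs ht).quasiMeasurePreserving.ae hp)

/-- Averaging the transition laws over `μ` gives back `μ`, so a `μ`-null set is null for the
transition law from almost every starting point. Hence the semigroup acts on classes in `L²(μ)`. -/
theorem ouSemigroup_congr_ae (hα : ∀ k, 0 < α k) (hs : Summable fun k => 1 / (2 * α k))
    {t : ℝ} (ht : 0 ≤ t) {φ φ' : H → ℝ} (h : φ =ᵐ[invMeasure e α] φ') :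
    ouSemigroup e α t φ =ᵐ[invMeasure e α] ouSemigroup e α t φ' := by
  obtain ⟨N, hN, hNm, hN0⟩ := exists_measurable_superset_of_null (ae_iff.1 h)
  have hN' : ∀ᵐ x ∂(invMeasure e α), x ∉ N := measure_eq_zero_iff_ae_notMem.1 hN0
  filter_upwards [ae_ae_ouMap e hα hs ht hN'] with x hx
  refine integral_congr_ae ?_
  rw [gaussian_eq_map]
  have hm := measurable_ouMap_right e α t x
  have := (ae_map_iff (p := fun y => y ∉ N) hm.aemeasurable hNm.compl).2 hx
  exact this.mono fun y hy => by_contra fun h => hy (hN h)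

theorem memLp_ouMap (hα : ∀ k, 0 < α k) (hs : Summable fun k => 1 / (2 * α k))
    {t : ℝ} (ht : 0 ≤ t) {φ : H → ℝ} (hφ : Measurable φ) (h2 : MemLp φ 2 (invMeasure e α)) :
    ∀ᵐ x ∂(invMeasure e α), MemLp (fun ξ => φ (ouMap e α t x ξ)) 2 (whiteNoise ι) := by
  have h := lintegral_lintegral_ouMap e hα hs ht (f := fun x => ‖φ x‖ₑ ^ 2) (by fun_prop)
  have hfin : ∫⁻ x, ‖φ x‖ₑ ^ 2 ∂(invMeasure e α) ≠ ∞ := by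
    rw [← eLpNorm_two_sq]
    exact ENNReal.pow_ne_top h2.eLpNorm_ne_top
  rw [← h] at hfin
  have hm : Measurable fun p : H × (ι → ℝ) => ‖φ (ouMap e α t p.1 p.2)‖ₑ ^ 2 :=
    ((hφ.comp (measurable_ouMap e α t)).enorm).pow_const 2
  filter_upwards [ae_lt_top hm.lintegral_prod_right' hfin] with x hx
  refine ⟨(hφ.comp (measurable_ouMap_right e α t x)).aestronglyMeasurable, ?_⟩
  rw [← eLpNorm_two_sq] at hx
  exact (ENNReal.pow_lt_top_iff.1 hx).resolve_right two_ne_zero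

theorem enorm_ouSemigroup_sq_le (α : ι → ℝ) (t : ℝ) {φ : H → ℝ} (hφ : Measurable φ) (x : H) :
    ‖ouSemigroup e α t φ x‖ₑ ^ 2 ≤ ∫⁻ ξ, ‖φ (ouMap e α t x ξ)‖ₑ ^ 2 ∂(whiteNoise ι) := by
  rw [ouSemigroup_eq e α t hφ]
  refine (pow_le_pow_left' (enorm_integral_le_lintegral_enorm _) 2).trans (sq_lintegral_le _ ?_)
  exact (hφ.comp (measurable_ouMap_right e α t x)).enorm.aemeasurable

/-- Jensen's inequality at each point, then invariance of `μ`. -/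
theorem eLpNorm_ouSemigroup_le (hα : ∀ k, 0 < α k) (hs : Summable fun k => 1 / (2 * α k))
    {t : ℝ} (ht : 0 ≤ t) {φ : H → ℝ} (hφ : Measurable φ) :
    eLpNorm (ouSemigroup e α t φ) 2 (invMeasure e α) ≤ eLpNorm φ 2 (invMeasure e α) := by
  have := eLpNorm_two_le_of_lintegral_le (c := 1) (f := ouSemigroup e α t φ) (f' := φ)
    (ν := invMeasure e α) (ν' := invMeasure e α) ?_
  · simpa using this
  · rw [one_pow, one_mul, ← lintegral_lintegral_ouMap e hα hs ht (f := fun x => ‖φ x‖ₑ ^ 2)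
      (by fun_prop)]
    exact lintegral_mono fun x => enorm_ouSemigroup_sq_le e α t hφ x

theorem memLp_ouSemigroup (hα : ∀ k, 0 < α k) (hs : Summable fun k => 1 / (2 * α k))
    {t : ℝ} (ht : 0 ≤ t) {φ : H → ℝ} (hφ : Measurable φ) (h2 : MemLp φ 2 (invMeasure e α)) :
    MemLp (ouSemigroup e α t φ) 2 (invMeasure e α) :=
  ⟨(measurable_ouSemigroup e α t hφ).aestronglyMeasurable,
    (eLpNorm_ouSemigroup_le e hα hs ht hφ).trans_lt h2.2⟩

theorem tendsto_expA (hα : ∀ k, 0 < α k) (x : H) :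
    Tendsto (fun t => expA e α t x) (𝓝[>] 0) (𝓝 x) := by
  rw [tendsto_iff_norm_sub_tendsto_zero]
  have hsq : ∀ t, 0 < t → ‖expA e α t x - x‖ ^ 2
      = ∑' k, ((Real.exp (-t * α k) - 1) * ⟪e k, x⟫_ℝ) ^ 2 := by
    intro t ht
    rw [← (hasSum_sq_inner e _).tsum_eq]
    refine tsum_congr fun k => ?_
    rw [inner_sub_right, inner_expA e hα ht.le]
    ring
  have h : Tendsto (fun t : ℝ => ∑' k, ((Real.exp (-t * α k) - 1) * ⟪e k, x⟫_ℝ) ^ 2) (𝓝[>] 0)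
      (𝓝 (∑' k : ι, 0)) := by
    refine tendsto_tsum_of_dominated_convergence (hasSum_sq_inner e x).summable (fun k => ?_) ?_
    · have : Continuous fun t : ℝ => ((Real.exp (-t * α k) - 1) * ⟪e k, x⟫_ℝ) ^ 2 := by fun_prop
      have := this.tendsto 0
      simp only [neg_zero, zero_mul, Real.exp_zero, sub_self, ne_eq, OfNat.ofNat_ne_zero,
        not_false_eq_true, zero_pow] at this
      exact this.mono_left nhdsWithin_le_nhds
    · filter_upwards [self_mem_nhdsWithin] with t ht k
      have h1 := abs_exp_le_one hα (le_of_lt ht) k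
      have h2 := Real.exp_pos (-t * α k)
      rw [Real.abs_exp] at h1
      rw [Real.norm_eq_abs, abs_of_nonneg (sq_nonneg _), mul_pow]
      refine mul_le_of_le_one_left (sq_nonneg _) ?_
      rw [sq_le_one_iff_abs_le_one, abs_le]
      constructor <;> linarith
  rw [tsum_zero] at h
  have h2 := (Real.continuous_sqrt.tendsto 0).comp h
  rw [Real.sqrt_zero] at h2
  refine h2.congr' ?_
  filter_upwards [self_mem_nhdsWithin] with t ht
  simp only [Function.comp]
  rw [← hsq t ht, Real.sqrt_sq (norm_nonneg _)]

/-- For fixed noise the squared norm is a series dominated, uniformly in `t`, by its stationary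
counterpart, which is almost surely summable; each term vanishes as `t → 0`. -/
theorem tendsto_gaussSeries_ouVar (hα : ∀ k, 0 < α k) (hs : Summable fun k => 1 / (2 * α k)) :
    ∀ᵐ ξ ∂(whiteNoise ι), Tendsto (fun t => gaussSeries e (ouVar α t) ξ) (𝓝[>] 0) (𝓝 0) := by
  filter_upwards [ae_summable_coord (q := fun k => 1 / (2 * α k))
    (fun k => by have := hα k; positivity) hs] with ξ hξ
  have hle : ∀ t, 0 < t → ∀ k, (√(ouVar α t k) * ξ k) ^ 2 ≤ 1 / (2 * α k) * ξ k ^ 2 := by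
    intro t ht k
    rw [mul_pow, Real.sq_sqrt (ouVar_nonneg hα ht.le k)]
    exact mul_le_mul_of_nonneg_right (ouVar_le hα t k) (sq_nonneg _)
  rw [tendsto_zero_iff_norm_tendsto_zero]
  have h : Tendsto (fun t : ℝ => ∑' k, (√(ouVar α t k) * ξ k) ^ 2) (𝓝[>] 0)
      (𝓝 (∑' k : ι, 0)) := by
    refine tendsto_tsum_of_dominated_convergence hξ (fun k => ?_) ?_
    · have : Continuous fun t : ℝ => (√(ouVar α t k) * ξ k) ^ 2 := by unfold ouVar; fun_prop
      have := this.tendsto 0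
      simp only [ouVar, mul_zero, zero_mul, Real.exp_zero, sub_self, zero_div, Real.sqrt_zero,
        ne_eq, OfNat.ofNat_ne_zero, not_false_eq_true, zero_pow] at this
      exact this.mono_left nhdsWithin_le_nhds
    · filter_upwards [self_mem_nhdsWithin] with t ht k
      rw [Real.norm_eq_abs, abs_of_nonneg (sq_nonneg _)]
      exact hle t ht k
  rw [tsum_zero] at h
  have h2 := (Real.continuous_sqrt.tendsto 0).comp h
  rw [Real.sqrt_zero] at h2
  refine h2.congr' ?_
  filter_upwards [self_mem_nhdsWithin] with t ht
  simp only [Function.comp]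
  rw [gaussSeries, ← norm_sq_series e (Summable.of_nonneg_of_le (fun _ => sq_nonneg _) (hle t ht) hξ),
    Real.sqrt_sq (norm_nonneg _)]

theorem tendsto_ouSemigroup_of_continuous (hα : ∀ k, 0 < α k)
    (hs : Summable fun k => 1 / (2 * α k)) {φ : H → ℝ} (hφ : Continuous φ) {K : ℝ}
    (hK : ∀ x, |φ x| ≤ K) (x : H) :
    Tendsto (fun t => ouSemigroup e α t φ x) (𝓝[>] 0) (𝓝 (φ x)) := by
  simp_rw [ouSemigroup_eq e α _ hφ.measurable]
  have h1 : φ x = ∫ _, φ x ∂(whiteNoise ι) := by simp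
  rw [h1]
  refine tendsto_integral_filter_of_dominated_convergence (fun _ => K)
    (.of_forall fun t => (hφ.measurable.comp (measurable_ouMap_right e α t x)).aestronglyMeasurable)
    (.of_forall fun t => ae_of_all _ fun ξ => hK _) (integrable_const _) ?_
  filter_upwards [tendsto_gaussSeries_ouVar e hα hs] with ξ hξ
  have := (tendsto_expA e hα x).add hξ
  rw [add_zero] at this
  exact (hφ.tendsto x).comp this

theorem tendsto_eLpNorm_ouSemigroup_of_continuous (hα : ∀ k, 0 < α k)
    (hs : Summable fun k => 1 / (2 * α k)) {φ : H → ℝ} (hφ : Continuous φ) {K : ℝ}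
    (hK : ∀ x, |φ x| ≤ K) :
    Tendsto (fun t => eLpNorm (fun x => ouSemigroup e α t φ x - φ x) 2 (invMeasure e α))
      (𝓝[>] 0) (𝓝 0) := by
  rw [tendsto_eLpNorm_two_zero_iff]
  have h0 : (0 : ℝ≥0∞) = ∫⁻ _, 0 ∂(invMeasure e α) := by simp
  rw [h0]
  refine tendsto_lintegral_filter_of_dominated_convergence (fun _ => ENNReal.ofReal (2 * K) ^ 2)
    (.of_forall fun t => ?_) (.of_forall fun t => ae_of_all _ fun x => ?_)
    (by rw [lintegral_const, measure_univ, mul_one]; exact ENNReal.pow_ne_top ENNReal.ofReal_ne_top)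
    (ae_of_all _ fun x => ?_)
  · exact (((measurable_ouSemigroup e α t hφ.measurable).sub hφ.measurable).enorm).pow_const 2
  · refine pow_le_pow_left' ?_ 2
    rw [← ofReal_norm, Real.norm_eq_abs]
    refine ENNReal.ofReal_le_ofReal ?_
    have h1 := abs_le.1 (abs_ouSemigroup_le e α t hK x)
    have h2 := abs_le.1 (hK x)
    rw [abs_le]
    constructor <;> linarith [h1.1, h1.2, h2.1, h2.2]
  · have := (tendsto_ouSemigroup_of_continuous e hα hs hφ hK x).sub_const (φ x)
    rw [sub_self] at this
    have := (((ENNReal.continuous_pow 2).comp continuous_enorm).tendsto 0).comp this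
    simpa [Function.comp_def] using this

end OrnsteinUhlenbeck

/-! ### Abstract contraction semigroups and their resolvents. -/

section ContractionSemigroup

variable {E : Type*} [NormedAddCommGroup E] [NormedSpace ℝ E]

/-- A strongly continuous semigroup of contractions (the values at negative times are
irrelevant). -/
structure IsContractionSemigroup (S : ℝ → E →L[ℝ] E) : Prop where
  norm_le : ∀ t, 0 ≤ t → ∀ v, ‖S t v‖ ≤ ‖v‖
  add : ∀ s t, 0 ≤ s → 0 ≤ t → ∀ v, S (s + t) v = S s (S t v)
  tendsto_zero : ∀ v, Tendsto (fun t => S t v) (𝓝[>] 0) (𝓝 v)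

/-- `v` is in the domain of the generator, and is mapped to `g`. -/
def HasGenerator (S : ℝ → E →L[ℝ] E) (v g : E) : Prop :=
  Tendsto (fun t : ℝ => t⁻¹ • (S t v - v) - g) (𝓝[>] 0) (𝓝 0)

variable {S : ℝ → E →L[ℝ] E}

theorem IsContractionSemigroup.norm_map_sub_le (hS : IsContractionSemigroup S) {s t : ℝ}
    (hs : 0 ≤ s) (hst : s ≤ t) (v : E) : ‖S t v - S s v‖ ≤ ‖S (t - s) v - v‖ := by
  have h := hS.add s (t - s) hs (sub_nonneg.2 hst) v
  rw [add_sub_cancel] at h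
  rw [h, ← map_sub]
  exact hS.norm_le s hs _

theorem IsContractionSemigroup.continuousOn (hS : IsContractionSemigroup S) (v : E) :
    ContinuousOn (fun t => S t v) (Set.Ioi 0) := by
  intro t ht
  rw [Metric.continuousWithinAt_iff]
  intro ε hε
  have h := (Metric.tendsto_nhdsWithin_nhds.1 (hS.tendsto_zero v)) ε hε
  obtain ⟨δ, hδ, h⟩ := h
  refine ⟨δ, hδ, fun s hs hst => ?_⟩
  rcases lt_trichotomy s t with hlt | rfl | hlt
  · rw [dist_comm, dist_eq_norm]
    refine (hS.norm_map_sub_le (le_of_lt hs) hlt.le v).trans_lt ?_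
    rw [← dist_eq_norm]
    refine h (sub_pos.2 hlt) ?_
    rw [dist_comm] at hst
    simpa [Real.dist_eq] using hst
  · simpa using hε
  · rw [dist_eq_norm]
    refine (hS.norm_map_sub_le (le_of_lt ht) hlt.le v).trans_lt ?_
    rw [← dist_eq_norm]
    refine h (sub_pos.2 hlt) ?_
    simpa [Real.dist_eq] using hst

theorem IsContractionSemigroup.integrableOn (hS : IsContractionSemigroup S) {lam : ℝ}
    (hl : 0 < lam) (v : E) :
    IntegrableOn (fun t => Real.exp (-lam * t) • S t v) (Set.Ioi 0) := by
  have h1 : IntegrableOn (fun t => Real.exp (-lam * t) * ‖v‖) (Set.Ioi 0) :=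
    (exp_neg_integrableOn_Ioi 0 hl).mul_const _
  refine Integrable.mono' h1 ?_ ?_
  · refine ContinuousOn.aestronglyMeasurable ?_ measurableSet_Ioi
    exact (Continuous.continuousOn (by fun_prop)).smul (hS.continuousOn v)
  · refine (ae_restrict_iff' measurableSet_Ioi).2 (ae_of_all _ fun t ht => ?_)
    rw [norm_smul, Real.norm_eq_abs, Real.abs_exp]
    exact mul_le_mul_of_nonneg_left (hS.norm_le t (le_of_lt ht) v) (Real.exp_pos _).le

theorem HasGenerator.sub {v w g h : E} (hv : HasGenerator S v g) (hw : HasGenerator S w h) :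
    HasGenerator S (v - w) (g - h) := by
  have := Tendsto.sub hv hw
  rw [sub_zero] at this
  refine this.congr fun t => ?_
  simp only [map_sub, smul_sub]
  abel

/-- The generator of a semigroup of contractions is dissipative. -/
theorem IsContractionSemigroup.eq_zero_of_generator (hS : IsContractionSemigroup S) {lam : ℝ}
    (hl : 0 < lam) {v : E} (hv : HasGenerator S v (lam • v)) : v = 0 := by
  by_contra hne
  have hpos : 0 < ‖v‖ := norm_pos_iff.2 hne
  have h1 : ∀ᶠ t in 𝓝[>] (0 : ℝ), ‖t⁻¹ • (S t v - v) - lam • v‖ < lam * ‖v‖ := by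
    have := hv.norm
    rw [norm_zero] at this
    exact this.eventually (gt_mem_nhds (by positivity))
  obtain ⟨t, ht, ht0⟩ := (h1.and self_mem_nhdsWithin).exists
  have ht0 : 0 < t := ht0
  -- Taking norms and using `‖S t v‖ ≤ ‖v‖` bounds `lam * ‖v‖` by the error of the difference
  -- quotient, which is smaller for small `t`.
  have h2 : (1 + t * lam) • v = S t v - t • (t⁻¹ • (S t v - v) - lam • v) := by
    rw [smul_sub, smul_smul, smul_smul, mul_inv_cancel₀ ht0.ne', one_smul, add_smul, one_smul]
    abel
  have h3 : (1 + t * lam) * ‖v‖ ≤ ‖v‖ + t * ‖t⁻¹ • (S t v - v) - lam • v‖ := by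
    have h4 := norm_sub_le (S t v) (t • (t⁻¹ • (S t v - v) - lam • v))
    rw [← h2, norm_smul, norm_smul, Real.norm_of_nonneg (by positivity),
      Real.norm_of_nonneg ht0.le] at h4
    linarith [hS.norm_le t ht0.le v]
  nlinarith

variable [CompleteSpace E]

theorem IsContractionSemigroup.tendsto_average (hS : IsContractionSemigroup S) (lam : ℝ) (v : E) :
    Tendsto (fun h : ℝ => h⁻¹ • ∫ t in (0 : ℝ)..h, Real.exp (-lam * t) • S t v) (𝓝[>] 0)
      (𝓝 v) := by
  have hc : Tendsto (fun t => Real.exp (-lam * t) • S t v) (𝓝[>] 0) (𝓝 v) := by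
    have h1 : Tendsto (fun t : ℝ => Real.exp (-lam * t)) (𝓝[>] 0) (𝓝 1) := by
      have : Continuous fun t : ℝ => Real.exp (-lam * t) := by fun_prop
      simpa using (this.tendsto 0).mono_left nhdsWithin_le_nhds
    simpa using h1.smul (hS.tendsto_zero v)
  rw [Metric.tendsto_nhdsWithin_nhds] at hc ⊢
  intro ε hε
  obtain ⟨δ, hδ, hd⟩ := hc (ε / 2) (half_pos hε)
  refine ⟨δ, hδ, fun h hh hhd => ?_⟩
  have hh : 0 < h := hh
  have hi : IntervalIntegrable (fun t => Real.exp (-lam * t) • S t v) volume 0 h := by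
    rw [intervalIntegrable_iff_integrableOn_Ioc_of_le hh.le]
    refine Integrable.of_bound ?_ (Real.exp (|lam| * h) * ‖v‖) ?_
    · refine ContinuousOn.aestronglyMeasurable ?_ measurableSet_Ioc
      have hexp : Continuous fun t : ℝ => Real.exp (-lam * t) := by fun_prop
      exact (hexp.continuousOn.smul (hS.continuousOn v)).mono Set.Ioc_subset_Ioi_self
    · refine (ae_restrict_iff' measurableSet_Ioc).2 (ae_of_all _ fun t ht => ?_)
      rw [norm_smul, Real.norm_eq_abs, Real.abs_exp]
      refine mul_le_mul (Real.exp_le_exp.2 ?_) (hS.norm_le t ht.1.le v) (norm_nonneg _)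
        (Real.exp_pos _).le
      have h5 : |lam| * t ≤ |lam| * h := mul_le_mul_of_nonneg_left ht.2 (abs_nonneg _)
      have h6 : -lam * t ≤ |lam| * t := mul_le_mul_of_nonneg_right (neg_le_abs lam) ht.1.le
      exact h6.trans h5
  have h1 : h⁻¹ • (∫ t in (0 : ℝ)..h, Real.exp (-lam * t) • S t v) - v
      = h⁻¹ • ∫ t in (0 : ℝ)..h, (Real.exp (-lam * t) • S t v - v) := by
    rw [intervalIntegral.integral_sub hi (by simp), intervalIntegral.integral_const, sub_zero,
      smul_sub, smul_smul, inv_mul_cancel₀ hh.ne', one_smul]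
  rw [dist_eq_norm, h1, norm_smul, Real.norm_of_nonneg (inv_nonneg.2 hh.le)]
  have h2 : ‖∫ t in (0 : ℝ)..h, (Real.exp (-lam * t) • S t v - v)‖ ≤ ε / 2 * |h - 0| := by
    refine intervalIntegral.norm_integral_le_of_norm_le_const fun t ht => ?_
    rw [Set.uIoc_of_le hh.le] at ht
    rw [← dist_eq_norm]
    refine (hd ht.1 ?_).le
    rw [Real.dist_eq, sub_zero, abs_of_pos hh] at hhd
    rw [Real.dist_eq, sub_zero, abs_of_pos ht.1]
    exact ht.2.trans_lt hhd
  rw [sub_zero, abs_of_pos hh] at h2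
  calc h⁻¹ * _ ≤ h⁻¹ * (ε / 2 * h) := by gcongr
    _ = ε / 2 := by field_simp
    _ < ε := half_lt_self hε

/-- The Laplace transform of a semigroup of contractions is the resolvent of its generator. -/
theorem IsContractionSemigroup.exists_resolvent (hS : IsContractionSemigroup S) {lam : ℝ}
    (hl : 0 < lam) : ∃ G : E →L[ℝ] E,
      (∀ v, G v = ∫ t in Set.Ioi (0 : ℝ), Real.exp (-lam * t) • S t v) ∧
      (∀ v, HasGenerator S (G v) (lam • G v - v)) ∧
      ∀ v g, HasGenerator S v g → v = G (lam • v - g) := by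
  have hbound : ∀ v, ‖∫ t in Set.Ioi (0 : ℝ), Real.exp (-lam * t) • S t v‖
      ≤ (∫ t in Set.Ioi (0 : ℝ), Real.exp (-lam * t)) * ‖v‖ := by
    intro v
    rw [← integral_mul_const]
    refine norm_integral_le_of_norm_le ((exp_neg_integrableOn_Ioi 0 hl).mul_const _) ?_
    refine (ae_restrict_iff' measurableSet_Ioi).2 (ae_of_all _ fun t ht => ?_)
    rw [norm_smul, Real.norm_eq_abs, Real.abs_exp]
    exact mul_le_mul_of_nonneg_left (hS.norm_le t (le_of_lt ht) v) (Real.exp_pos _).le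
  set G : E →L[ℝ] E := LinearMap.mkContinuous
    { toFun := fun v => ∫ t in Set.Ioi (0 : ℝ), Real.exp (-lam * t) • S t v
      map_add' := fun v w => by
        rw [← integral_add (hS.integrableOn hl v) (hS.integrableOn hl w)]
        simp [smul_add]
      map_smul' := fun c v => by
        rw [RingHom.id_apply, ← integral_smul]
        simp [smul_comm c] } _ hbound with hG
  have hGv : ∀ v, G v = ∫ t in Set.Ioi (0 : ℝ), Real.exp (-lam * t) • S t v := fun v => rfl
  have hgen : ∀ v, HasGenerator S (G v) (lam • G v - v) := by
    intro v
    -- The semigroup law turns the action of `S h` into a translation of the time variable, which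
    -- costs the factor `e^{λh}` and the initial piece `[0, h]` of the integral. The difference
    -- quotient then reduces to that of `e^{λh}` and to `tendsto_average`.
    have hshift : ∀ h, 0 < h → S h (G v) = Real.exp (lam * h) •
        (G v - ∫ t in (0 : ℝ)..h, Real.exp (-lam * t) • S t v) := by
      intro h hh
      have hi := hS.integrableOn hl v
      rw [hGv, ← ContinuousLinearMap.integral_comp_comm _ hi]
      have h1 : ∫ t in Set.Ioi (0 : ℝ), S h (Real.exp (-lam * t) • S t v)
          = ∫ t in Set.Ioi (0 : ℝ), Real.exp (lam * h) • (Real.exp (-lam * (t + h)) • S (t + h) v) := by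
        refine setIntegral_congr_fun measurableSet_Ioi fun t ht => ?_
        rw [map_smul, smul_smul, ← Real.exp_add, add_comm t h, hS.add h t hh.le (le_of_lt ht)]
        congr 2; ring
      have h2 := (measurePreserving_add_right volume h).setIntegral_preimage_emb
        (measurableEmbedding_addRight h) (fun t => Real.exp (-lam * t) • S t v) (Set.Ioi h)
      rw [Set.preimage_add_const_Ioi, sub_self] at h2
      rw [h1, integral_smul, h2]
      congr 1
      rw [eq_sub_iff_add_eq, add_comm, intervalIntegral.integral_of_le hh.le,
        ← setIntegral_union (Set.Ioc_disjoint_Ioi le_rfl) measurableSet_Ioi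
          (hi.mono_set Set.Ioc_subset_Ioi_self) (hi.mono_set (Set.Ioi_subset_Ioi hh.le)),
        Set.Ioc_union_Ioi_eq_Ioi hh.le]
    have he : Tendsto (fun h : ℝ => h⁻¹ * (Real.exp (lam * h) - 1)) (𝓝[>] 0) (𝓝 lam) := by
      have h1 : HasDerivAt (fun h : ℝ => Real.exp (lam * h)) lam 0 := by
        have := ((hasDerivAt_id (0 : ℝ)).const_mul lam).exp
        simpa using this
      have h2 := (hasDerivAt_iff_tendsto_slope_zero.1 h1).mono_left
        (nhdsWithin_mono 0 fun x (hx : x ∈ Set.Ioi (0 : ℝ)) => ne_of_gt hx)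
      simpa using h2
    have he1 : Tendsto (fun h : ℝ => Real.exp (lam * h)) (𝓝[>] 0) (𝓝 1) := by
      have : Continuous fun t : ℝ => Real.exp (lam * t) := by fun_prop
      simpa using (this.tendsto 0).mono_left nhdsWithin_le_nhds
    have hlim := ((he.smul_const (G v)).sub (he1.smul (hS.tendsto_average lam v))).sub_const
      (lam • G v - v)
    rw [one_smul, sub_self] at hlim
    refine hlim.congr' ?_
    filter_upwards [self_mem_nhdsWithin] with h hh
    rw [hshift h hh]
    rw [mul_smul, smul_comm (Real.exp (lam * h)) h⁻¹, ← smul_sub, sub_smul, one_smul,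
      smul_sub (Real.exp (lam * h))]
    congr 2
    abel
  refine ⟨G, hGv, hgen, fun v g hv => ?_⟩
  -- The difference `w = v - G(λv - g)` is mapped to `λw` by the generator, and dissipativity
  -- excludes `w ≠ 0`.
  have h := hv.sub (hgen (lam • v - g))
  have h2 : g - (lam • G (lam • v - g) - (lam • v - g)) = lam • (v - G (lam • v - g)) := by
    rw [smul_sub]; abel
  rw [h2] at h
  exact sub_eq_zero.1 (hS.eq_zero_of_generator hl h)

end ContractionSemigroup

/-! ### The Ornstein-Uhlenbeck semigroup and its resolvent on `L²(μ)`. -/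

section L2Semigroup

variable {H : Type*} [NormedAddCommGroup H] [InnerProductSpace ℝ H] [CompleteSpace H]
  [MeasurableSpace H] [BorelSpace H] [SecondCountableTopology H]
  {ι : Type*} [Countable ι] (e : HilbertBasis ι ℝ H) {α : ι → ℝ}

theorem ouSemigroup_add_ae (hα : ∀ k, 0 < α k) (hs : Summable fun k => 1 / (2 * α k))
    {t : ℝ} (ht : 0 ≤ t) {φ ψ : H → ℝ} (hφ : Measurable φ) (hψ : Measurable ψ)
    (hφ2 : MemLp φ 2 (invMeasure e α)) (hψ2 : MemLp ψ 2 (invMeasure e α)) :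
    ouSemigroup e α t (fun x => φ x + ψ x)
      =ᵐ[invMeasure e α] fun x => ouSemigroup e α t φ x + ouSemigroup e α t ψ x := by
  filter_upwards [memLp_ouMap e hα hs ht hφ hφ2, memLp_ouMap e hα hs ht hψ hψ2] with x h1 h2
  rw [ouSemigroup_eq e α t (φ := fun x => φ x + ψ x) (hφ.add hψ), ouSemigroup_eq e α t hφ, ouSemigroup_eq e α t hψ]
  exact integral_add (h1.integrable one_le_two) (h2.integrable one_le_two)

theorem ouSemigroup_const_mul (α : ι → ℝ) (t c : ℝ) (φ : H → ℝ) (x : H) :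
    ouSemigroup e α t (fun x => c * φ x) x = c * ouSemigroup e α t φ x :=
  integral_const_mul _ _

theorem memLp_ouSemigroup_coe (hα : ∀ k, 0 < α k) (hs : Summable fun k => 1 / (2 * α k))
    {t : ℝ} (ht : 0 ≤ t) (φ : Lp ℝ 2 (invMeasure e α)) :
    MemLp (ouSemigroup e α t φ) 2 (invMeasure e α) :=
  memLp_ouSemigroup e hα hs ht (Lp.stronglyMeasurable φ).measurable (Lp.memLp φ)

/-- The Ornstein-Uhlenbeck semigroup on `L²(μ)`. -/
noncomputable def ouOp (hα : ∀ k, 0 < α k) (hs : Summable fun k => 1 / (2 * α k)) (t : ℝ) :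
    Lp ℝ 2 (invMeasure e α) →L[ℝ] Lp ℝ 2 (invMeasure e α) :=
  LinearMap.mkContinuous
    -- The time is clamped to `max t 0`, so that the operator is defined, and a contraction, for
    -- every real `t`.
    { toFun := fun φ => (memLp_ouSemigroup_coe e hα hs (le_max_right t 0) φ).toLp _
      map_add' := fun φ ψ => by
        rw [← MemLp.toLp_add, MemLp.toLp_eq_toLp_iff]
        exact (ouSemigroup_congr_ae e hα hs (le_max_right t 0) (Lp.coeFn_add φ ψ)).trans
          (ouSemigroup_add_ae e hα hs (le_max_right t 0) (Lp.stronglyMeasurable φ).measurable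
            (Lp.stronglyMeasurable ψ).measurable (Lp.memLp φ) (Lp.memLp ψ))
      map_smul' := fun c φ => by
        rw [RingHom.id_apply, ← MemLp.toLp_const_smul, MemLp.toLp_eq_toLp_iff]
        exact (ouSemigroup_congr_ae e hα hs (le_max_right t 0) (Lp.coeFn_smul c φ)).trans
          (ae_of_all _ fun x => ouSemigroup_const_mul e α _ c φ x) } 1 fun φ => by
    rw [one_mul, LinearMap.coe_mk, AddHom.coe_mk, Lp.norm_toLp, Lp.norm_def]
    exact ENNReal.toReal_mono (Lp.eLpNorm_ne_top φ)
      (eLpNorm_ouSemigroup_le e hα hs (le_max_right t 0) (Lp.stronglyMeasurable φ).measurable)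

theorem ouOp_coe (hα : ∀ k, 0 < α k) (hs : Summable fun k => 1 / (2 * α k)) {t : ℝ}
    (ht : 0 ≤ t) (φ : Lp ℝ 2 (invMeasure e α)) :
    ouOp e hα hs t φ =ᵐ[invMeasure e α] ouSemigroup e α t φ := by
  have h : ouOp e hα hs t φ = (memLp_ouSemigroup_coe e hα hs (le_max_right t 0) φ).toLp _ := rfl
  rw [h]
  refine (MemLp.coeFn_toLp _).trans ?_
  rw [max_eq_left ht]

theorem ouOp_toLp (hα : ∀ k, 0 < α k) (hs : Summable fun k => 1 / (2 * α k)) {t : ℝ}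
    (ht : 0 ≤ t) {φ : H → ℝ} (hφ : MemLp φ 2 (invMeasure e α)) :
    ouOp e hα hs t (hφ.toLp φ) =ᵐ[invMeasure e α] ouSemigroup e α t φ :=
  (ouOp_coe e hα hs ht _).trans (ouSemigroup_congr_ae e hα hs ht hφ.coeFn_toLp)

theorem norm_ouOp_le (hα : ∀ k, 0 < α k) (hs : Summable fun k => 1 / (2 * α k)) (t : ℝ)
    (φ : Lp ℝ 2 (invMeasure e α)) : ‖ouOp e hα hs t φ‖ ≤ ‖φ‖ := by
  have := (ouOp e hα hs t).le_of_opNorm_le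
    (LinearMap.mkContinuous_norm_le _ zero_le_one _) φ
  rwa [one_mul] at this

theorem isContractionSemigroup_ouOp (hα : ∀ k, 0 < α k)
    (hs : Summable fun k => 1 / (2 * α k)) : IsContractionSemigroup (ouOp e hα hs) where
  norm_le t _ φ := norm_ouOp_le e hα hs t φ
  add s t hs0 ht φ := by
    rw [add_comm]
    refine Lp.ext ?_
    have hφ := (Lp.stronglyMeasurable φ).measurable
    refine (ouOp_coe e hα hs (add_nonneg ht hs0) φ).trans ?_
    refine EventuallyEq.trans ?_ (ouOp_coe e hα hs hs0 _).symm
    refine EventuallyEq.trans ?_ (ouSemigroup_congr_ae e hα hs hs0 (ouOp_coe e hα hs ht φ)).symm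
    filter_upwards [memLp_ouMap e hα hs (add_nonneg ht hs0) hφ (Lp.memLp φ)] with x hx
    exact (ouSemigroup_ouSemigroup e hα hs ht hs0 hφ x (hx.integrable one_le_two)).symm
  tendsto_zero φ := by
    -- Strong continuity holds for bounded continuous functions by dominated convergence and extends
    -- by density, because the operators are contractions.
    have hd := BoundedContinuousFunction.toLp_denseRange (p := 2) (E := ℝ) (μ := invMeasure e α)
      ℝ (by simp)
    rw [Metric.tendsto_nhds]
    intro ε hε
    obtain ⟨g, hg⟩ := Metric.denseRange_iff.1 hd φ (ε / 3) (by positivity)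
    set ψ := BoundedContinuousFunction.toLp (E := ℝ) 2 (invMeasure e α) ℝ g with hψ
    have hψg : ψ =ᵐ[invMeasure e α] g := BoundedContinuousFunction.coeFn_toLp _ _ _ g
    have h1 : Tendsto (fun t => ouOp e hα hs t ψ) (𝓝[>] 0) (𝓝 ψ) := by
      rw [Lp.tendsto_Lp_iff_tendsto_eLpNorm']
      refine (tendsto_eLpNorm_ouSemigroup_of_continuous e hα hs g.continuous
        (fun x => g.norm_coe_le_norm x)).congr' ?_
      filter_upwards [self_mem_nhdsWithin] with t ht
      refine eLpNorm_congr_ae ?_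
      filter_upwards [ouOp_coe e hα hs (le_of_lt ht) ψ, hψg,
        ouSemigroup_congr_ae e hα hs (le_of_lt ht) hψg] with x h2 h3 h4
      rw [Pi.sub_apply, h2, h3, h4]
    filter_upwards [(Metric.tendsto_nhds.1 h1) (ε / 3) (by positivity)] with t ht
    have h2 : dist (ouOp e hα hs t φ) (ouOp e hα hs t ψ) ≤ dist φ ψ := by
      rw [dist_eq_norm, dist_eq_norm, ← map_sub]
      exact norm_ouOp_le e hα hs t _
    have h3 := dist_triangle4 (ouOp e hα hs t φ) (ouOp e hα hs t ψ) ψ φ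
    rw [dist_comm ψ φ] at h3
    linarith

theorem isGenerator_iff (hα : ∀ k, 0 < α k) (hs : Summable fun k => 1 / (2 * α k))
    {u g : H → ℝ} (hu : MemLp u 2 (invMeasure e α)) (hg : MemLp g 2 (invMeasure e α)) :
    IsGenerator e α u g ↔ HasGenerator (ouOp e hα hs) (hu.toLp u) (hg.toLp g) := by
  rw [IsGenerator, HasGenerator, Lp.tendsto_Lp_iff_tendsto_eLpNorm']
  simp only [hu, hg, true_and]
  refine tendsto_congr' ?_
  filter_upwards [self_mem_nhdsWithin] with t ht
  refine eLpNorm_congr_ae ?_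
  filter_upwards [Lp.coeFn_sub (t⁻¹ • (ouOp e hα hs t (hu.toLp u) - hu.toLp u)) (hg.toLp g),
    Lp.coeFn_smul t⁻¹ (ouOp e hα hs t (hu.toLp u) - hu.toLp u),
    Lp.coeFn_sub (ouOp e hα hs t (hu.toLp u)) (hu.toLp u), hu.coeFn_toLp, hg.coeFn_toLp,
    ouOp_toLp e hα hs (le_of_lt ht) hu, Lp.coeFn_zero ℝ 2 (invMeasure e α)]
    with x h1 h2 h3 h4 h5 h6 h7
  simp only [Pi.sub_apply, h1, h2, h3, h4, h5, h6, h7, Pi.smul_apply, smul_eq_mul, Pi.zero_apply,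
    sub_zero]

/-- The resolvent of `L₂`. -/
noncomputable def ouRes (hα : ∀ k, 0 < α k) (hs : Summable fun k => 1 / (2 * α k)) {lam : ℝ}
    (hl : 0 < lam) : Lp ℝ 2 (invMeasure e α) →L[ℝ] Lp ℝ 2 (invMeasure e α) :=
  ((isContractionSemigroup_ouOp e hα hs).exists_resolvent hl).choose

theorem ouRes_eq (hα : ∀ k, 0 < α k) (hs : Summable fun k => 1 / (2 * α k)) {lam : ℝ}
    (hl : 0 < lam) (φ : Lp ℝ 2 (invMeasure e α)) : ouRes e hα hs hl φ
      = ∫ t in Set.Ioi (0 : ℝ), Real.exp (-lam * t) • ouOp e hα hs t φ :=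
  ((isContractionSemigroup_ouOp e hα hs).exists_resolvent hl).choose_spec.1 φ

theorem IsResolventOf.memLp {lam : ℝ} {φ v : H → ℝ} (h : IsResolventOf e α lam φ v) :
    MemLp φ 2 (invMeasure e α) := by
  obtain ⟨Lv, hgen, heq⟩ := h
  exact (memLp_congr_ae heq).1 ((hgen.1.const_mul lam).sub hgen.2.1)

/-- All later use of `D(L₂)` passes through this equivalence, which replaces the generator, defined
by a limit, by a bounded operator. -/
theorem isResolventOf_iff (hα : ∀ k, 0 < α k) (hs : Summable fun k => 1 / (2 * α k)) {lam : ℝ}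
    (hl : 0 < lam) {φ v : H → ℝ} (hφ : MemLp φ 2 (invMeasure e α)) :
    IsResolventOf e α lam φ v ↔ v =ᵐ[invMeasure e α] ouRes e hα hs hl (hφ.toLp φ) := by
  have hspec := ((isContractionSemigroup_ouOp e hα hs).exists_resolvent hl).choose_spec.2
  constructor
  · rintro ⟨Lv, hgen, heq⟩
    have h := hspec.2 _ _ ((isGenerator_iff e hα hs hgen.1 hgen.2.1).1 hgen)
    refine hgen.1.coeFn_toLp.symm.trans ?_
    rw [h]
    have : lam • hgen.1.toLp v - hgen.2.1.toLp Lv = hφ.toLp φ := by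
      rw [← MemLp.toLp_const_smul, ← MemLp.toLp_sub, MemLp.toLp_eq_toLp_iff]
      exact heq
    rw [this]
    rfl
  · intro h
    have hv : MemLp v 2 (invMeasure e α) := (memLp_congr_ae h).2 (Lp.memLp _)
    have hv' : hv.toLp v = ouRes e hα hs hl (hφ.toLp φ) := by
      conv_rhs => rw [← Lp.toLp_coeFn (ouRes e hα hs hl (hφ.toLp φ)) (Lp.memLp _)]
      rw [MemLp.toLp_eq_toLp_iff]
      exact h
    refine ⟨fun x => lam * v x - φ x, ?_, ae_of_all _ fun x => by ring⟩
    have hg : MemLp (fun x => lam * v x - φ x) 2 (invMeasure e α) := (hv.const_mul lam).sub hφ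
    rw [isGenerator_iff e hα hs hv hg]
    have h2 := hspec.1 (hφ.toLp φ)
    have h3 : hg.toLp _ = lam • hv.toLp v - hφ.toLp φ := by
      rw [← MemLp.toLp_const_smul, ← MemLp.toLp_sub, MemLp.toLp_eq_toLp_iff]
      rfl
    rw [h3, hv']
    exact h2

theorem isResolvent_ouRes (hα : ∀ k, 0 < α k) (hs : Summable fun k => 1 / (2 * α k)) {lam : ℝ}
    (hl : 0 < lam) : IsResolvent e α lam (ouRes e hα hs hl) := by
  intro φ v
  rw [isResolventOf_iff e hα hs hl (Lp.memLp φ), Lp.toLp_coeFn]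
  exact ⟨fun h => by rw [h], fun h => (Lp.ext h).symm⟩

/-- The resolvent of a bounded function, defined pointwise. -/
noncomputable def ouResFun (e : HilbertBasis ι ℝ H) (α : ι → ℝ) (lam : ℝ) (φ : H → ℝ) (x : H) :
    ℝ := ∫ t in Set.Ioi (0 : ℝ), Real.exp (-lam * t) * ouSemigroup e α t φ x

/-- The abstract resolvent is a Bochner integral in `L²(μ)`, whereas `ouResFun` integrates
pointwise. Pairing both with an arbitrary `ψ ∈ L²(μ)` and applying Fubini identifies them. -/
theorem isResolventOf_ouResFun (hα : ∀ k, 0 < α k) (hs : Summable fun k => 1 / (2 * α k))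
    {lam : ℝ} (hl : 0 < lam) {φ : H → ℝ} (hφ : Measurable φ) {K : ℝ} (hK : ∀ x, |φ x| ≤ K) :
    IsResolventOf e α lam φ (ouResFun e α lam φ) := by
  have hφ2 : MemLp φ 2 (invMeasure e α) := MemLp.of_bound hφ.aestronglyMeasurable K
    (ae_of_all _ hK)
  rw [isResolventOf_iff e hα hs hl hφ2]
  have hjm : Measurable fun p : ℝ × H => Real.exp (-lam * p.1) * ouSemigroup e α p.1 φ p.2 :=
    (Measurable.exp (by fun_prop)).mul (measurable_ouSemigroup_uncurry e α hφ)
  have hm : Measurable (ouResFun e α lam φ) := by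
    have h2 : Measurable fun p : H × ℝ => Real.exp (-lam * p.2) * ouSemigroup e α p.2 φ p.1 :=
      hjm.comp measurable_swap
    exact (h2.stronglyMeasurable.integral_prod_right' (ν := volume.restrict (Set.Ioi 0))).measurable
  have hexp := exp_neg_integrableOn_Ioi 0 hl
  have hb : ∀ x, |ouResFun e α lam φ x| ≤ ∫ t in Set.Ioi (0 : ℝ), Real.exp (-lam * t) * K := by
    intro x
    rw [ouResFun, ← Real.norm_eq_abs]
    refine norm_integral_le_of_norm_le (hexp.mul_const K) (ae_of_all _ fun t => ?_)
    rw [norm_mul, Real.norm_eq_abs, Real.abs_exp]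
    exact mul_le_mul_of_nonneg_left (abs_ouSemigroup_le e α t hK x) (Real.exp_pos _).le
  have hv2 : MemLp (ouResFun e α lam φ) 2 (invMeasure e α) :=
    MemLp.of_bound hm.aestronglyMeasurable _ (ae_of_all _ hb)
  suffices hv2.toLp _ = ouRes e hα hs hl (hφ2.toLp φ) by
    rw [← this]; exact hv2.coeFn_toLp.symm
  refine ext_inner_left ℝ fun ψ => ?_
  have hψ1 : Integrable ψ (invMeasure e α) := (Lp.memLp ψ).integrable one_le_two
  rw [ouRes_eq, L2.inner_def]
  have h1 := ContinuousLinearMap.integral_comp_comm (innerSL ℝ ψ)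
    ((isContractionSemigroup_ouOp e hα hs).integrableOn hl (hφ2.toLp φ))
  simp only [innerSL_apply_apply] at h1
  rw [← h1]
  have h2 : ∀ t ∈ Set.Ioi (0 : ℝ), ⟪ψ, Real.exp (-lam * t) • ouOp e hα hs t (hφ2.toLp φ)⟫_ℝ
      = ∫ x, ψ x * (Real.exp (-lam * t) * ouSemigroup e α t φ x) ∂(invMeasure e α) := by
    intro t ht
    rw [L2.inner_def]
    refine integral_congr_ae ?_
    filter_upwards [Lp.coeFn_smul (Real.exp (-lam * t)) (ouOp e hα hs t (hφ2.toLp φ)),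
      ouOp_toLp e hα hs (le_of_lt ht) hφ2] with x h3 h4
    rw [h3, Pi.smul_apply, h4, smul_eq_mul, real_inner_eq_re_inner, RCLike.inner_apply]
    simp [mul_comm]
  rw [setIntegral_congr_fun measurableSet_Ioi h2]
  have hI : Integrable (fun p : ℝ × H => ψ p.2 * (Real.exp (-lam * p.1) * ouSemigroup e α p.1 φ p.2))
      ((volume.restrict (Set.Ioi 0)).prod (invMeasure e α)) := by
    refine Integrable.mono' ((hexp.mul_const K).mul_prod hψ1.norm) ?_ (ae_of_all _ fun p => ?_)
    · exact (((Lp.stronglyMeasurable ψ).measurable.comp measurable_snd).mul hjm).aestronglyMeasurable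
    · rw [norm_mul, norm_mul, Real.norm_eq_abs (Real.exp _), Real.abs_exp, mul_comm]
      refine mul_le_mul_of_nonneg_right ?_ (norm_nonneg _)
      exact mul_le_mul_of_nonneg_left (abs_ouSemigroup_le e α p.1 hK p.2) (Real.exp_pos _).le
  rw [integral_integral_swap hI]
  refine integral_congr_ae ?_
  filter_upwards [hv2.coeFn_toLp] with x hx
  rw [hx, real_inner_eq_re_inner, RCLike.inner_apply, ouResFun, integral_const_mul]
  simp [mul_comm]

end L2Semigroup

/-! ### From continuous partial derivatives to a Fréchet gradient. -/

section PartialDerivatives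

variable {H : Type*} [NormedAddCommGroup H] [InnerProductSpace ℝ H] [CompleteSpace H]

theorem hasDerivAt_line_translate {u : H → ℝ} {g : H → H} {h : H}
    (hh : ∀ x, HasDerivAt (fun s : ℝ => u (x + s • h)) ⟪g x, h⟫_ℝ 0) (x : H) (a : ℝ) :
    HasDerivAt (fun s : ℝ => u (x + s • h)) ⟪g (x + a • h), h⟫_ℝ a := by
  have h2 : HasDerivAt (fun s : ℝ => s - a) 1 a := (hasDerivAt_id a).sub_const a
  have h3 := HasDerivAt.comp_of_eq a (hh (x + a • h)) h2 (sub_self a).symm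
  rw [mul_one] at h3
  refine h3.congr_of_eventuallyEq (.of_forall fun s => ?_)
  simp only [Function.comp, sub_smul, add_assoc, add_sub_cancel]

/-- On the plane through `x` spanned by the two directions both partial derivatives are continuous,
so the restriction of `u` is differentiable there; the claim is its derivative along the diagonal.
-/
theorem hasDerivAt_line_add {u : H → ℝ} {g : H → H} (hg : Continuous g) {h h' : H}
    (hh : ∀ x, HasDerivAt (fun s : ℝ => u (x + s • h)) ⟪g x, h⟫_ℝ 0)
    (hh' : ∀ x, HasDerivAt (fun s : ℝ => u (x + s • h')) ⟪g x, h'⟫_ℝ 0) (x : H) :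
    HasDerivAt (fun s : ℝ => u (x + s • (h + h'))) ⟪g x, h + h'⟫_ℝ 0 := by
  have hc : ∀ w : H, Continuous fun p : ℝ × ℝ =>
      ContinuousLinearMap.toSpanSingleton ℝ ⟪g (x + p.1 • h + p.2 • h'), w⟫_ℝ := fun w => by
    have h1 : Continuous fun p : ℝ × ℝ => ⟪g (x + p.1 • h + p.2 • h'), w⟫_ℝ := by fun_prop
    exact (ContinuousLinearMap.toSpanSingletonCLE (𝕜 := ℝ) (E := ℝ)).continuous.comp h1
  have h1 := hasStrictFDerivAt_uncurry_coprod (u := ((0 : ℝ), (0 : ℝ)))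
    (f := fun a b : ℝ => u (x + a • h + b • h'))
    (f₁ := fun a b => ContinuousLinearMap.toSpanSingleton ℝ ⟪g (x + a • h + b • h'), h⟫_ℝ)
    (f₂ := fun a b => ContinuousLinearMap.toSpanSingleton ℝ ⟪g (x + a • h + b • h'), h'⟫_ℝ)
    (.of_forall fun v => ?_) (.of_forall fun v => ?_) (hc h).continuousAt (hc h').continuousAt
  · have h2 : HasDerivAt (fun s : ℝ => (s, s)) ((1 : ℝ), (1 : ℝ)) 0 :=
      (hasDerivAt_id 0).prodMk (hasDerivAt_id 0)
    have h3 := HasFDerivAt.comp_hasDerivAt_of_eq (0 : ℝ) h1.hasFDerivAt h2 rfl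
    simp only [ContinuousLinearMap.coprod_apply, ContinuousLinearMap.toSpanSingleton_apply,
      one_smul, Function.HasUncurry.uncurry, id_eq, zero_smul, add_zero,
      ← inner_add_right] at h3
    refine h3.congr_of_eventuallyEq (.of_forall fun s => ?_)
    simp only [Function.comp, smul_add, add_assoc]
  · have := (hasDerivAt_line_translate hh (x + v.2 • h') v.1).hasFDerivAt
    simpa only [add_right_comm x, Function.HasUncurry.uncurry, id_eq] using this
  · exact (hasDerivAt_line_translate hh' (x + v.1 • h) v.2).hasFDerivAt

/-- A continuous function with partial derivatives along a Hilbert basis given by a continuous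
vector field has this vector field as gradient. -/
theorem hasGradientAt_of_partial {ι : Type*} (e : HilbertBasis ι ℝ H) {u : H → ℝ} {g : H → H}
    (hu : Continuous u) (hg : Continuous g)
    (h : ∀ k x, HasDerivAt (fun s : ℝ => u (x + s • e k)) ⟪g x, e k⟫_ℝ 0) (x : H) :
    HasGradientAt u (g x) x := by
  have hspan : ∀ w ∈ Submodule.span ℝ (Set.range e), ∀ x,
      HasDerivAt (fun s : ℝ => u (x + s • w)) ⟪g x, w⟫_ℝ 0 := by
    intro w hw
    induction hw using Submodule.span_induction with
    | mem w hw => obtain ⟨k, rfl⟩ := hw; exact h k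
    | zero => intro x; simpa using hasDerivAt_const (0 : ℝ) (u x)
    | add w w' _ _ h1 h2 => exact hasDerivAt_line_add hg h1 h2
    | smul c w _ h1 =>
      intro x
      have h2 : HasDerivAt (fun s : ℝ => s * c) c 0 := by
        simpa using (hasDerivAt_id (0 : ℝ)).mul_const c
      have h3 := HasDerivAt.comp_of_eq (0 : ℝ) (h1 x) h2 (zero_mul c).symm
      simpa only [Function.comp_def, mul_smul, inner_smul_right, mul_comm c] using h3
  rw [hasGradientAt_iff_isLittleO_nhds_zero, Asymptotics.isLittleO_iff]
  intro c hc
  obtain ⟨δ, hδ, hd⟩ := Metric.continuous_iff.1 hg x c hc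
  filter_upwards [Metric.ball_mem_nhds (0 : H) hδ] with w hw
  have hdense : Dense (Submodule.span ℝ (Set.range e) : Set H) := by
    rw [dense_iff_closure_eq, ← Submodule.topologicalClosure_coe, e.dense_span]; rfl
  have hcl : w ∈ closure (Metric.ball (0 : H) δ ∩ Submodule.span ℝ (Set.range e)) :=
    hdense.open_subset_closure_inter Metric.isOpen_ball hw
  -- Directional derivatives are known only along the dense span. The mean value inequality proves
  -- the estimate there, and it passes to all increments because both sides are continuous.
  have hclosed : IsClosed {w : H | ‖u (x + w) - u x - ⟪g x, w⟫_ℝ‖ ≤ c * ‖w‖} :=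
    isClosed_le (by fun_prop) (by fun_prop)
  refine closure_minimal ?_ hclosed hcl
  rintro w ⟨hw, hwspan⟩
  rw [mem_ball_zero_iff] at hw
  have hder : ∀ s ∈ Set.Icc (0 : ℝ) 1, HasDerivWithinAt
      (fun s : ℝ => u (x + s • w) - s * ⟪g x, w⟫_ℝ) (⟪g (x + s • w), w⟫_ℝ - ⟪g x, w⟫_ℝ)
      (Set.Icc 0 1) s := by
    intro s _
    have h1 := hasDerivAt_line_translate (hspan w hwspan) x s
    have h2 : HasDerivAt (fun s : ℝ => s * ⟪g x, w⟫_ℝ) ⟪g x, w⟫_ℝ s := by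
      simpa using (hasDerivAt_id s).mul_const ⟪g x, w⟫_ℝ
    exact (h1.sub h2).hasDerivWithinAt
  have hb : ∀ s ∈ Set.Ico (0 : ℝ) 1, ‖⟪g (x + s • w), w⟫_ℝ - ⟪g x, w⟫_ℝ‖ ≤ c * ‖w‖ := by
    intro s hs
    rw [← inner_sub_left]
    refine (norm_inner_le_norm _ _).trans (mul_le_mul_of_nonneg_right ?_ (norm_nonneg _))
    rw [← dist_eq_norm]
    refine (hd _ ?_).le
    rw [dist_eq_norm, add_sub_cancel_left, norm_smul, Real.norm_of_nonneg hs.1]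
    exact (mul_le_of_le_one_left (norm_nonneg _) hs.2.le).trans_lt hw
  have := norm_image_sub_le_of_norm_deriv_le_segment_01' hder hb
  simpa [sub_right_comm] using this

end PartialDerivatives

/-! ### The gradient formula and the strong Feller property. -/

section Smoothing

variable {H : Type*} [NormedAddCommGroup H] [InnerProductSpace ℝ H] [CompleteSpace H]
  [MeasurableSpace H] [BorelSpace H] [SecondCountableTopology H]
  {ι : Type*} [Countable ι] (e : HilbertBasis ι ℝ H) {α : ι → ℝ}

/-- The eigenvalues of `Q_t^{-1/2} e^{tA}`. -/
noncomputable def smoothCoef (α : ι → ℝ) (t : ℝ) (k : ι) : ℝ :=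
  Real.exp (-t * α k) * (√(ouVar α t k))⁻¹

theorem smoothCoef_nonneg (α : ι → ℝ) (t : ℝ) (k : ι) : 0 ≤ smoothCoef α t k := by
  unfold smoothCoef; positivity

/-- With `s = t α_k`, the square of the left side is `t^{-(1+2ε)} s^{2ε} · 2s / (e^{2s} - 1)`. Since
`s^{2ε} ≤ 1 + s` for `2ε ≤ 1` and `2s(1 + s) ≤ e^{2s} - 1`, the bound holds with constant one. -/
theorem rpow_mul_smoothCoef_le (hα : ∀ k, 0 < α k) {t : ℝ} (ht : 0 < t) {ε : ℝ} (hε0 : 0 ≤ ε)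
    (hε : ε ≤ 1 / 2) (k : ι) : α k ^ ε * smoothCoef α t k ≤ t ^ (-(1 / 2 + ε)) := by
  have ha := hα k
  have hv := ouVar_pos hα ht k
  refine abs_le_of_sq_le_sq' ?_ (by positivity) |>.2
  have h1 : (t ^ (-(1 / 2 + ε))) ^ 2 = (t ^ (2 * ε) * t)⁻¹ := by
    rw [← Real.rpow_natCast, ← Real.rpow_mul ht.le, ← Real.rpow_add_one ht.ne',
      ← Real.rpow_neg ht.le]
    congr 1; push_cast; ring
  have h2 : (α k ^ ε) ^ 2 = α k ^ (2 * ε) := by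
    rw [← Real.rpow_natCast, ← Real.rpow_mul ha.le]; congr 1; push_cast; ring
  have hs : 0 < t * α k := mul_pos ht ha
  have h3 : (t * α k) ^ (2 * ε) ≤ 1 + t * α k := by
    rcases le_total (t * α k) 1 with h | h
    · have := Real.rpow_le_one hs.le h (show 0 ≤ 2 * ε by linarith)
      linarith
    · have := Real.rpow_le_rpow_of_exponent_le h (show 2 * ε ≤ 1 by linarith)
      rw [Real.rpow_one] at this
      linarith
  have h4 := Real.quadratic_le_exp_of_nonneg (show 0 ≤ 2 * (t * α k) by positivity)
  have h5 : Real.exp (-t * α k) ^ 2 = (Real.exp (2 * (t * α k)))⁻¹ := by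
    rw [← Real.exp_nat_mul, ← Real.exp_neg]; congr 1; push_cast; ring
  have h6 : ouVar α t k = (1 - (Real.exp (2 * (t * α k)))⁻¹) / (2 * α k) := by
    rw [ouVar, ← Real.exp_neg]; congr 3; ring
  have hE : 1 < Real.exp (2 * (t * α k)) := by nlinarith
  rw [Real.mul_rpow ht.le ha.le] at h3
  rw [smoothCoef, h1, mul_pow, mul_pow, inv_pow, Real.sq_sqrt hv.le, h2, h5, h6]
  have hE' : 0 < Real.exp (2 * (t * α k)) - 1 := by linarith
  have heq : (Real.exp (2 * (t * α k)))⁻¹ * ((1 - (Real.exp (2 * (t * α k)))⁻¹) / (2 * α k))⁻¹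
      = 2 * α k / (Real.exp (2 * (t * α k)) - 1) := by
    have : Real.exp (2 * (t * α k)) ≠ 0 := (Real.exp_pos _).ne'
    field_simp
  rw [heq, ← mul_div_assoc, div_le_iff₀ hE', inv_mul_eq_div, le_div_iff₀ (by positivity)]
  have hp : 0 < t ^ (2 * ε) := by positivity
  calc α k ^ (2 * ε) * (2 * α k) * (t ^ (2 * ε) * t)
      = (t ^ (2 * ε) * α k ^ (2 * ε)) * (2 * (t * α k)) := by ring
    _ ≤ (1 + t * α k) * (2 * (t * α k)) := by gcongr
    _ ≤ Real.exp (2 * (t * α k)) - 1 := by nlinarith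

theorem sum_sq_smoothCoef_le (hα : ∀ k, 0 < α k) {t : ℝ} (ht : 0 < t) {ε : ℝ} (hε0 : 0 ≤ ε)
    (hε : ε ≤ 1 / 2) {Φ : (ι → ℝ) → ℝ} (hΦ : MemLp Φ 2 (whiteNoise ι)) (F : Finset ι) :
    ∑ k ∈ F, (α k ^ ε * (smoothCoef α t k * ∫ ξ, Φ ξ * ξ k ∂(whiteNoise ι))) ^ 2
      ≤ (t ^ (-(1 / 2 + ε))) ^ 2 * ∫ ξ, Φ ξ ^ 2 ∂(whiteNoise ι) := by
  refine le_trans ?_ (mul_le_mul_of_nonneg_left (sum_sq_integral_mul_coord_le hΦ F)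
    (sq_nonneg _))
  rw [Finset.mul_sum]
  refine Finset.sum_le_sum fun k _ => ?_
  rw [← mul_assoc, mul_pow]
  refine mul_le_mul_of_nonneg_right (pow_le_pow_left₀ ?_ ?_ 2) (sq_nonneg _)
  · exact mul_nonneg (Real.rpow_nonneg (hα k).le _) (smoothCoef_nonneg α t k)
  · exact rpow_mul_smoothCoef_le hα ht hε0 hε k

theorem summable_sq_smoothCoef (hα : ∀ k, 0 < α k) {t : ℝ} (ht : 0 < t) {Φ : (ι → ℝ) → ℝ}
    (hΦ : MemLp Φ 2 (whiteNoise ι)) :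
    Summable fun k => (smoothCoef α t k * ∫ ξ, Φ ξ * ξ k ∂(whiteNoise ι)) ^ 2 := by
  refine summable_of_sum_le (fun _ => sq_nonneg _) (fun F => ?_)
    (c := (t ^ (-(1 / 2 + (0 : ℝ)))) ^ 2 * ∫ ξ, Φ ξ ^ 2 ∂(whiteNoise ι))
  have := sum_sq_smoothCoef_le hα ht le_rfl (by norm_num) hΦ F
  simpa only [Real.rpow_zero, one_mul] using this

/-- The gradient of `R_t φ`, given by the Bismut-Elworthy formula. -/
noncomputable def ouGrad (e : HilbertBasis ι ℝ H) (α : ι → ℝ) (t : ℝ) (φ : H → ℝ) (x : H) : H :=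
  ∑' k, (smoothCoef α t k * ∫ ξ, φ (ouMap e α t x ξ) * ξ k ∂(whiteNoise ι)) • e k

theorem measurable_ouGrad_uncurry (α : ι → ℝ) {φ : H → ℝ} (hφ : Measurable φ) :
    Measurable fun p : ℝ × H => ouGrad e α p.1 φ p.2 := by
  refine measurable_series e fun k => Measurable.mul ?_ ?_
  · unfold smoothCoef ouVar; fun_prop
  · have h : Measurable fun p : (ℝ × H) × (ι → ℝ) => φ (ouMap e α p.1.1 p.1.2 p.2) * p.2 k :=
      (hφ.comp ((measurable_ouMap_uncurry e α).comp (f := fun p : (ℝ × H) × (ι → ℝ) =>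
        (p.1.1, p.1.2, p.2)) (by fun_prop))).mul ((measurable_pi_apply k).comp measurable_snd)
    exact h.stronglyMeasurable.integral_prod_right'.measurable

theorem memLp_comp_ouMap_of_bounded (α : ι → ℝ) {φ : H → ℝ} (hφ : Measurable φ) {K : ℝ}
    (hK : ∀ x, |φ x| ≤ K) (t : ℝ) (x : H) :
    MemLp (fun ξ => φ (ouMap e α t x ξ)) 2 (whiteNoise ι) :=
  MemLp.of_bound (hφ.comp (measurable_ouMap_right e α t x)).aestronglyMeasurable K
    (ae_of_all _ fun _ => hK _)

theorem inner_ouGrad (hα : ∀ k, 0 < α k) {t : ℝ} (ht : 0 < t) {φ : H → ℝ} {x : H}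
    (h2 : MemLp (fun ξ => φ (ouMap e α t x ξ)) 2 (whiteNoise ι)) (k : ι) :
    ⟪e k, ouGrad e α t φ x⟫_ℝ
      = smoothCoef α t k * ∫ ξ, φ (ouMap e α t x ξ) * ξ k ∂(whiteNoise ι) :=
  inner_series e (summable_sq_smoothCoef hα ht h2) k

theorem sum_sq_ouGrad_le (hα : ∀ k, 0 < α k) {t : ℝ} (ht : 0 < t) {ε : ℝ} (hε0 : 0 ≤ ε)
    (hε : ε ≤ 1 / 2) {φ : H → ℝ} {x : H}
    (h2 : MemLp (fun ξ => φ (ouMap e α t x ξ)) 2 (whiteNoise ι)) (F : Finset ι) :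
    ∑ k ∈ F, (α k ^ ε * ⟪e k, ouGrad e α t φ x⟫_ℝ) ^ 2
      ≤ (t ^ (-(1 / 2 + ε))) ^ 2 * ∫ ξ, φ (ouMap e α t x ξ) ^ 2 ∂(whiteNoise ι) := by
  simp_rw [inner_ouGrad e hα ht h2]
  exact sum_sq_smoothCoef_le hα ht hε0 hε h2 F

theorem integral_sq_comp_le (α : ι → ℝ) {φ : H → ℝ} {K : ℝ} (hK : ∀ x, |φ x| ≤ K) (t : ℝ)
    (x : H) : ∫ ξ, φ (ouMap e α t x ξ) ^ 2 ∂(whiteNoise ι) ≤ K ^ 2 := by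
  have h := norm_integral_le_of_norm_le_const (μ := whiteNoise ι) (C := K ^ 2)
    (f := fun ξ => φ (ouMap e α t x ξ) ^ 2) (ae_of_all _ fun ξ => ?_)
  · rw [probReal_univ, mul_one] at h
    exact (le_abs_self _).trans h
  · rw [norm_pow, Real.norm_eq_abs]
    exact pow_le_pow_left₀ (abs_nonneg _) (hK _) 2

theorem norm_ouGrad_le (hα : ∀ k, 0 < α k) {t : ℝ} (ht : 0 < t) {φ : H → ℝ}
    (hφ : Measurable φ) {K : ℝ} (hK : ∀ x, |φ x| ≤ K) (x : H) :
    ‖ouGrad e α t φ x‖ ≤ t ^ (-(1 / 2 : ℝ)) * K := by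
  have hK0 : 0 ≤ K := (abs_nonneg _).trans (hK 0)
  refine norm_le_of_sum_sq_le e (by positivity) fun F => ?_
  have h := sum_sq_ouGrad_le e hα ht le_rfl (by norm_num)
    (memLp_comp_ouMap_of_bounded e α hφ hK t x) F
  simp only [Real.rpow_zero, one_mul, add_zero] at h
  rw [mul_pow]
  exact h.trans (mul_le_mul_of_nonneg_left (integral_sq_comp_le e α hK t x) (sq_nonneg _))

theorem ouMap_add_smul (hα : ∀ k, 0 < α k) {t : ℝ} (ht : 0 ≤ t) (x : H) (s : ℝ) (k : ι)
    (ξ : ι → ℝ) : ouMap e α t (x + s • e k) ξ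
      = expA e α t x + (s * Real.exp (-t * α k)) • e k + gaussSeries e (ouVar α t) ξ := by
  rw [ouMap, expA_add e hα ht, expA_smul e hα ht, expA_basis e hα ht, smul_smul]

theorem hasDerivAt_ouSemigroup (hα : ∀ k, 0 < α k) (hs : Summable fun k => 1 / (2 * α k))
    {t : ℝ} (ht : 0 < t) {φ : H → ℝ} (hφ : Measurable φ) {K : ℝ} (hK : ∀ x, |φ x| ≤ K)
    (k : ι) (x : H) :
    HasDerivAt (fun s : ℝ => ouSemigroup e α t φ (x + s • e k)) ⟪ouGrad e α t φ x, e k⟫_ℝ 0 := by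
  simp_rw [ouSemigroup_eq e α t hφ, ouMap_add_smul e hα ht.le]
  rw [real_inner_comm, inner_ouGrad e hα ht (memLp_comp_ouMap_of_bounded e α hφ hK t x)]
  have h1 := hasDerivAt_gaussSeries_shift e hφ hK (expA e α t x) (ouVar_nonneg hα ht.le)
    (summable_ouVar hα hs ht.le) (ouVar_pos hα ht k) 0
  have h2 : HasDerivAt (fun s : ℝ => s * Real.exp (-t * α k)) (Real.exp (-t * α k)) 0 := by
    simpa using (hasDerivAt_id (0 : ℝ)).mul_const (Real.exp (-t * α k))
  have h3 := HasDerivAt.comp_of_eq (0 : ℝ) h1 h2 (zero_mul _).symm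
  simp only [Function.comp_def, zero_smul, add_zero] at h3
  refine h3.congr_deriv ?_
  simp only [smoothCoef, ouMap]
  ring

theorem continuous_ouMap (hα : ∀ k, 0 < α k) {t : ℝ} (ht : 0 ≤ t) (ξ : ι → ℝ) :
    Continuous fun x => ouMap e α t x ξ :=
  (continuous_expA e hα ht).add continuous_const

theorem continuous_ouSemigroup_of_continuous (hα : ∀ k, 0 < α k) {t : ℝ} (ht : 0 ≤ t)
    {φ : H → ℝ} (hφ : Continuous φ) {K : ℝ} (hK : ∀ x, |φ x| ≤ K) :
    Continuous (ouSemigroup e α t φ) := by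
  have : ouSemigroup e α t φ = fun x => ∫ ξ, φ (ouMap e α t x ξ) ∂(whiteNoise ι) :=
    funext (ouSemigroup_eq e α t hφ.measurable)
  rw [this]
  exact continuous_of_dominated (bound := fun _ => K)
    (fun x => (hφ.measurable.comp (measurable_ouMap_right e α t x)).aestronglyMeasurable)
    (fun x => ae_of_all _ fun ξ => hK _) (integrable_const _)
    (ae_of_all _ fun ξ => hφ.comp (continuous_ouMap e hα ht ξ))

/-- The gradient is linear in the random variable `φ(X)`, so Bessel's inequality bounds its
increment by the `L²` distance of `φ(X)` for the two starting points; for continuous `φ` this tends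
to zero. -/
theorem continuous_ouGrad_of_continuous (hα : ∀ k, 0 < α k) {t : ℝ} (ht : 0 < t)
    {φ : H → ℝ} (hφ : Continuous φ) {K : ℝ} (hK : ∀ x, |φ x| ≤ K) :
    Continuous (ouGrad e α t φ) := by
  rw [continuous_iff_continuousAt]
  intro x
  have hm := fun y => memLp_comp_ouMap_of_bounded e α hφ.measurable hK t y
  have hbound : ∀ y, ‖ouGrad e α t φ y - ouGrad e α t φ x‖ ≤ t ^ (-(1 / 2 : ℝ)) *
      √(∫ ξ, (φ (ouMap e α t y ξ) - φ (ouMap e α t x ξ)) ^ 2 ∂(whiteNoise ι)) := by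
    intro y
    refine norm_le_of_sum_sq_le e (by positivity) fun F => ?_
    have h := sum_sq_smoothCoef_le hα ht le_rfl (by norm_num) ((hm y).sub (hm x)) F
    simp only [Real.rpow_zero, one_mul, add_zero, Pi.sub_apply] at h
    rw [mul_pow, Real.sq_sqrt (integral_nonneg fun _ => sq_nonneg _)]
    refine le_trans (le_of_eq ?_) h
    refine Finset.sum_congr rfl fun k _ => ?_
    have hi := fun y => (hm y).integrable_mul (memLp_coord k)
    have hsub : ∫ ξ, (φ (ouMap e α t y ξ) - φ (ouMap e α t x ξ)) * ξ k ∂(whiteNoise ι)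
        = ∫ ξ, φ (ouMap e α t y ξ) * ξ k ∂(whiteNoise ι)
          - ∫ ξ, φ (ouMap e α t x ξ) * ξ k ∂(whiteNoise ι) := by
      simp_rw [sub_mul]
      exact integral_sub (hi y) (hi x)
    rw [inner_sub_right, inner_ouGrad e hα ht (hm y), inner_ouGrad e hα ht (hm x), hsub, mul_sub]
  rw [ContinuousAt, tendsto_iff_norm_sub_tendsto_zero]
  have hlim : Tendsto (fun y => ∫ ξ, (φ (ouMap e α t y ξ) - φ (ouMap e α t x ξ)) ^ 2
      ∂(whiteNoise ι)) (𝓝 x) (𝓝 0) := by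
    have hc : Continuous fun y => ∫ ξ, (φ (ouMap e α t y ξ) - φ (ouMap e α t x ξ)) ^ 2
        ∂(whiteNoise ι) := by
      refine continuous_of_dominated (bound := fun _ => (2 * K) ^ 2) (fun y => ?_)
        (fun y => ae_of_all _ fun ξ => ?_) (integrable_const _) (ae_of_all _ fun ξ => ?_)
      · exact ((hm y).sub (hm x)).aestronglyMeasurable.pow 2
      · rw [norm_pow, Real.norm_eq_abs]
        refine pow_le_pow_left₀ (abs_nonneg _) ?_ 2
        have h1 := abs_le.1 (hK (ouMap e α t y ξ))
        have h2 := abs_le.1 (hK (ouMap e α t x ξ))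
        rw [abs_le]
        constructor <;> linarith [h1.1, h1.2, h2.1, h2.2]
      · exact ((hφ.comp (continuous_ouMap e hα ht.le ξ)).sub continuous_const).pow 2
    have := hc.tendsto x
    simpa using this
  have h0 : Tendsto (fun y => t ^ (-(1 / 2 : ℝ)) *
      √(∫ ξ, (φ (ouMap e α t y ξ) - φ (ouMap e α t x ξ)) ^ 2 ∂(whiteNoise ι))) (𝓝 x) (𝓝 0) := by
    have := ((Real.continuous_sqrt.tendsto 0).comp hlim).const_mul (t ^ (-(1 / 2 : ℝ)))
    simpa [Function.comp_def] using this
  exact squeeze_zero (fun _ => norm_nonneg _) hbound h0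

theorem hasGradientAt_ouSemigroup_of_continuous (hα : ∀ k, 0 < α k)
    (hs : Summable fun k => 1 / (2 * α k)) {t : ℝ} (ht : 0 < t) {φ : H → ℝ} (hφ : Continuous φ)
    {K : ℝ} (hK : ∀ x, |φ x| ≤ K) (x : H) :
    HasGradientAt (ouSemigroup e α t φ) (ouGrad e α t φ x) x :=
  hasGradientAt_of_partial e (continuous_ouSemigroup_of_continuous e hα ht.le hφ hK)
    (continuous_ouGrad_of_continuous e hα ht hφ hK)
    (hasDerivAt_ouSemigroup e hα hs ht hφ.measurable hK) x

theorem abs_ouSemigroup_sub_le_of_continuous (hα : ∀ k, 0 < α k)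
    (hs : Summable fun k => 1 / (2 * α k)) {t : ℝ} (ht : 0 < t) {φ : H → ℝ} (hφ : Continuous φ)
    {K : ℝ} (hK : ∀ x, |φ x| ≤ K) (x y : H) :
    |ouSemigroup e α t φ y - ouSemigroup e α t φ x| ≤ t ^ (-(1 / 2 : ℝ)) * K * ‖y - x‖ := by
  refine Convex.norm_image_sub_le_of_norm_hasFDerivWithin_le (s := Set.univ)
    (fun z _ => (hasGradientAt_ouSemigroup_of_continuous e hα hs ht hφ hK
      z).hasFDerivAt.hasFDerivWithinAt) (fun z _ => ?_) convex_univ trivial trivial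
  rw [LinearIsometryEquiv.norm_map]
  exact norm_ouGrad_le e hα ht hφ.measurable hK z

/-- The strong Feller property. -/
theorem abs_ouSemigroup_sub_le (hα : ∀ k, 0 < α k)
    (hs : Summable fun k => 1 / (2 * α k)) {t : ℝ} (ht : 0 < t) {φ : H → ℝ} (hφ : Measurable φ)
    {K : ℝ} (hK : ∀ x, |φ x| ≤ K) (x y : H) :
    |ouSemigroup e α t φ y - ouSemigroup e α t φ x| ≤ t ^ (-(1 / 2 : ℝ)) * K * ‖y - x‖ := by
  have hK0 : 0 ≤ K := (abs_nonneg _).trans (hK 0)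
  set νx := gaussian e (expA e α t x) (ouVar α t) with hνx
  set νy := gaussian e (expA e α t y) (ouVar α t) with hνy
  have hφ1 : MemLp φ 1 (νx + νy) := MemLp.of_bound hφ.aestronglyMeasurable K (ae_of_all _ hK)
  refine le_of_forall_pos_le_add fun ε hε => ?_
  -- For two fixed points, one continuous approximation in `L¹` of the sum of both transition laws
  -- controls both values of the semigroup. Truncating it at `±K` preserves the constant in the
  -- Lipschitz bound and does not worsen the approximation.
  obtain ⟨g, hg, -⟩ := hφ1.exists_boundedContinuous_eLpNorm_sub_le (by simp)
    (ε := ENNReal.ofReal (ε / 2)) (by simpa using hε)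
  set ψ : H → ℝ := fun z => max (-K) (min K (g z)) with hψ
  have hψc : Continuous ψ := by fun_prop
  have hψK : ∀ z, |ψ z| ≤ K := fun z =>
    abs_le.2 ⟨le_max_left _ _, max_le (by linarith) (min_le_left _ _)⟩
  have hclose : ∀ z, |φ z - ψ z| ≤ |φ z - g z| := by
    intro z
    have h1 : φ z = max (-K) (min K (φ z)) := by
      rw [min_eq_right (abs_le.1 (hK z)).2, max_eq_right (abs_le.1 (hK z)).1]
    conv_lhs => rw [h1]
    refine (abs_max_sub_max_le_max _ _ _ _).trans ?_
    refine max_le (by simp) ((abs_min_sub_min_le_max _ _ _ _).trans ?_)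
    exact max_le (by simp) le_rfl
  have hint : ∫ z, |φ z - g z| ∂(νx + νy) ≤ ε / 2 := by
    rw [eLpNorm_one_eq_lintegral_enorm] at hg
    simp only [Pi.sub_apply] at hg
    have h1 : Integrable (fun z => φ z - g z) (νx + νy) :=
      (hφ1.integrable le_rfl).sub (g.integrable _)
    rw [← ofReal_integral_norm_eq_lintegral_enorm (f := fun z => φ z - g z) h1,
      ENNReal.ofReal_le_ofReal_iff (by positivity)] at hg
    exact hg
  have hI : ∀ (ν : Measure H) [IsFiniteMeasure ν], Integrable (fun z => |φ z - g z|) ν := fun ν _ =>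
    ((Integrable.of_bound hφ.aestronglyMeasurable K (ae_of_all _ hK)).sub (g.integrable _)).abs
  rw [integral_add_measure (hI νx) (hI νy)] at hint
  have hone : ∀ (ν : Measure H) [IsFiniteMeasure ν],
      |∫ z, φ z ∂ν - ∫ z, ψ z ∂ν| ≤ ∫ z, |φ z - g z| ∂ν := by
    intro ν _
    rw [← integral_sub (Integrable.of_bound hφ.aestronglyMeasurable K (ae_of_all _ hK))
      (Integrable.of_bound hψc.aestronglyMeasurable K (ae_of_all _ hψK))]
    exact norm_integral_le_of_norm_le (f := fun z => φ z - ψ z) (hI ν) (ae_of_all _ hclose)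
  have hx := hone νx
  have hy := hone νy
  have hxy := abs_ouSemigroup_sub_le_of_continuous e hα hs ht hψc hψK x y
  change |∫ z, ψ z ∂νy - ∫ z, ψ z ∂νx| ≤ _ at hxy
  change |∫ z, φ z ∂νy - ∫ z, φ z ∂νx| ≤ _
  rw [abs_le] at hx hy hxy ⊢
  constructor <;> linarith [hx.1, hx.2, hy.1, hy.2, hxy.1, hxy.2]

theorem continuous_ouSemigroup (hα : ∀ k, 0 < α k)
    (hs : Summable fun k => 1 / (2 * α k)) {t : ℝ} (ht : 0 < t) {φ : H → ℝ} (hφ : Measurable φ)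
    {K : ℝ} (hK : ∀ x, |φ x| ≤ K) : Continuous (ouSemigroup e α t φ) := by
  have hK0 : 0 ≤ K := (abs_nonneg _).trans (hK 0)
  refine (LipschitzWith.of_dist_le_mul (K := ⟨t ^ (-(1 / 2 : ℝ)) * K, by positivity⟩)
    fun x y => ?_).continuous
  rw [Real.dist_eq, dist_eq_norm]
  exact abs_ouSemigroup_sub_le e hα hs ht hφ hK y x

theorem ouSemigroup_half (hα : ∀ k, 0 < α k) (hs : Summable fun k => 1 / (2 * α k)) {t : ℝ}
    (ht : 0 < t) {φ : H → ℝ} (hφ : Measurable φ) {K : ℝ} (hK : ∀ x, |φ x| ≤ K) :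
    ouSemigroup e α (t / 2) (ouSemigroup e α (t / 2) φ) = ouSemigroup e α t φ := by
  funext x
  rw [ouSemigroup_ouSemigroup e hα hs (half_pos ht).le (half_pos ht).le hφ x
    ((memLp_comp_ouMap_of_bounded e α hφ hK _ x).integrable one_le_two), add_halves]

/-- Both sides have the partial derivatives of `R_t φ = R_{t/2} R_{t/2} φ` as coordinates. On the
right the inner function is continuous, which extends the continuity of the gradient to merely
measurable `φ`. -/
theorem ouGrad_eq_half (hα : ∀ k, 0 < α k) (hs : Summable fun k => 1 / (2 * α k)) {t : ℝ}
    (ht : 0 < t) {φ : H → ℝ} (hφ : Measurable φ) {K : ℝ} (hK : ∀ x, |φ x| ≤ K) :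
    ouGrad e α t φ = ouGrad e α (t / 2) (ouSemigroup e α (t / 2) φ) := by
  funext x
  refine ext_inner_basis e fun k => ?_
  have h1 := hasDerivAt_ouSemigroup e hα hs ht hφ hK k x
  have h2 := hasDerivAt_ouSemigroup e hα hs (half_pos ht)
    (measurable_ouSemigroup e α (t / 2) hφ) (abs_ouSemigroup_le e α (t / 2) hK) k x
  rw [ouSemigroup_half e hα hs ht hφ hK] at h2
  rw [real_inner_comm, real_inner_comm _ (e k)]
  exact h1.unique h2

theorem continuous_ouGrad (hα : ∀ k, 0 < α k) (hs : Summable fun k => 1 / (2 * α k)) {t : ℝ}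
    (ht : 0 < t) {φ : H → ℝ} (hφ : Measurable φ) {K : ℝ} (hK : ∀ x, |φ x| ≤ K) :
    Continuous (ouGrad e α t φ) := by
  rw [ouGrad_eq_half e hα hs ht hφ hK]
  exact continuous_ouGrad_of_continuous e hα (half_pos ht)
    (continuous_ouSemigroup e hα hs (half_pos ht) hφ hK) (abs_ouSemigroup_le e α (t / 2) hK)

theorem hasGradientAt_ouSemigroup (hα : ∀ k, 0 < α k)
    (hs : Summable fun k => 1 / (2 * α k)) {t : ℝ} (ht : 0 < t) {φ : H → ℝ} (hφ : Measurable φ)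
    {K : ℝ} (hK : ∀ x, |φ x| ≤ K) (x : H) :
    HasGradientAt (ouSemigroup e α t φ) (ouGrad e α t φ x) x :=
  hasGradientAt_of_partial e (continuous_ouSemigroup e hα hs ht hφ hK)
    (continuous_ouGrad e hα hs ht hφ hK) (hasDerivAt_ouSemigroup e hα hs ht hφ hK) x

end Smoothing

/-! ### The time weight and its Gamma integral. -/

section GammaWeight

/-- The weight in the time integrals for the derivative of the resolvent. -/
noncomputable def gammaWeight (lam ε t : ℝ) : ℝ := Real.exp (-lam * t) * t ^ (-(1 / 2 + ε))

theorem gammaWeight_nonneg {lam ε t : ℝ} (ht : 0 < t) : 0 ≤ gammaWeight lam ε t := by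
  unfold gammaWeight; positivity

theorem integrableOn_gammaWeight {lam ε : ℝ} (hl : 0 < lam) (hε : ε < 1 / 2) :
    IntegrableOn (gammaWeight lam ε) (Set.Ioi 0) := by
  have h := integrableOn_rpow_mul_exp_neg_mul_rpow (p := 1) (s := -(1 / 2 + ε)) (b := lam)
    (by linarith) one_pos hl
  simp only [Real.rpow_one] at h
  exact h.congr_fun (fun t _ => mul_comm _ _) measurableSet_Ioi

theorem integral_gammaWeight {lam ε : ℝ} (hl : 0 < lam) (hε : ε < 1 / 2) :
    ∫ t in Set.Ioi (0 : ℝ), gammaWeight lam ε t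
      = Real.Gamma (1 / 2 - ε) / lam ^ (1 / 2 - ε) := by
  have h := Real.integral_rpow_mul_exp_neg_mul_Ioi (a := 1 / 2 - ε) (r := lam) (by linarith) hl
  rw [Real.div_rpow zero_le_one hl.le, Real.one_rpow] at h
  rw [div_eq_mul_one_div, mul_comm, ← h]
  refine setIntegral_congr_fun measurableSet_Ioi fun t _ => ?_
  simp only [gammaWeight]
  rw [mul_comm, show 1 / 2 - ε - 1 = -(1 / 2 + ε) by ring, neg_mul]

theorem measurable_gammaWeight (lam ε : ℝ) : Measurable (gammaWeight lam ε) := by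
  unfold gammaWeight; fun_prop

end GammaWeight

/-! ### Finite rank truncations of unbounded diagonal operators. -/

section DiagonalTruncation

variable {H : Type*} [NormedAddCommGroup H] [InnerProductSpace ℝ H] [CompleteSpace H]
  {ι : Type*} (e : HilbertBasis ι ℝ H)

/-- The finite rank truncation of a diagonal operator. -/
noncomputable def diagFin (g : ι → ℝ) (F : Finset ι) : H →L[ℝ] H :=
  ∑ k ∈ F, (innerSL ℝ (e k)).smulRight (g k • e k)

theorem norm_sq_diagFin (g : ι → ℝ) (F : Finset ι) (x : H) :
    ‖diagFin e g F x‖ ^ 2 = ∑ k ∈ F, (g k * ⟪e k, x⟫_ℝ) ^ 2 := by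
  have h : diagFin e g F x = ∑ k ∈ F, (g k * ⟪e k, x⟫_ℝ) • e k := by
    simp [diagFin, smul_smul, mul_comm]
  rw [h, ← real_inner_self_eq_norm_sq, e.orthonormal.inner_sum]
  exact Finset.sum_congr rfl fun k _ => by simp [sq]

/-- Truncations are bounded operators, so they commute with Bochner integrals and pass to `L²`
limits, which the unbounded operator does not do directly. Uniform bounds on them recover both
membership in the domain and the norm estimate. -/
theorem inDiagDomain_of_diagFin_le {g : ι → ℝ} {x : H} {K : ℝ} (hK : 0 ≤ K)
    (h : ∀ F : Finset ι, ‖diagFin e g F x‖ ≤ K) :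
    InDiagDomain e g x ∧ ‖diagOp e g x‖ ≤ K :=
  inDiagDomain_of_sum_le e hK fun F => by
    rw [← norm_sq_diagFin]
    exact pow_le_pow_left₀ (norm_nonneg _) (h F) 2

theorem norm_diagFin_le {g : ι → ℝ} {x : H} (hx : InDiagDomain e g x) (F : Finset ι) :
    ‖diagFin e g F x‖ ≤ ‖diagOp e g x‖ := by
  refine abs_le_of_sq_le_sq' ?_ (norm_nonneg _) |>.2
  rw [norm_sq_diagFin, norm_sq_diagOp e hx]
  exact hx.sum_le_tsum F fun _ _ => sq_nonneg _

end DiagonalTruncation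

/-! ### Gradient estimates for the resolvent of a bounded function. -/

section ResolventGradient

variable {H : Type*} [NormedAddCommGroup H] [InnerProductSpace ℝ H] [CompleteSpace H]
  [MeasurableSpace H] [BorelSpace H] [SecondCountableTopology H]
  {ι : Type*} [Countable ι] (e : HilbertBasis ι ℝ H) {α : ι → ℝ}

/-- The gradient of the resolvent of a bounded function. -/
noncomputable def ouResGrad (e : HilbertBasis ι ℝ H) (α : ι → ℝ) (lam : ℝ) (φ : H → ℝ) (x : H) :
    H := ∫ t in Set.Ioi (0 : ℝ), Real.exp (-lam * t) • ouGrad e α t φ x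

theorem abs_ouResFun_le (α : ι → ℝ) {lam : ℝ} (hl : 0 < lam) {φ : H → ℝ} {K : ℝ}
    (hK : ∀ x, |φ x| ≤ K) (x : H) : |ouResFun e α lam φ x| ≤ K / lam := by
  have hexp := exp_neg_integrableOn_Ioi 0 hl
  have h : ∫ t in Set.Ioi (0 : ℝ), Real.exp (-lam * t) * K = K / lam := by
    rw [integral_mul_const, integral_exp_mul_Ioi (by linarith)]
    simp
    ring
  rw [ouResFun, ← Real.norm_eq_abs, ← h]
  refine norm_integral_le_of_norm_le (hexp.mul_const K) (ae_of_all _ fun t => ?_)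
  rw [norm_mul, Real.norm_eq_abs, Real.abs_exp]
  exact mul_le_mul_of_nonneg_left (abs_ouSemigroup_le e α t hK x) (Real.exp_pos _).le

theorem aestronglyMeasurable_exp_smul_ouGrad (α : ι → ℝ) (lam : ℝ) {φ : H → ℝ}
    (hφ : Measurable φ) (x : H) (ν : Measure ℝ) :
    AEStronglyMeasurable (fun t => Real.exp (-lam * t) • ouGrad e α t φ x) ν := by
  have h : Measurable fun t => ouGrad e α t φ x :=
    (measurable_ouGrad_uncurry e α hφ).comp (measurable_id.prodMk measurable_const)
  exact Measurable.aestronglyMeasurable (by fun_prop)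

theorem norm_exp_smul_ouGrad_le (hα : ∀ k, 0 < α k) (lam : ℝ) {φ : H → ℝ}
    (hφ : Measurable φ) {K : ℝ} (hK : ∀ x, |φ x| ≤ K) {t : ℝ} (ht : 0 < t) (x : H) :
    ‖Real.exp (-lam * t) • ouGrad e α t φ x‖ ≤ gammaWeight lam 0 t * K := by
  rw [norm_smul, Real.norm_eq_abs, Real.abs_exp, gammaWeight, mul_assoc, add_zero]
  exact mul_le_mul_of_nonneg_left (norm_ouGrad_le e hα ht hφ hK x) (Real.exp_pos _).le

theorem integrableOn_exp_smul_ouGrad (hα : ∀ k, 0 < α k) {lam : ℝ} (hl : 0 < lam) {φ : H → ℝ}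
    (hφ : Measurable φ) {K : ℝ} (hK : ∀ x, |φ x| ≤ K) (x : H) :
    IntegrableOn (fun t => Real.exp (-lam * t) • ouGrad e α t φ x) (Set.Ioi 0) :=
  Integrable.mono' ((integrableOn_gammaWeight hl (by norm_num)).mul_const K)
    (aestronglyMeasurable_exp_smul_ouGrad e α lam hφ x _)
    ((ae_restrict_iff' measurableSet_Ioi).2 (ae_of_all _ fun _ ht =>
      norm_exp_smul_ouGrad_le e hα lam hφ hK ht x))

/-- Differentiation under the time integral: the gradient of `R_t φ` blows up only like `t^{-1/2}`,
which is integrable at zero, uniformly in the point. -/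
theorem hasGradientAt_ouResFun (hα : ∀ k, 0 < α k) (hs : Summable fun k => 1 / (2 * α k))
    {lam : ℝ} (hl : 0 < lam) {φ : H → ℝ} (hφ : Measurable φ) {K : ℝ} (hK : ∀ x, |φ x| ≤ K)
    (x : H) : HasGradientAt (ouResFun e α lam φ) (ouResGrad e α lam φ x) x := by
  have hm : ∀ y, Measurable fun t => Real.exp (-lam * t) * ouSemigroup e α t φ y := fun y => by
    have h : Measurable fun t => ouSemigroup e α t φ y :=
      (measurable_ouSemigroup_uncurry e α hφ).comp (measurable_id.prodMk measurable_const)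
    fun_prop
  have h := hasFDerivAt_integral_of_dominated_of_fderiv_le (𝕜 := ℝ)
    (μ := volume.restrict (Set.Ioi (0 : ℝ)))
    (F := fun y t => Real.exp (-lam * t) * ouSemigroup e α t φ y)
    (F' := fun y t => innerSL ℝ (Real.exp (-lam * t) • ouGrad e α t φ y)) (x₀ := x)
    (bound := fun t => gammaWeight lam 0 t * K) univ_mem
    (.of_forall fun y => (hm y).aestronglyMeasurable) ?_ ?_ ?_
    ((integrableOn_gammaWeight hl (by norm_num)).mul_const K) ?_
  · have h2 := ContinuousLinearMap.integral_comp_comm (innerSL ℝ (E := H))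
      (integrableOn_exp_smul_ouGrad e hα hl hφ hK x)
    rw [h2] at h
    exact h
  · refine Integrable.mono' ((exp_neg_integrableOn_Ioi 0 hl).mul_const K)
      (hm x).aestronglyMeasurable (ae_of_all _ fun t => ?_)
    rw [norm_mul, Real.norm_eq_abs, Real.abs_exp]
    exact mul_le_mul_of_nonneg_left (abs_ouSemigroup_le e α t hK x) (Real.exp_pos _).le
  · exact (innerSL ℝ (E := H)).continuous.comp_aestronglyMeasurable
      (aestronglyMeasurable_exp_smul_ouGrad e α lam hφ x _)
  · refine (ae_restrict_iff' measurableSet_Ioi).2 (ae_of_all _ fun t ht y _ => ?_)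
    rw [innerSL_apply_norm]
    exact norm_exp_smul_ouGrad_le e hα lam hφ hK ht y
  · refine (ae_restrict_iff' measurableSet_Ioi).2 (ae_of_all _ fun t ht y _ => ?_)
    have h3 := (hasGradientAt_ouSemigroup e hα hs ht hφ hK y).hasFDerivAt.const_mul
      (Real.exp (-lam * t))
    rw [map_smul]
    exact h3

theorem gradient_ouResFun (hα : ∀ k, 0 < α k) (hs : Summable fun k => 1 / (2 * α k))
    {lam : ℝ} (hl : 0 < lam) {φ : H → ℝ} (hφ : Measurable φ) {K : ℝ} (hK : ∀ x, |φ x| ≤ K) :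
    gradient (ouResFun e α lam φ) = ouResGrad e α lam φ :=
  funext fun x => (hasGradientAt_ouResFun e hα hs hl hφ hK x).gradient

theorem continuous_ouResGrad (hα : ∀ k, 0 < α k) (hs : Summable fun k => 1 / (2 * α k))
    {lam : ℝ} (hl : 0 < lam) {φ : H → ℝ} (hφ : Measurable φ) {K : ℝ} (hK : ∀ x, |φ x| ≤ K) :
    Continuous (ouResGrad e α lam φ) := by
  refine continuous_of_dominated (bound := fun t => gammaWeight lam 0 t * K)
    (fun x => aestronglyMeasurable_exp_smul_ouGrad e α lam hφ x _) (fun x => ?_)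
    ((integrableOn_gammaWeight hl (by norm_num)).mul_const K) ?_
  · exact (ae_restrict_iff' measurableSet_Ioi).2 (ae_of_all _ fun t ht =>
      norm_exp_smul_ouGrad_le e hα lam hφ hK ht x)
  · refine (ae_restrict_iff' measurableSet_Ioi).2 (ae_of_all _ fun t ht => ?_)
    exact (continuous_ouGrad e hα hs ht hφ hK).const_smul _

theorem norm_ouResGrad_le (hα : ∀ k, 0 < α k)
    {lam : ℝ} (hl : 0 < lam) {φ : H → ℝ} (hφ : Measurable φ) {K : ℝ} (hK : ∀ x, |φ x| ≤ K)
    (x : H) : ‖ouResGrad e α lam φ x‖ ≤ ∫ t in Set.Ioi (0 : ℝ), gammaWeight lam 0 t * K :=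
  norm_integral_le_of_norm_le ((integrableOn_gammaWeight hl (by norm_num)).mul_const K)
    ((ae_restrict_iff' measurableSet_Ioi).2 (ae_of_all _ fun _ ht =>
      norm_exp_smul_ouGrad_le e hα lam hφ hK ht x))

theorem isC1b_ouResFun (hα : ∀ k, 0 < α k) (hs : Summable fun k => 1 / (2 * α k))
    {lam : ℝ} (hl : 0 < lam) {φ : H → ℝ} (hφ : Measurable φ) {K : ℝ} (hK : ∀ x, |φ x| ≤ K) :
    IsC1b (ouResFun e α lam φ) := by
  have hg := hasGradientAt_ouResFun e hα hs hl hφ hK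
  have hf : fderiv ℝ (ouResFun e α lam φ) = fun x => innerSL ℝ (ouResGrad e α lam φ x) :=
    funext fun x => (hg x).hasFDerivAt.fderiv
  refine ⟨contDiff_one_iff_fderiv.2 ⟨fun x => (hg x).differentiableAt, ?_⟩,
    ⟨K / lam, abs_ouResFun_le e α hl hK⟩,
    ⟨∫ t in Set.Ioi (0 : ℝ), gammaWeight lam 0 t * K, fun x => ?_⟩⟩
  · rw [hf]
    exact (innerSL ℝ (E := H)).continuous.comp (continuous_ouResGrad e hα hs hl hφ hK)
  · rw [hf, innerSL_apply_norm]
    exact norm_ouResGrad_le e hα hl hφ hK x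

/-- The `L²` norm of `φ` with respect to the transition probability of the
Ornstein-Uhlenbeck process. -/
noncomputable def ouNorm (e : HilbertBasis ι ℝ H) (α : ι → ℝ) (φ : H → ℝ) (x : H) (t : ℝ) : ℝ :=
  √(∫ ξ, φ (ouMap e α t x ξ) ^ 2 ∂(whiteNoise ι))

theorem measurable_ouNorm_uncurry (α : ι → ℝ) {φ : H → ℝ} (hφ : Measurable φ) :
    Measurable fun p : H × ℝ => ouNorm e α φ p.1 p.2 := by
  have h : Measurable fun p : (H × ℝ) × (ι → ℝ) => φ (ouMap e α p.1.2 p.1.1 p.2) ^ 2 :=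
    (hφ.comp ((measurable_ouMap_uncurry e α).comp (f := fun p : (H × ℝ) × (ι → ℝ) =>
      (p.1.2, p.1.1, p.2)) (by fun_prop))).pow_const 2
  exact h.stronglyMeasurable.integral_prod_right'.measurable.sqrt

theorem ouNorm_nonneg (α : ι → ℝ) (φ : H → ℝ) (x : H) (t : ℝ) : 0 ≤ ouNorm e α φ x t :=
  Real.sqrt_nonneg _

theorem sq_ouNorm (α : ι → ℝ) (φ : H → ℝ) (x : H) (t : ℝ) :
    ouNorm e α φ x t ^ 2 = ∫ ξ, φ (ouMap e α t x ξ) ^ 2 ∂(whiteNoise ι) :=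
  Real.sq_sqrt (integral_nonneg fun _ => sq_nonneg _)

theorem measurable_ouNorm (α : ι → ℝ) {φ : H → ℝ} (hφ : Measurable φ) (x : H) :
    Measurable (ouNorm e α φ x) :=
  Measurable.comp (g := fun p : H × ℝ => ouNorm e α φ p.1 p.2) (f := fun t : ℝ => (x, t))
    (measurable_ouNorm_uncurry e α hφ) (measurable_const.prodMk measurable_id)

theorem ouNorm_le (α : ι → ℝ) {φ : H → ℝ} {K : ℝ} (hK : ∀ x, |φ x| ≤ K) (x : H) (t : ℝ) :
    ouNorm e α φ x t ≤ K :=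
  Real.sqrt_le_iff.2 ⟨(abs_nonneg _).trans (hK 0), integral_sq_comp_le e α hK t x⟩

theorem integrableOn_gammaWeight_mul_ouNorm (α : ι → ℝ) {lam ε : ℝ} (hl : 0 < lam)
    (hε : ε < 1 / 2) {φ : H → ℝ} (hφ : Measurable φ) {K : ℝ} (hK : ∀ x, |φ x| ≤ K) (x : H) :
    IntegrableOn (fun t => gammaWeight lam ε t * ouNorm e α φ x t) (Set.Ioi 0) := by
  have hm := measurable_ouNorm e α hφ x
  refine Integrable.mono' ((integrableOn_gammaWeight hl hε).mul_const K)
    ((measurable_gammaWeight lam ε).mul hm).aestronglyMeasurable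
    ((ae_restrict_iff' measurableSet_Ioi).2 (ae_of_all _ fun t ht => ?_))
  have h0 : 0 ≤ ouNorm e α φ x t := ouNorm_nonneg e α φ x t
  rw [Real.norm_of_nonneg (mul_nonneg (gammaWeight_nonneg ht) h0)]
  exact mul_le_mul_of_nonneg_left (ouNorm_le e α hK x t) (gammaWeight_nonneg ht)

/-- Keeping the local `L²` norm `ouNorm` on the right, instead of `K`, makes this the common source
of the sup estimate and the `L²(μ)` estimate. -/
theorem powNegA_ouResGrad_le (hα : ∀ k, 0 < α k) {lam ε : ℝ} (hl : 0 < lam) (hε0 : 0 ≤ ε)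
    (hε : ε < 1 / 2) {φ : H → ℝ} (hφ : Measurable φ) {K : ℝ} (hK : ∀ x, |φ x| ≤ K) (x : H) :
    InDomPowNegA e α ε (ouResGrad e α lam φ x) ∧ ‖powNegA e α ε (ouResGrad e α lam φ x)‖
      ≤ ∫ t in Set.Ioi (0 : ℝ), gammaWeight lam ε t * ouNorm e α φ x t := by
  refine inDiagDomain_of_diagFin_le e ?_ fun F => ?_
  · exact setIntegral_nonneg measurableSet_Ioi fun t ht =>
      mul_nonneg (gammaWeight_nonneg ht) (ouNorm_nonneg e α φ x t)
  · rw [ouResGrad, ← ContinuousLinearMap.integral_comp_comm _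
      (integrableOn_exp_smul_ouGrad e hα hl hφ hK x)]
    refine norm_integral_le_of_norm_le (integrableOn_gammaWeight_mul_ouNorm e α hl hε hφ hK x)
      ((ae_restrict_iff' measurableSet_Ioi).2 (ae_of_all _ fun t ht => ?_))
    have ht : 0 < t := ht
    rw [map_smul, norm_smul, Real.norm_eq_abs, Real.abs_exp, gammaWeight, mul_assoc]
    refine mul_le_mul_of_nonneg_left ?_ (Real.exp_pos _).le
    refine abs_le_of_sq_le_sq' ?_ (mul_nonneg (by positivity) (ouNorm_nonneg e α φ x t)) |>.2
    rw [norm_sq_diagFin, mul_pow, sq_ouNorm]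
    exact sum_sq_ouGrad_le e hα ht hε0 hε.le (memLp_comp_ouMap_of_bounded e α hφ hK t x) F

theorem powNegA_ouResGrad_sup_le (hα : ∀ k, 0 < α k) {lam ε : ℝ} (hl : 0 < lam) (hε0 : 0 ≤ ε)
    (hε : ε < 1 / 2) {φ : H → ℝ} (hφ : Measurable φ) {K : ℝ} (hK : ∀ x, |φ x| ≤ K) (x : H) :
    ‖powNegA e α ε (ouResGrad e α lam φ x)‖
      ≤ Real.Gamma (1 / 2 - ε) / lam ^ (1 / 2 - ε) * K := by
  refine (powNegA_ouResGrad_le e hα hl hε0 hε hφ hK x).2.trans ?_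
  rw [← integral_gammaWeight hl hε, ← integral_mul_const]
  exact setIntegral_mono_on (integrableOn_gammaWeight_mul_ouNorm e α hl hε hφ hK x)
    ((integrableOn_gammaWeight hl hε).mul_const K) measurableSet_Ioi fun t ht =>
      mul_le_mul_of_nonneg_left (ouNorm_le e α hK x t) (gammaWeight_nonneg ht)

/-- Weighted Cauchy-Schwarz in time produces one factor `W`, the total mass of the weight. After
exchanging the integrals, invariance makes the `μ`-integral of the squared `ouNorm` independent of
`t`, and the remaining time integral is the second `W`. -/
theorem eLpNorm_powNegA_ouResGrad_le (hα : ∀ k, 0 < α k)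
    (hs : Summable fun k => 1 / (2 * α k)) {lam ε : ℝ} (hl : 0 < lam) (hε0 : 0 ≤ ε)
    (hε : ε < 1 / 2) {φ : H → ℝ} (hφ : Measurable φ) {K : ℝ} (hK : ∀ x, |φ x| ≤ K) :
    eLpNorm (fun x => powNegA e α ε (ouResGrad e α lam φ x)) 2 (invMeasure e α)
      ≤ ENNReal.ofReal (Real.Gamma (1 / 2 - ε) / lam ^ (1 / 2 - ε))
        * eLpNorm φ 2 (invMeasure e α) := by
  set W : ℝ≥0∞ := ENNReal.ofReal (Real.Gamma (1 / 2 - ε) / lam ^ (1 / 2 - ε)) with hWdef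
  have hW : ∫⁻ t in Set.Ioi (0 : ℝ), ENNReal.ofReal (gammaWeight lam ε t) = W := by
    rw [hWdef, ← integral_gammaWeight hl hε, ofReal_integral_eq_lintegral_ofReal
      (integrableOn_gammaWeight hl hε)]
    exact (ae_restrict_iff' measurableSet_Ioi).2 (ae_of_all _ fun t ht => gammaWeight_nonneg ht)
  have hwm : Measurable fun t => ENNReal.ofReal (gammaWeight lam ε t) :=
    (measurable_gammaWeight lam ε).ennreal_ofReal
  have hnm := measurable_ouNorm_uncurry e α hφ
  refine eLpNorm_two_le_of_lintegral_le ?_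
  have hpt : ∀ x, ‖powNegA e α ε (ouResGrad e α lam φ x)‖ₑ ^ 2
      ≤ W * ∫⁻ t in Set.Ioi (0 : ℝ), ENNReal.ofReal (gammaWeight lam ε t)
          * ENNReal.ofReal (ouNorm e α φ x t) ^ 2 := by
    intro x
    have hx : Measurable fun t => ENNReal.ofReal (ouNorm e α φ x t) :=
      (measurable_ouNorm e α hφ x).ennreal_ofReal
    rw [← hW]
    refine le_trans (pow_le_pow_left' ?_ 2)
      (sq_lintegral_weight_mul_le _ hwm.aemeasurable hx.aemeasurable)
    rw [← ofReal_norm]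
    refine (ENNReal.ofReal_le_ofReal (powNegA_ouResGrad_le e hα hl hε0 hε hφ hK x).2).trans ?_
    rw [ofReal_integral_eq_lintegral_ofReal
      (integrableOn_gammaWeight_mul_ouNorm e α hl hε hφ hK x)]
    · refine le_of_eq (setLIntegral_congr_fun measurableSet_Ioi fun t ht => ?_)
      exact ENNReal.ofReal_mul (gammaWeight_nonneg ht)
    · exact (ae_restrict_iff' measurableSet_Ioi).2 (ae_of_all _ fun t ht =>
        mul_nonneg (gammaWeight_nonneg ht) (ouNorm_nonneg e α φ x t))
  refine (lintegral_mono hpt).trans ?_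
  have hjm : Measurable fun p : H × ℝ => ENNReal.ofReal (gammaWeight lam ε p.2)
      * ENNReal.ofReal (ouNorm e α φ p.1 p.2) ^ 2 :=
    (hwm.comp measurable_snd).mul (hnm.ennreal_ofReal.pow_const 2)
  rw [lintegral_const_mul _ hjm.lintegral_prod_right',
    lintegral_lintegral_swap hjm.aemeasurable, sq, mul_assoc]
  refine mul_le_mul_right (le_of_eq ?_) W
  rw [← hW, ← lintegral_mul_const _ hwm]
  refine setLIntegral_congr_fun measurableSet_Ioi fun t ht => ?_
  have hnx : Measurable fun x => ENNReal.ofReal (ouNorm e α φ x t) ^ 2 :=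
    (Measurable.comp (g := fun p : H × ℝ => ouNorm e α φ p.1 p.2) (f := fun x : H => (x, t))
      hnm (measurable_id.prodMk measurable_const)).ennreal_ofReal.pow_const 2
  simp only
  rw [lintegral_const_mul _ hnx, ← lintegral_lintegral_ouMap e hα hs (le_of_lt ht)
    (f := fun x => ‖φ x‖ₑ ^ 2) (by fun_prop)]
  congr 1
  refine lintegral_congr fun x => ?_
  rw [← ENNReal.ofReal_pow (ouNorm_nonneg e α φ x t), sq_ouNorm,
    ofReal_integral_eq_lintegral_ofReal
      (memLp_comp_ouMap_of_bounded e α hφ hK t x).integrable_sq (ae_of_all _ fun _ => sq_nonneg _)]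
  refine lintegral_congr fun ξ => ?_
  rw [← sq_abs, ENNReal.ofReal_pow (abs_nonneg _), ← Real.norm_eq_abs, ofReal_norm]

end ResolventGradient

/-! ### The Sobolev gradient as a closed linear relation. -/

section SobolevGraph

variable {H : Type*} [NormedAddCommGroup H] [InnerProductSpace ℝ H] [CompleteSpace H]

theorem IsC1b.hasGradientAt {φ : H → ℝ} (h : IsC1b φ) (x : H) :
    HasGradientAt φ (gradient φ x) x :=
  (h.1.differentiable one_ne_zero x).hasGradientAt

theorem norm_gradient (φ : H → ℝ) (x : H) : ‖gradient φ x‖ = ‖fderiv ℝ φ x‖ :=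
  LinearIsometryEquiv.norm_map _ _

theorem IsC1b.continuous_gradient {φ : H → ℝ} (h : IsC1b φ) : Continuous (gradient φ) :=
  (InnerProductSpace.toDual ℝ H).symm.continuous.comp (h.1.continuous_fderiv one_ne_zero)

theorem IsC1b.add {φ ψ : H → ℝ} (hφ : IsC1b φ) (hψ : IsC1b ψ) : IsC1b (φ + ψ) := by
  obtain ⟨h1, ⟨K, hK⟩, K', hK'⟩ := hφ
  obtain ⟨l1, ⟨L, hL⟩, L', hL'⟩ := hψ
  refine ⟨h1.add l1, ⟨K + L, fun x => (abs_add_le _ _).trans (add_le_add (hK x) (hL x))⟩,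
    K' + L', fun x => ?_⟩
  rw [fderiv_add (h1.differentiable one_ne_zero x) (l1.differentiable one_ne_zero x)]
  exact (norm_add_le _ _).trans (add_le_add (hK' x) (hL' x))

theorem IsC1b.gradient_add {φ ψ : H → ℝ} (hφ : IsC1b φ) (hψ : IsC1b ψ) (x : H) :
    gradient (φ + ψ) x = gradient φ x + gradient ψ x := by
  rw [gradient, fderiv_add (hφ.1.differentiable one_ne_zero x)
    (hψ.1.differentiable one_ne_zero x), map_add]
  rfl

theorem IsC1b.const_smul {φ : H → ℝ} (hφ : IsC1b φ) (c : ℝ) : IsC1b (c • φ) := by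
  obtain ⟨h1, ⟨K, hK⟩, K', hK'⟩ := hφ
  refine ⟨h1.const_smul c, ⟨|c| * K, fun x => ?_⟩, |c| * K', fun x => ?_⟩
  · rw [Pi.smul_apply, smul_eq_mul, abs_mul]
    exact mul_le_mul_of_nonneg_left (hK x) (abs_nonneg c)
  · rw [fderiv_const_smul (h1.differentiable one_ne_zero x), norm_smul, Real.norm_eq_abs]
    exact mul_le_mul_of_nonneg_left (hK' x) (abs_nonneg c)

theorem IsC1b.gradient_const_smul {φ : H → ℝ} (hφ : IsC1b φ) (c : ℝ) (x : H) :
    gradient (c • φ) x = c • gradient φ x := by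
  rw [gradient, fderiv_const_smul (hφ.1.differentiable one_ne_zero x), map_smulₛₗ]
  rfl

theorem isC1b_zero : IsC1b (0 : H → ℝ) :=
  ⟨contDiff_const, ⟨0, by simp⟩, 0, by simp⟩

variable [MeasurableSpace H] [BorelSpace H] [SecondCountableTopology H]

theorem IsC1b.memLp {φ : H → ℝ} (h : IsC1b φ) (μ : Measure H) [IsFiniteMeasure μ] :
    MemLp φ 2 μ := by
  obtain ⟨h1, ⟨K, hK⟩, -⟩ := h
  exact MemLp.of_bound h1.continuous.aestronglyMeasurable K (ae_of_all _ hK)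

theorem IsC1b.memLp_gradient {φ : H → ℝ} (h : IsC1b φ) (μ : Measure H) [IsFiniteMeasure μ] :
    MemLp (gradient φ) 2 μ := by
  have hc := h.continuous_gradient
  obtain ⟨-, -, K, hK⟩ := h
  exact MemLp.of_bound hc.aestronglyMeasurable K
    (ae_of_all _ fun x => (norm_gradient φ x).trans_le (hK x))

variable (μ : Measure H) [IsFiniteMeasure μ]

/-- The graph of the gradient on `C¹_b(H)` in `L²`. -/
noncomputable def c1bGraph : Submodule ℝ (Lp ℝ 2 μ × Lp H 2 μ) where
  carrier := {p | ∃ φ : H → ℝ, IsC1b φ ∧ p.1 =ᵐ[μ] φ ∧ p.2 =ᵐ[μ] gradient φ}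
  add_mem' := by
    rintro p q ⟨φ, hφ, h1, h2⟩ ⟨ψ, hψ, l1, l2⟩
    refine ⟨φ + ψ, hφ.add hψ, (Lp.coeFn_add _ _).trans (h1.add l1),
      (Lp.coeFn_add _ _).trans ((h2.add l2).trans (.of_forall fun x => ?_))⟩
    exact (hφ.gradient_add hψ x).symm
  zero_mem' := by
    refine ⟨0, isC1b_zero, Lp.coeFn_zero _ _ _, (Lp.coeFn_zero _ _ _).trans
      (.of_forall fun x => ?_)⟩
    simp [gradient]
  smul_mem' := by
    rintro c p ⟨φ, hφ, h1, h2⟩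
    refine ⟨c • φ, hφ.const_smul c, (Lp.coeFn_smul _ _).trans (h1.const_smul c),
      (Lp.coeFn_smul _ _).trans ((h2.const_smul c).trans (.of_forall fun x => ?_))⟩
    exact (hφ.gradient_const_smul c x).symm

/-- The graph of the Sobolev gradient in `L²`. -/
noncomputable def sobolevGraph : Submodule ℝ (Lp ℝ 2 μ × Lp H 2 μ) :=
  (c1bGraph μ).topologicalClosure

theorem isClosed_sobolevGraph : IsClosed (sobolevGraph μ : Set (Lp ℝ 2 μ × Lp H 2 μ)) :=
  Submodule.isClosed_topologicalClosure _

/-- Stated for classes, approximation by `C¹_b` functions is membership in the closure of a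
subspace, so linearity and closedness become available. -/
theorem hasSobolevGradient_iff {u : H → ℝ} {g : H → H} (hu : MemLp u 2 μ) (hg : MemLp g 2 μ) :
    HasSobolevGradient μ u g ↔ (hu.toLp u, hg.toLp g) ∈ sobolevGraph μ := by
  rw [sobolevGraph, ← SetLike.mem_coe, Submodule.topologicalClosure_coe,
    mem_closure_iff_seq_limit]
  constructor
  · rintro ⟨-, -, φ, hφ, h1, h2⟩
    refine ⟨fun n => (((hφ n).memLp μ).toLp _, ((hφ n).memLp_gradient μ).toLp _),
      fun n => ⟨φ n, hφ n, ((hφ n).memLp μ).coeFn_toLp, ((hφ n).memLp_gradient μ).coeFn_toLp⟩, Tendsto.prodMk_nhds ?_ ?_⟩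
    · exact (Lp.tendsto_Lp_iff_tendsto_eLpNorm'' _ _ _ _).2 h1
    · exact (Lp.tendsto_Lp_iff_tendsto_eLpNorm'' _ _ _ _).2 h2
  · rintro ⟨p, hp, hlim⟩
    choose φ hφ h1 h2 using hp
    rw [nhds_prod_eq, tendsto_prod_iff'] at hlim
    refine ⟨hu, hg, φ, hφ, ?_, ?_⟩
    · refine ((Lp.tendsto_Lp_iff_tendsto_eLpNorm _ _ hu).1 hlim.1).congr fun n => ?_
      exact eLpNorm_congr_ae ((h1 n).sub .rfl)
    · refine ((Lp.tendsto_Lp_iff_tendsto_eLpNorm _ _ hg).1 hlim.2).congr fun n => ?_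
      exact eLpNorm_congr_ae ((h2 n).sub .rfl)

theorem hasSobolevGradient_of_mem {p : Lp ℝ 2 μ × Lp H 2 μ} (hp : p ∈ sobolevGraph μ) :
    HasSobolevGradient μ p.1 p.2 := by
  rw [hasSobolevGradient_iff μ (Lp.memLp _) (Lp.memLp _), Lp.toLp_coeFn, Lp.toLp_coeFn]
  exact hp

theorem mem_sobolevGraph_of_isC1b {φ : H → ℝ} (hφ : IsC1b φ) :
    ((hφ.memLp μ).toLp φ, (hφ.memLp_gradient μ).toLp (gradient φ)) ∈ sobolevGraph μ :=
  Submodule.le_topologicalClosure _ ⟨φ, hφ, (hφ.memLp μ).coeFn_toLp, (hφ.memLp_gradient μ).coeFn_toLp⟩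

end SobolevGraph

/-! ### Closability of the gradient. -/

section Closability

variable {H : Type*} [NormedAddCommGroup H] [InnerProductSpace ℝ H] [CompleteSpace H]
  [MeasurableSpace H] [BorelSpace H] [SecondCountableTopology H]
  {ι : Type*} [Countable ι] (e : HilbertBasis ι ℝ H) {α : ι → ℝ}

/-- The commutation relation of the Ornstein-Uhlenbeck semigroup and the partial derivatives. -/
theorem exp_mul_ouSemigroup_inner_gradient (hα : ∀ k, 0 < α k)
    (hs : Summable fun k => 1 / (2 * α k)) {t : ℝ} (ht : 0 < t) {φ : H → ℝ} (hφ : IsC1b φ)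
    (k : ι) (x : H) :
    Real.exp (-t * α k) * ouSemigroup e α t (fun y => ⟪e k, gradient φ y⟫_ℝ) x
      = ⟪e k, ouGrad e α t φ x⟫_ℝ := by
  have hgrad := hφ.hasGradientAt
  have hgc := hφ.continuous_gradient
  obtain ⟨h1, ⟨K, hK⟩, K', hK'⟩ := hφ
  have hφm := h1.continuous.measurable
  have hd := hasDerivAt_ouSemigroup e hα hs ht hφm hK k x
  have hm : Measurable fun y => ⟪e k, gradient φ y⟫_ℝ :=
    (continuous_const.inner hgc).measurable
  -- The same directional derivative is computed twice: by the gradient formula, which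
  -- differentiates the Gaussian density, and here by differentiating `φ` under the integral.
  have hd2 := (hasDerivAt_integral_of_dominated_loc_of_deriv_le (𝕜 := ℝ) (μ := whiteNoise ι)
    (F := fun s ξ => φ (ouMap e α t (x + s • e k) ξ)) (x₀ := 0)
    (F' := fun s ξ => Real.exp (-t * α k) * ⟪e k, gradient φ (ouMap e α t (x + s • e k) ξ)⟫_ℝ)
    (bound := fun _ => Real.exp (-t * α k) * K') univ_mem
    (.of_forall fun s => (hφm.comp (measurable_ouMap_right e α t _)).aestronglyMeasurable)
    ((memLp_comp_ouMap_of_bounded e α hφm hK t _).integrable one_le_two)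
    ((hm.comp (measurable_ouMap_right e α t _)).const_mul _).aestronglyMeasurable
    (ae_of_all _ fun ξ s _ => ?_) (integrable_const _) (ae_of_all _ fun ξ s _ => ?_)).2
  · simp_rw [← ouSemigroup_eq e α t hφm, zero_smul, add_zero, integral_const_mul] at hd2
    rw [ouSemigroup_eq e α t hm, hd2.unique hd, real_inner_comm]
  · rw [norm_mul, Real.norm_eq_abs, Real.abs_exp]
    refine mul_le_mul_of_nonneg_left ((norm_inner_le_norm _ _).trans ?_) (Real.exp_pos _).le
    rw [e.orthonormal.1 k, one_mul, norm_gradient]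
    exact hK' _
  · have hl : HasDerivAt (fun s : ℝ => ouMap e α t (x + s • e k) ξ)
        (Real.exp (-t * α k) • e k) s := by
      simp_rw [ouMap_add_smul e hα ht.le, mul_smul]
      have := ((((hasDerivAt_id s).smul_const (Real.exp (-t * α k) • e k)).const_add
        (expA e α t x))).add_const (gaussSeries e (ouVar α t) ξ)
      rwa [one_smul] at this
    have := (hgrad (ouMap e α t (x + s • e k) ξ)).hasFDerivAt.comp_hasDerivAt s hl
    simp only [InnerProductSpace.toDual_apply_apply, inner_smul_right] at this
    rwa [real_inner_comm]

theorem eLpNorm_inner_ouGrad_le (hα : ∀ k, 0 < α k) (hs : Summable fun k => 1 / (2 * α k))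
    {t : ℝ} (ht : 0 < t) {φ : H → ℝ} (hφ : Measurable φ) {K : ℝ} (hK : ∀ x, |φ x| ≤ K) (k : ι) :
    eLpNorm (fun x => ⟪e k, ouGrad e α t φ x⟫_ℝ) 2 (invMeasure e α)
      ≤ ENNReal.ofReal (t ^ (-(1 / 2 : ℝ))) * eLpNorm φ 2 (invMeasure e α) := by
  refine eLpNorm_two_le_of_lintegral_le ?_
  rw [← lintegral_lintegral_ouMap e hα hs ht.le (f := fun x => ‖φ x‖ₑ ^ 2) (by fun_prop),
    ← lintegral_const_mul' _ _ (ENNReal.pow_ne_top ENNReal.ofReal_ne_top)]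
  refine lintegral_mono fun x => ?_
  have h2 := memLp_comp_ouMap_of_bounded e α hφ hK t x
  have h := sum_sq_ouGrad_le e hα ht le_rfl (by norm_num) h2 {k}
  rw [Finset.sum_singleton, Real.rpow_zero, one_mul, add_zero] at h
  have h3 := ENNReal.ofReal_le_ofReal h
  rw [ENNReal.ofReal_mul (sq_nonneg _), ofReal_integral_eq_lintegral_ofReal h2.integrable_sq
    (ae_of_all _ fun _ => sq_nonneg _), ENNReal.ofReal_pow (Real.rpow_nonneg ht.le _)] at h3
  have hsq : ∀ r : ℝ, ENNReal.ofReal (r ^ 2) = ‖r‖ₑ ^ 2 := fun r => by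
    rw [← sq_abs, ENNReal.ofReal_pow (abs_nonneg _), ← Real.norm_eq_abs, ofReal_norm]
  simp_rw [hsq] at h3
  exact h3

/-- On `C¹_b` functions the left side is the norm of a component of `D R_t φ`, which smoothing
controls by `φ` alone. Both sides are continuous on the product space, so the bound extends to the
closed graph; there a vanishing first component forces `R_t ⟨e_k, g⟩ = 0` for all `t > 0`. -/
theorem norm_ouOp_inner_le (hα : ∀ k, 0 < α k) (hs : Summable fun k => 1 / (2 * α k))
    {t : ℝ} (ht : 0 < t) (k : ι) {p : Lp ℝ 2 (invMeasure e α) × Lp H 2 (invMeasure e α)}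
    (hp : p ∈ sobolevGraph (invMeasure e α)) :
    Real.exp (-t * α k) *
        ‖ouOp e hα hs t ((innerSL ℝ (e k)).compLpL 2 (invMeasure e α) p.2)‖
      ≤ t ^ (-(1 / 2 : ℝ)) * ‖p.1‖ := by
  set T : Lp ℝ 2 (invMeasure e α) × Lp H 2 (invMeasure e α) →L[ℝ] Lp ℝ 2 (invMeasure e α) :=
    (ouOp e hα hs t).comp (((innerSL ℝ (e k)).compLpL 2 (invMeasure e α)).comp
      (ContinuousLinearMap.snd ℝ _ _)) with hT
  have hcl : IsClosed {q : Lp ℝ 2 (invMeasure e α) × Lp H 2 (invMeasure e α) |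
      Real.exp (-t * α k) * ‖T q‖ ≤ t ^ (-(1 / 2 : ℝ)) * ‖q.1‖} :=
    isClosed_le (T.continuous.norm.const_mul _) (continuous_fst.norm.const_mul _)
  have hp' : p ∈ closure (c1bGraph (invMeasure e α) : Set _) := by
    rw [← Submodule.topologicalClosure_coe]; exact hp
  refine closure_minimal (fun q hq => ?_) hcl hp'
  obtain ⟨φ, hφ, h1, h2⟩ := hq
  have hid := exp_mul_ouSemigroup_inner_gradient e hα hs ht hφ k
  have hφm := hφ.1.continuous.measurable
  obtain ⟨-, ⟨K, hK⟩, -⟩ := hφ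
  have h3 : (innerSL ℝ (e k)).compLpL 2 (invMeasure e α) q.2
      =ᵐ[invMeasure e α] fun y => ⟪e k, gradient φ y⟫_ℝ := by
    filter_upwards [ContinuousLinearMap.coeFn_compLpL (p := 2) (innerSL ℝ (e k)) q.2, h2]
      with x hx hx2
    rw [hx, hx2]; rfl
  have h4 := (ouOp_coe e hα hs ht.le _).trans (ouSemigroup_congr_ae e hα hs ht.le h3)
  have h5 : ‖Real.exp (-t * α k) • ouOp e hα hs t
      ((innerSL ℝ (e k)).compLpL 2 (invMeasure e α) q.2)‖ₑ
        = eLpNorm (fun x => ⟪e k, ouGrad e α t φ x⟫_ℝ) 2 (invMeasure e α) := by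
    rw [Lp.enorm_def]
    refine eLpNorm_congr_ae ((Lp.coeFn_smul _ _).trans ?_)
    filter_upwards [h4] with x hx
    rw [Pi.smul_apply, hx, smul_eq_mul, hid]
  have h6 := eLpNorm_inner_ouGrad_le e hα hs ht hφm hK k
  rw [← h5, ← eLpNorm_congr_ae h1, ← Lp.enorm_def, ← ofReal_norm, ← ofReal_norm,
    ← ENNReal.ofReal_mul (by positivity), ENNReal.ofReal_le_ofReal_iff (by positivity),
    norm_smul, Real.norm_eq_abs, Real.abs_exp] at h6
  exact h6

/-- The gradient is closable. -/
theorem snd_eq_zero_of_mem_sobolevGraph (hα : ∀ k, 0 < α k)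
    (hs : Summable fun k => 1 / (2 * α k))
    {g : Lp H 2 (invMeasure e α)} (hg : (0, g) ∈ sobolevGraph (invMeasure e α)) : g = 0 := by
  have hk : ∀ k, (innerSL ℝ (e k)).compLpL 2 (invMeasure e α) g = 0 := by
    intro k
    refine tendsto_nhds_unique ((isContractionSemigroup_ouOp e hα hs).tendsto_zero _) ?_
    refine tendsto_const_nhds.congr' ?_
    filter_upwards [self_mem_nhdsWithin] with t ht
    have h := norm_ouOp_inner_le e hα hs ht k hg
    rw [norm_zero, mul_zero] at h
    refine (norm_le_zero_iff.1 ?_).symm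
    exact le_of_mul_le_mul_left (h.trans_eq (mul_zero _).symm) (Real.exp_pos _)
  refine Lp.ext ((?_ : (g : H → H) =ᵐ[invMeasure e α] fun _ => 0).trans
    (Lp.coeFn_zero _ _ _).symm)
  have h : ∀ᵐ x ∂(invMeasure e α), ∀ k, ⟪e k, g x⟫_ℝ = 0 := by
    rw [ae_all_iff]
    intro k
    have h1 := ContinuousLinearMap.coeFn_compLpL (p := 2) (innerSL ℝ (e k)) g
    rw [hk k] at h1
    filter_upwards [h1, Lp.coeFn_zero ℝ 2 (invMeasure e α)] with x hx hx0
    rw [hx0] at hx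
    exact hx.symm
  filter_upwards [h] with x hx
  exact ext_inner_basis e fun k => by rw [hx k, inner_zero_right]

theorem snd_eq_of_mem_sobolevGraph (hα : ∀ k, 0 < α k) (hs : Summable fun k => 1 / (2 * α k))
    {u : Lp ℝ 2 (invMeasure e α)} {g g' : Lp H 2 (invMeasure e α)}
    (hg : (u, g) ∈ sobolevGraph (invMeasure e α)) (hg' : (u, g') ∈ sobolevGraph (invMeasure e α)) :
    g = g' := by
  have h := Submodule.sub_mem _ hg hg'
  rw [Prod.mk_sub_mk, sub_self] at h
  exact sub_eq_zero.1 (snd_eq_zero_of_mem_sobolevGraph e hα hs h)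

end Closability

/-! ### Consequences of the trace class hypothesis. -/

section Hypothesis

variable {H : Type*} [NormedAddCommGroup H] [InnerProductSpace ℝ H] [CompleteSpace H]
  {ι : Type*} {A : H →ₗ.[ℝ] H} {e : HilbertBasis ι ℝ H} {α : ι → ℝ}

theorem Hypothesis1.countable (hA : Hypothesis1 A e α) : Countable ι := by
  obtain ⟨δ, -, hs⟩ := hA.traceClass
  have h := hs.countable_support
  have hu : (Function.support fun k => α k ^ (-1 + δ)) = Set.univ :=
    Set.eq_univ_of_forall fun k => (Real.rpow_pos_of_pos (hA.pos k) _).ne'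
  rw [hu] at h
  exact Set.countable_univ_iff.1 h

/-- The terms `α_k^(-1+δ)` tend to zero, so `α_k ≥ 1` outside a finite set, and there `α_k⁻¹ ≤
α_k^(-1+δ)`. -/
theorem Hypothesis1.summable (hA : Hypothesis1 A e α) : Summable fun k => 1 / (2 * α k) := by
  obtain ⟨δ, hδ, hs⟩ := hA.traceClass
  refine Summable.of_norm_bounded_eventually hs ?_
  filter_upwards [hs.tendsto_cofinite_zero.eventually_le_const one_pos] with k hk
  have hp := hA.pos k
  have h1 : 1 ≤ α k := by
    by_contra! h
    exact absurd hk (not_le.2 (Real.one_lt_rpow_of_pos_of_lt_one_of_neg hp h (by linarith [hδ.2])))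
  have h2 : (α k) ^ (-1 : ℝ) ≤ α k ^ (-1 + δ) :=
    Real.rpow_le_rpow_of_exponent_le h1 (by linarith [hδ.1])
  rw [Real.rpow_neg_one] at h2
  rw [Real.norm_of_nonneg (by positivity)]
  refine le_trans ?_ h2
  rw [one_div, mul_inv]
  have := inv_pos.2 hp
  linarith

end Hypothesis

/-! ### Monotone convergence for truncated diagonal operators. -/

section DiagonalFatou

variable {H : Type*} [NormedAddCommGroup H] [InnerProductSpace ℝ H] [CompleteSpace H]
  [MeasurableSpace H] [BorelSpace H] [SecondCountableTopology H]
  {ι : Type*} [Countable ι] (e : HilbertBasis ι ℝ H)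

/-- The squared norms of the truncations increase with `F`, so their supremum has integral at most
`c²`. It is therefore finite almost everywhere, which gives the domain, and it dominates the squared
norm of the full operator. -/
theorem eLpNorm_diagOp_le {Ω : Type*} [MeasurableSpace Ω] {μ : Measure Ω} {g : Ω → H}
    (hg : AEStronglyMeasurable g μ) {γ : ι → ℝ} {c : ℝ≥0∞} (hc : c ≠ ∞)
    (h : ∀ F : Finset ι, eLpNorm (fun x => diagFin e γ F (g x)) 2 μ ≤ c) :
    (∀ᵐ x ∂μ, InDiagDomain e γ (g x)) ∧ eLpNorm (fun x => diagOp e γ (g x)) 2 μ ≤ c := by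
  set S : Ω → ℝ≥0∞ := fun x => ⨆ F : Finset ι, ‖diagFin e γ F (g x)‖ₑ ^ 2 with hS
  have hm : ∀ F : Finset ι, AEMeasurable (fun x => ‖diagFin e γ F (g x)‖ₑ ^ 2) μ := fun F =>
    ((diagFin e γ F).continuous.comp_aestronglyMeasurable hg).enorm.pow_const 2
  have hmono : Monotone fun (F : Finset ι) x => ‖diagFin e γ F (g x)‖ₑ ^ 2 := by
    intro F F' hF x
    simp only
    rw [← ofReal_norm, ← ofReal_norm, ← ENNReal.ofReal_pow (norm_nonneg _),
      ← ENNReal.ofReal_pow (norm_nonneg _), norm_sq_diagFin, norm_sq_diagFin]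
    exact ENNReal.ofReal_le_ofReal
      (Finset.sum_le_sum_of_subset_of_nonneg hF fun _ _ _ => sq_nonneg _)
  have hint : ∫⁻ x, S x ∂μ ≤ c ^ 2 := by
    rw [hS, lintegral_iSup_directed hm hmono.directed_le]
    refine iSup_le fun F => ?_
    rw [← eLpNorm_two_sq]
    exact pow_le_pow_left' (h F) 2
  have hfin : ∀ᵐ x ∂μ, S x < ∞ :=
    ae_lt_top' (AEMeasurable.iSup hm) (hint.trans_lt (ENNReal.pow_lt_top hc.lt_top)).ne
  have hkey : ∀ᵐ x ∂μ, InDiagDomain e γ (g x) ∧ ‖diagOp e γ (g x)‖ₑ ^ 2 ≤ S x := by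
    filter_upwards [hfin] with x hx
    have hle : ∀ F : Finset ι, ‖diagFin e γ F (g x)‖ ≤ √(S x).toReal := fun F => by
      refine Real.le_sqrt_of_sq_le ?_
      have h1 : ‖diagFin e γ F (g x)‖ₑ ^ 2 ≤ S x := le_iSup (fun F : Finset ι =>
        ‖diagFin e γ F (g x)‖ₑ ^ 2) F
      have h2 := ENNReal.toReal_mono hx.ne h1
      rwa [ENNReal.toReal_pow, toReal_enorm] at h2
    obtain ⟨h1, h2⟩ := inDiagDomain_of_diagFin_le e (Real.sqrt_nonneg _) hle
    refine ⟨h1, ?_⟩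
    rw [← ofReal_norm, ← ENNReal.ofReal_pow (norm_nonneg _), ← ENNReal.ofReal_toReal hx.ne]
    refine ENNReal.ofReal_le_ofReal ?_
    rw [← Real.sq_sqrt (ENNReal.toReal_nonneg (a := S x))]
    exact pow_le_pow_left₀ (norm_nonneg _) h2 2
  refine ⟨hkey.mono fun x hx => hx.1, (ENNReal.pow_right_strictMono two_ne_zero).le_iff_le.1 ?_⟩
  rw [eLpNorm_two_sq]
  exact (lintegral_mono_ae (hkey.mono fun x hx => hx.2)).trans hint

end DiagonalFatou

/-! ### Essentially bounded functions and their bounded versions. -/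

section BoundedVersion

variable {Ω : Type*} [MeasurableSpace Ω] {μ : Measure Ω}

theorem exists_bounded_version {f : Ω → ℝ} (hf : AEMeasurable f μ) {S : ℝ} (hS : 0 ≤ S)
    (h : ∀ᵐ x ∂μ, |f x| ≤ S) :
    ∃ f' : Ω → ℝ, Measurable f' ∧ (∀ x, |f' x| ≤ S) ∧ f =ᵐ[μ] f' := by
  refine ⟨fun x => max (-S) (min S (hf.mk f x)),
    measurable_const.max (measurable_const.min hf.measurable_mk), fun x => ?_, ?_⟩
  · exact abs_le.2 ⟨le_max_left _ _, max_le (by linarith) (min_le_left _ _)⟩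
  · filter_upwards [h, hf.ae_eq_mk] with x hx hx2
    rw [← hx2, min_eq_right (abs_le.1 hx).2, max_eq_right (abs_le.1 hx).1]

theorem ae_norm_le_supNorm {H F : Type*} [NormedAddCommGroup H] [MeasurableSpace H]
    [NormedAddCommGroup F] [MeasurableSpace F] (μ : Measure H) {f : H → F}
    (hf : IsBoundedBorel f) : ∀ᵐ x ∂μ, ‖f x‖ ≤ supNorm μ f := by
  obtain ⟨-, K, hK⟩ := hf
  have hfin : eLpNormEssSup f μ ≠ ∞ := (eLpNormEssSup_lt_top_of_ae_bound (ae_of_all _ hK)).ne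
  filter_upwards [ae_le_eLpNormEssSup (f := f) (μ := μ)] with x hx
  have := ENNReal.toReal_mono hfin hx
  rwa [toReal_enorm] at this

theorem supNorm_nonneg {H F : Type*} [NormedAddCommGroup H] [MeasurableSpace H]
    [NormedAddCommGroup F] (μ : Measure H) (f : H → F) : 0 ≤ supNorm μ f :=
  ENNReal.toReal_nonneg

theorem supNorm_le {H F : Type*} [NormedAddCommGroup H] [MeasurableSpace H]
    [NormedAddCommGroup F] {μ : Measure H} {f : H → F} {S : ℝ} (hS : 0 ≤ S)
    (h : ∀ᵐ x ∂μ, ‖f x‖ ≤ S) : supNorm μ f ≤ S :=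
  ENNReal.toReal_le_of_le_ofReal hS (eLpNormEssSup_le_of_ae_bound h)

end BoundedVersion

/-! ### The bounded operator `D(λ - L₂)⁻¹` on `L²(μ)`. -/

section ResolventDerivative

variable {H : Type*} [NormedAddCommGroup H] [InnerProductSpace ℝ H] [CompleteSpace H]
  [MeasurableSpace H] [BorelSpace H] [SecondCountableTopology H]
  {ι : Type*} [Countable ι] (e : HilbertBasis ι ℝ H) {α : ι → ℝ}

theorem memLp_of_bounded (α : ι → ℝ) {φ : H → ℝ} (hφ : Measurable φ) {K : ℝ}
    (hK : ∀ x, |φ x| ≤ K) : MemLp φ 2 (invMeasure e α) :=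
  MemLp.of_bound hφ.aestronglyMeasurable K (ae_of_all _ hK)

theorem powNegA_zero (α : ι → ℝ) (w : H) : powNegA e α 0 w = w := by
  simp only [powNegA, diagOp, Real.rpow_zero, one_mul]
  exact series_inner e w

theorem IsC1b.eq_of_ae_eq (hα : ∀ k, 0 < α k) (hs : Summable fun k => 1 / (2 * α k))
    {u v : H → ℝ} (hu : IsC1b u) (hv : IsC1b v) (h : u =ᵐ[invMeasure e α] v) : u = v := by
  have := isOpenPosMeasure_invMeasure e hα hs
  exact (hu.1.continuous.ae_eq_iff_eq _ hv.1.continuous).1 h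

theorem ouRes_toLp_of_bounded (hα : ∀ k, 0 < α k) (hs : Summable fun k => 1 / (2 * α k))
    {lam : ℝ} (hl : 0 < lam) {φ : H → ℝ} (hφ : Measurable φ) {K : ℝ} (hK : ∀ x, |φ x| ≤ K) :
    ouRes e hα hs hl ((memLp_of_bounded e α hφ hK).toLp φ)
      =ᵐ[invMeasure e α] ouResFun e α lam φ :=
  ((isResolventOf_iff e hα hs hl _).1 (isResolventOf_ouResFun e hα hs hl hφ hK)).symm

/-- The pairs of a function in `L²` with a bounded version, and the gradient of its resolvent. -/
def boundedResGraph (e : HilbertBasis ι ℝ H) (α : ι → ℝ) (lam : ℝ) :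
    Set (Lp ℝ 2 (invMeasure e α) × Lp H 2 (invMeasure e α)) :=
  {p | ∃ φ : H → ℝ, Measurable φ ∧ (∃ K : ℝ, ∀ x, |φ x| ≤ K) ∧ p.1 =ᵐ[invMeasure e α] φ ∧
    p.2 =ᵐ[invMeasure e α] ouResGrad e α lam φ}

theorem mem_sobolevGraph_of_mem_boundedResGraph (hα : ∀ k, 0 < α k)
    (hs : Summable fun k => 1 / (2 * α k)) {lam : ℝ} (hl : 0 < lam)
    {p : Lp ℝ 2 (invMeasure e α)} {g : Lp H 2 (invMeasure e α)}
    (hp : (p, g) ∈ boundedResGraph e α lam) :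
    (ouRes e hα hs hl p, g) ∈ sobolevGraph (invMeasure e α) := by
  obtain ⟨φ, hφ, ⟨K, hK⟩, h1, h2⟩ := hp
  dsimp only at h1 h2
  refine Submodule.le_topologicalClosure _ ⟨_, isC1b_ouResFun e hα hs hl hφ hK, ?_, ?_⟩
  · have h3 : p = (memLp_of_bounded e α hφ hK).toLp φ := Lp.ext (h1.trans (MemLp.coeFn_toLp _).symm)
    simp only
    rw [h3]
    exact ouRes_toLp_of_bounded e hα hs hl hφ hK
  · rwa [gradient_ouResFun e hα hs hl hφ hK]

theorem exists_mem_boundedResGraph (hα : ∀ k, 0 < α k) (hs : Summable fun k => 1 / (2 * α k))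
    {lam : ℝ} (hl : 0 < lam) {φ : H → ℝ} (hφ : Measurable φ) {K : ℝ} (hK : ∀ x, |φ x| ≤ K)
    {p : Lp ℝ 2 (invMeasure e α)} (hp : p =ᵐ[invMeasure e α] φ) :
    ∃ g, (p, g) ∈ boundedResGraph e α lam := by
  have hg : MemLp (ouResGrad e α lam φ) 2 (invMeasure e α) :=
    MemLp.of_bound (continuous_ouResGrad e hα hs hl hφ hK).aestronglyMeasurable _
      (ae_of_all _ (norm_ouResGrad_le e hα hl hφ hK))
  exact ⟨hg.toLp _, φ, hφ, ⟨K, hK⟩, hp, hg.coeFn_toLp⟩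

/-- The gradient of the resolvent of the difference and the difference of the gradients both belong
to the same function in the Sobolev graph, so closability makes them equal. -/
theorem sub_mem_boundedResGraph (hα : ∀ k, 0 < α k) (hs : Summable fun k => 1 / (2 * α k))
    {lam : ℝ} (hl : 0 < lam) {p q : Lp ℝ 2 (invMeasure e α) × Lp H 2 (invMeasure e α)}
    (hp : p ∈ boundedResGraph e α lam) (hq : q ∈ boundedResGraph e α lam) :
    p - q ∈ boundedResGraph e α lam := by
  have h1 := mem_sobolevGraph_of_mem_boundedResGraph e hα hs hl hp
  have h2 := mem_sobolevGraph_of_mem_boundedResGraph e hα hs hl hq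
  obtain ⟨φ, hφ, ⟨K, hK⟩, hp1, -⟩ := hp
  obtain ⟨ψ, hψ, ⟨L, hL⟩, hq1, -⟩ := hq
  obtain ⟨g, hg⟩ := exists_mem_boundedResGraph e hα hs hl (hφ.sub hψ)
    (fun x => (abs_sub (φ x) (ψ x)).trans (add_le_add (hK x) (hL x)))
    ((Lp.coeFn_sub p.1 q.1).trans (hp1.sub hq1))
  have h3 := mem_sobolevGraph_of_mem_boundedResGraph e hα hs hl hg
  have h4 := Submodule.sub_mem _ h1 h2
  rw [Prod.mk_sub_mk, ← map_sub] at h4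
  have h5 := snd_eq_of_mem_sobolevGraph e hα hs h3 h4
  have h6 : p - q = (p.1 - q.1, g) := Prod.ext rfl h5.symm
  rwa [h6]

theorem norm_diagFin_le_of_mem_boundedResGraph (hα : ∀ k, 0 < α k)
    (hs : Summable fun k => 1 / (2 * α k)) {lam ε : ℝ} (hl : 0 < lam) (hε0 : 0 ≤ ε)
    (hε : ε < 1 / 2) {p : Lp ℝ 2 (invMeasure e α)} {g : Lp H 2 (invMeasure e α)}
    (hp : (p, g) ∈ boundedResGraph e α lam) (F : Finset ι) :
    ‖(diagFin e (fun k => α k ^ ε) F).compLpL 2 (invMeasure e α) g‖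
      ≤ Real.Gamma (1 / 2 - ε) / lam ^ (1 / 2 - ε) * ‖p‖ := by
  have hG : 0 ≤ Real.Gamma (1 / 2 - ε) := (Real.Gamma_pos_of_pos (by linarith)).le
  obtain ⟨φ, hφ, ⟨K, hK⟩, h1, h2⟩ := hp
  dsimp only at h1 h2
  have h3 : eLpNorm (fun x => diagFin e (fun k => α k ^ ε) F (ouResGrad e α lam φ x)) 2
      (invMeasure e α) ≤ eLpNorm (fun x => powNegA e α ε (ouResGrad e α lam φ x)) 2
        (invMeasure e α) :=
    eLpNorm_mono fun x => norm_diagFin_le e (powNegA_ouResGrad_le e hα hl hε0 hε hφ hK x).1 F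
  have h4 := h3.trans (eLpNorm_powNegA_ouResGrad_le e hα hs hl hε0 hε hφ hK)
  rw [← ENNReal.ofReal_le_ofReal_iff (by positivity), ENNReal.ofReal_mul (by positivity),
    ofReal_norm, ofReal_norm, Lp.enorm_def, Lp.enorm_def, eLpNorm_congr_ae h1]
  refine le_of_eq_of_le (eLpNorm_congr_ae ?_) h4
  filter_upwards [ContinuousLinearMap.coeFn_compLpL (p := 2) (diagFin e (fun k => α k ^ ε) F) g,
    h2] with x hx hx2
  rw [hx, hx2]

theorem norm_snd_le_of_mem_boundedResGraph (hα : ∀ k, 0 < α k)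
    (hs : Summable fun k => 1 / (2 * α k)) {lam : ℝ} (hl : 0 < lam)
    {p : Lp ℝ 2 (invMeasure e α)} {g : Lp H 2 (invMeasure e α)}
    (hp : (p, g) ∈ boundedResGraph e α lam) :
    ‖g‖ ≤ Real.Gamma (1 / 2 - 0) / lam ^ (1 / 2 - 0 : ℝ) * ‖p‖ := by
  have hG : 0 ≤ Real.Gamma (1 / 2 - 0) := (Real.Gamma_pos_of_pos (by norm_num)).le
  obtain ⟨φ, hφ, ⟨K, hK⟩, h1, h2⟩ := hp
  dsimp only at h1 h2
  have h4 := eLpNorm_powNegA_ouResGrad_le e hα hs hl le_rfl (by norm_num) hφ hK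
  simp_rw [powNegA_zero] at h4
  rwa [← ENNReal.ofReal_le_ofReal_iff (by positivity), ENNReal.ofReal_mul (by positivity),
    ofReal_norm, ofReal_norm, Lp.enorm_def, Lp.enorm_def, eLpNorm_congr_ae h1,
    eLpNorm_congr_ae h2]

/-- Approximation of `φ` by bounded continuous functions: the `L²` bound makes their resolvent
gradients Cauchy, the Sobolev graph is closed, and the bounds survive in the limit because they are
stated for bounded truncations. -/
theorem exists_resolvent_derivative (hα : ∀ k, 0 < α k) (hs : Summable fun k => 1 / (2 * α k))
    {lam : ℝ} (hl : 0 < lam) (φ : Lp ℝ 2 (invMeasure e α)) :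
    ∃ g : Lp H 2 (invMeasure e α), (ouRes e hα hs hl φ, g) ∈ sobolevGraph (invMeasure e α) ∧
      ‖g‖ ≤ Real.Gamma (1 / 2 - 0) / lam ^ (1 / 2 - 0 : ℝ) * ‖φ‖ ∧
      ∀ ε : ℝ, 0 ≤ ε → ε < 1 / 2 → ∀ F : Finset ι,
        ‖(diagFin e (fun k => α k ^ ε) F).compLpL 2 (invMeasure e α) g‖
          ≤ Real.Gamma (1 / 2 - ε) / lam ^ (1 / 2 - ε) * ‖φ‖ := by
  have hd := BoundedContinuousFunction.toLp_denseRange (p := 2) (E := ℝ) (μ := invMeasure e α)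
    ℝ (by simp)
  obtain ⟨ψ, hψ, hlim⟩ := mem_closure_iff_seq_limit.1 (hd φ)
  choose b hb using hψ
  have hex : ∀ n, ∃ g, (ψ n, g) ∈ boundedResGraph e α lam := fun n =>
    exists_mem_boundedResGraph e hα hs hl (b n).continuous.measurable
      (fun x => (b n).norm_coe_le_norm x)
      (by rw [← hb n]; exact BoundedContinuousFunction.coeFn_toLp _ _ _ (b n))
  choose g hg using hex
  set c : ℝ := Real.Gamma (1 / 2 - 0) / lam ^ (1 / 2 - 0 : ℝ) with hc
  have hcau : CauchySeq g := by
    rw [cauchySeq_iff_tendsto_dist_atTop_0]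
    have h1 := (cauchySeq_iff_tendsto_dist_atTop_0.1 hlim.cauchySeq).const_mul c
    rw [mul_zero] at h1
    refine squeeze_zero (fun _ => dist_nonneg) (fun n => ?_) h1
    rw [dist_eq_norm, dist_eq_norm]
    exact norm_snd_le_of_mem_boundedResGraph e hα hs hl
      (sub_mem_boundedResGraph e hα hs hl (hg n.1) (hg n.2))
  obtain ⟨g', hg'⟩ := cauchySeq_tendsto_of_complete hcau
  refine ⟨g', ?_, ?_, fun ε hε0 hε F => ?_⟩
  · have h1 : Tendsto (fun n => ouRes e hα hs hl (ψ n)) atTop (𝓝 (ouRes e hα hs hl φ)) :=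
      ((ouRes e hα hs hl).continuous.tendsto φ).comp hlim
    have h2 : ∀ n, (ouRes e hα hs hl (ψ n), g n) ∈ sobolevGraph (invMeasure e α) := fun n =>
      mem_sobolevGraph_of_mem_boundedResGraph e hα hs hl (hg n)
    exact (isClosed_sobolevGraph (invMeasure e α)).mem_of_tendsto (h1.prodMk_nhds hg')
      (.of_forall h2)
  · exact le_of_tendsto_of_tendsto' hg'.norm (hlim.norm.const_mul c) fun n =>
      norm_snd_le_of_mem_boundedResGraph e hα hs hl (hg n)
  · set T := (diagFin e (fun k => α k ^ ε) F).compLpL 2 (invMeasure e α)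
    have h1 : Tendsto (fun n => ‖T (g n)‖) atTop (𝓝 ‖T g'‖) :=
      ((T.continuous.tendsto g').comp hg').norm
    exact le_of_tendsto_of_tendsto' h1 (hlim.norm.const_mul _) fun n =>
      norm_diagFin_le_of_mem_boundedResGraph e hα hs hl hε0 hε (hg n) F

/-- The gradient of the resolvent, as a bounded operator on `L²`. -/
noncomputable def ouResD (hα : ∀ k, 0 < α k) (hs : Summable fun k => 1 / (2 * α k)) {lam : ℝ}
    (hl : 0 < lam) : Lp ℝ 2 (invMeasure e α) →L[ℝ] Lp H 2 (invMeasure e α) :=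
  LinearMap.mkContinuous
    { toFun := fun φ => (exists_resolvent_derivative e hα hs hl φ).choose
      map_add' := fun φ ψ => by
        have h1 := (exists_resolvent_derivative e hα hs hl φ).choose_spec.1
        have h2 := (exists_resolvent_derivative e hα hs hl ψ).choose_spec.1
        have h3 := (exists_resolvent_derivative e hα hs hl (φ + ψ)).choose_spec.1
        have h4 := Submodule.add_mem _ h1 h2
        rw [Prod.mk_add_mk, ← map_add] at h4
        exact snd_eq_of_mem_sobolevGraph e hα hs h3 h4
      map_smul' := fun c φ => by
        have h1 := (exists_resolvent_derivative e hα hs hl φ).choose_spec.1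
        have h3 := (exists_resolvent_derivative e hα hs hl (c • φ)).choose_spec.1
        have h4 := Submodule.smul_mem _ c h1
        rw [Prod.smul_mk, ← map_smul] at h4
        exact snd_eq_of_mem_sobolevGraph e hα hs h3 h4 }
    (Real.Gamma (1 / 2 - 0) / lam ^ (1 / 2 - 0 : ℝ))
    fun φ => (exists_resolvent_derivative e hα hs hl φ).choose_spec.2.1

theorem ouResD_mem (hα : ∀ k, 0 < α k) (hs : Summable fun k => 1 / (2 * α k)) {lam : ℝ}
    (hl : 0 < lam) (φ : Lp ℝ 2 (invMeasure e α)) :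
    (ouRes e hα hs hl φ, ouResD e hα hs hl φ) ∈ sobolevGraph (invMeasure e α) :=
  (exists_resolvent_derivative e hα hs hl φ).choose_spec.1

theorem hasSobolevGradient_ouRes (hα : ∀ k, 0 < α k) (hs : Summable fun k => 1 / (2 * α k))
    {lam : ℝ} (hl : 0 < lam) (φ : Lp ℝ 2 (invMeasure e α)) :
    HasSobolevGradient (invMeasure e α) (ouRes e hα hs hl φ) (ouResD e hα hs hl φ) :=
  hasSobolevGradient_of_mem _ (ouResD_mem e hα hs hl φ)

theorem ae_eq_ouResD (hα : ∀ k, 0 < α k) (hs : Summable fun k => 1 / (2 * α k))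
    {lam : ℝ} (hl : 0 < lam) {φ : Lp ℝ 2 (invMeasure e α)} {v : H → ℝ} {Dv : H → H}
    (hv : v =ᵐ[invMeasure e α] ouRes e hα hs hl φ)
    (hD : HasSobolevGradient (invMeasure e α) v Dv) :
    Dv =ᵐ[invMeasure e α] ouResD e hα hs hl φ := by
  have h1 := (hasSobolevGradient_iff _ hD.1 hD.2.1).1 hD
  have h2 : hD.1.toLp v = ouRes e hα hs hl φ := Lp.ext (hD.1.coeFn_toLp.trans hv)
  rw [h2] at h1
  have h3 := snd_eq_of_mem_sobolevGraph e hα hs h1 (ouResD_mem e hα hs hl φ)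
  rw [← h3]
  exact hD.2.1.coeFn_toLp.symm

/-- Full support turns almost everywhere equality of `C¹_b` functions into equality, so the explicit
formula is valid at every point for any `C¹_b` version of the resolvent. -/
theorem eq_ouResFun_of_isResolventOf (hα : ∀ k, 0 < α k)
    (hs : Summable fun k => 1 / (2 * α k)) {lam : ℝ} (hl : 0 < lam) {φ φ' v : H → ℝ}
    (hv : IsC1b v) (h : IsResolventOf e α lam φ v) (hφ' : Measurable φ') {K : ℝ}
    (hK : ∀ x, |φ' x| ≤ K) (hφ : φ =ᵐ[invMeasure e α] φ') : v = ouResFun e α lam φ' := by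
  refine hv.eq_of_ae_eq e hα hs (isC1b_ouResFun e hα hs hl hφ' hK) ?_
  refine ((isResolventOf_iff e hα hs hl (IsResolventOf.memLp e h)).1 h).trans ?_
  rw [(MemLp.toLp_eq_toLp_iff _ (memLp_of_bounded e α hφ' hK)).2 hφ]
  exact ouRes_toLp_of_bounded e hα hs hl hφ' hK

theorem isGradientConstant_gamma (hα : ∀ k, 0 < α k) (hs : Summable fun k => 1 / (2 * α k)) :
    IsGradientConstant e α fun ε => Real.Gamma (1 / 2 - ε) where
  pos ε hε := Real.Gamma_pos_of_pos (by linarith [hε.2])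
  sup_bound ε hε lam hl φ v hφ hv h x := by
    -- The estimate is in terms of the essential supremum, so `φ` is first replaced by a version
    -- bounded everywhere by that number.
    obtain ⟨φ', hm, hK, heq⟩ := exists_bounded_version hφ.1.aemeasurable
      (supNorm_nonneg (invMeasure e α) φ) (ae_norm_le_supNorm (invMeasure e α) hφ)
    rw [eq_ouResFun_of_isResolventOf e hα hs hl hv h hm hK heq, gradient_ouResFun e hα hs hl hm hK]
    exact ⟨(powNegA_ouResGrad_le e hα hl hε.1 hε.2 hm hK x).1,
      powNegA_ouResGrad_sup_le e hα hl hε.1 hε.2 hm hK x⟩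
  L2_bound ε hε lam hl φ v Dv hφ h hD := by
    have hG : 0 ≤ Real.Gamma (1 / 2 - ε) := (Real.Gamma_pos_of_pos (by linarith [hε.2])).le
    have hae := ae_eq_ouResD e hα hs hl ((isResolventOf_iff e hα hs hl hφ).1 h) hD
    have hb := (exists_resolvent_derivative e hα hs hl (hφ.toLp φ)).choose_spec.2.2 ε hε.1 hε.2
    refine eLpNorm_diagOp_le e hD.2.1.1
      (ENNReal.mul_ne_top ENNReal.ofReal_ne_top hφ.eLpNorm_ne_top) fun F => ?_
    have h1 := ENNReal.ofReal_le_ofReal (hb F)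
    rw [ENNReal.ofReal_mul (by positivity), ofReal_norm, ofReal_norm, Lp.enorm_def,
      Lp.enorm_toLp] at h1
    refine le_of_eq_of_le (eLpNorm_congr_ae ?_) h1
    filter_upwards [hae, ContinuousLinearMap.coeFn_compLpL (p := 2)
      (diagFin e (fun k => α k ^ ε) F)
      (exists_resolvent_derivative e hα hs hl (hφ.toLp φ)).choose] with x hx hx2
    rw [hx2, hx]
    rfl

end ResolventDerivative

/-! ### Pairing with a bounded vector field; dominated convergence in `L²`. -/

section Pairing

variable {H : Type*} [NormedAddCommGroup H] [InnerProductSpace ℝ H] {Ω : Type*}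
  [MeasurableSpace Ω] {μ : Measure Ω}

theorem memLp_inner_of_ae_bound {B : Ω → H} (hB : AEStronglyMeasurable B μ) {b : ℝ}
    (hb : ∀ᵐ x ∂μ, ‖B x‖ ≤ b) (g : Lp H 2 μ) : MemLp (fun x => ⟪B x, g x⟫_ℝ) 2 μ :=
  (Lp.memLp g).of_le_mul (c := b) (hB.inner (Lp.aestronglyMeasurable g)) <| by
    filter_upwards [hb] with x hx
    exact (norm_inner_le_norm _ _).trans (mul_le_mul_of_nonneg_right hx (norm_nonneg _))

theorem norm_toLp_inner_le {B : Ω → H} (hB : AEStronglyMeasurable B μ) {b : ℝ}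
    (hb : ∀ᵐ x ∂μ, ‖B x‖ ≤ b) (g : Lp H 2 μ) :
    ‖(memLp_inner_of_ae_bound hB hb g).toLp _‖ ≤ b * ‖g‖ := by
  refine Lp.norm_le_mul_norm_of_ae_le_mul ?_
  filter_upwards [hb, (memLp_inner_of_ae_bound hB hb g).coeFn_toLp] with x hx hx2
  rw [hx2]
  exact (norm_inner_le_norm _ _).trans (mul_le_mul_of_nonneg_right hx (norm_nonneg _))

/-- The pairing with an essentially bounded vector field, as an operator on `L²`. -/
noncomputable def pairing (B : Ω → H) (hB : AEStronglyMeasurable B μ) {b : ℝ}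
    (hb : ∀ᵐ x ∂μ, ‖B x‖ ≤ b) : Lp H 2 μ →L[ℝ] Lp ℝ 2 μ :=
  LinearMap.mkContinuous
    { toFun := fun g => (memLp_inner_of_ae_bound hB hb g).toLp _
      map_add' := fun g h => by
        rw [← MemLp.toLp_add, MemLp.toLp_eq_toLp_iff]
        filter_upwards [Lp.coeFn_add g h] with x hx
        rw [hx, Pi.add_apply, Pi.add_apply, inner_add_right]
      map_smul' := fun c g => by
        rw [RingHom.id_apply, ← MemLp.toLp_const_smul, MemLp.toLp_eq_toLp_iff]
        filter_upwards [Lp.coeFn_smul c g] with x hx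
        rw [hx, Pi.smul_apply, Pi.smul_apply, inner_smul_right, smul_eq_mul] }
    b (norm_toLp_inner_le hB hb)

theorem pairing_coe (B : Ω → H) (hB : AEStronglyMeasurable B μ) {b : ℝ}
    (hb : ∀ᵐ x ∂μ, ‖B x‖ ≤ b) (g : Lp H 2 μ) :
    pairing B hB hb g =ᵐ[μ] fun x => ⟪B x, g x⟫_ℝ :=
  (memLp_inner_of_ae_bound hB hb g).coeFn_toLp

theorem norm_pairing_le (B : Ω → H) (hB : AEStronglyMeasurable B μ) {b : ℝ}
    (hb : ∀ᵐ x ∂μ, ‖B x‖ ≤ b) (g : Lp H 2 μ) : ‖pairing B hB hb g‖ ≤ b * ‖g‖ :=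
  norm_toLp_inner_le hB hb g

theorem tendsto_eLpNorm_two_of_dominated {E : Type*} [NormedAddCommGroup E] {f : ℕ → Ω → E}
    {g : Ω → E} (hf : ∀ n, AEStronglyMeasurable (fun x => f n x - g x) μ) {G : Ω → ℝ}
    (hG : MemLp G 2 μ) (hfG : ∀ n, ∀ᵐ x ∂μ, ‖f n x - g x‖ ≤ G x)
    (h : ∀ᵐ x ∂μ, Tendsto (fun n => f n x) atTop (𝓝 (g x))) :
    Tendsto (fun n => eLpNorm (fun x => f n x - g x) 2 μ) atTop (𝓝 0) := by
  rw [tendsto_eLpNorm_two_zero_iff]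
  have hfin : ∫⁻ x, ‖G x‖ₑ ^ 2 ∂μ ≠ ∞ := by
    rw [← eLpNorm_two_sq]
    exact ENNReal.pow_ne_top hG.eLpNorm_ne_top
  rw [← lintegral_zero (μ := μ)]
  refine tendsto_lintegral_of_dominated_convergence' _ (fun n => (hf n).enorm.pow_const 2)
    (fun n => ?_) hfin ?_
  · filter_upwards [hfG n] with x hx
    exact pow_le_pow_left' (enorm_le_iff_norm_le.2 (hx.trans (le_abs_self _))) 2
  · filter_upwards [h] with x hx
    have h1 := (tendsto_iff_norm_sub_tendsto_zero.1 hx)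
    have h2 := (ENNReal.continuous_ofReal.tendsto 0).comp h1
    have h3 := ENNReal.Tendsto.pow (n := 2) h2
    simpa [Function.comp_def, ofReal_norm] using h3

theorem ae_abs_le_of_tendsto {φ : ℕ → Lp ℝ 2 μ} {ψ : Lp ℝ 2 μ} {K : ℝ}
    (h : Tendsto φ atTop (𝓝 ψ)) (hK : ∀ n, ∀ᵐ x ∂μ, |φ n x| ≤ K) : ∀ᵐ x ∂μ, |ψ x| ≤ K := by
  obtain ⟨ns, -, hns⟩ := (tendstoInMeasure_of_tendsto_Lp h).exists_seq_tendsto_ae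
  filter_upwards [hns, ae_all_iff.2 hK] with x hx hKx
  exact le_of_tendsto hx.abs (.of_forall fun n => hKx (ns n))

end Pairing

/-! ### Inverses of `1 - T` for contractions, and their stability. -/

section InverseOneSub

variable {E : Type*} [NormedAddCommGroup E] [NormedSpace ℝ E]

theorem apply_inverse_apply {S : E →L[ℝ] E} (hS : IsUnit S) (v : E) :
    S (Ring.inverse S v) = v := by
  have h := congrArg (fun R : E →L[ℝ] E => R v) (Ring.mul_inverse_cancel _ hS)
  exact h

theorem inverse_apply_apply {S : E →L[ℝ] E} (hS : IsUnit S) (v : E) :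
    Ring.inverse S (S v) = v := by
  have h := congrArg (fun R : E →L[ℝ] E => R v) (Ring.inverse_mul_cancel _ hS)
  exact h

/-- Convergence of the solutions of `ψ - T ψ = F` for strongly convergent contractions `T`. -/
theorem tendsto_inverse_one_sub {T : E →L[ℝ] E} {Tn : ℕ → E →L[ℝ] E} (hT : IsUnit (1 - T))
    (hTn : ∀ n, IsUnit (1 - Tn n)) (hle : ∀ n v, ‖Tn n v‖ ≤ 1 / 2 * ‖v‖)
    (hlim : ∀ v, Tendsto (fun n => Tn n v) atTop (𝓝 (T v))) {F : E} {Fn : ℕ → E}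
    (hF : Tendsto Fn atTop (𝓝 F)) :
    Tendsto (fun n => Ring.inverse (1 - Tn n) (Fn n)) atTop (𝓝 (Ring.inverse (1 - T) F)) := by
  set ψ := Ring.inverse (1 - T) F with hψ
  have hψT : ψ - T ψ = F := apply_inverse_apply hT F
  rw [tendsto_iff_norm_sub_tendsto_zero]
  have h0 : Tendsto (fun n => 2 * (‖Fn n - F‖ + ‖Tn n ψ - T ψ‖)) atTop (𝓝 0) := by
    have := ((tendsto_iff_norm_sub_tendsto_zero.1 hF).add
      (tendsto_iff_norm_sub_tendsto_zero.1 (hlim ψ))).const_mul 2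
    simpa using this
  refine squeeze_zero (fun _ => norm_nonneg _) (fun n => ?_) h0
  have h1 := apply_inverse_apply (hTn n) (Fn n)
  set ψn := Ring.inverse (1 - Tn n) (Fn n)
  rw [sub_apply, one_apply_eq_self] at h1
  -- The strong limit is used only at the fixed vector `ψ`; the last term has at most half the norm
  -- of the left side and is absorbed, which gives the factor 2.
  have h2 : ψn - ψ = (Fn n - F) + (Tn n ψ - T ψ) + Tn n (ψn - ψ) := by
    rw [map_sub, ← h1, ← hψT]
    abel
  have h3 := norm_add₃_le (a := Fn n - F) (b := Tn n ψ - T ψ) (c := Tn n (ψn - ψ))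
  rw [← h2] at h3
  have h4 := hle n (ψn - ψ)
  linarith

end InverseOneSub

/-! ### The equation with a drift. -/

section Drift

variable {H : Type*} [NormedAddCommGroup H] [InnerProductSpace ℝ H] [CompleteSpace H]
  [MeasurableSpace H] [BorelSpace H] [SecondCountableTopology H]
  {ι : Type*} [Countable ι] {e : HilbertBasis ι ℝ H} {α : ι → ℝ} (hα : ∀ k, 0 < α k)
  (hs : Summable fun k => 1 / (2 * α k)) {lam : ℝ} (hl : 0 < lam)

/-- The operator is constructed with a Gamma constant, but the condition on `λ` refers to an
arbitrary admissible `C`, so its norm has to be estimated anew by `C 0`. -/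
theorem IsGradientConstant.norm_ouResD_le {C : ℝ → ℝ} (hC : IsGradientConstant e α C)
    (φ : Lp ℝ 2 (invMeasure e α)) :
    ‖ouResD e hα hs hl φ‖ ≤ C 0 / lam ^ (1 / 2 - 0 : ℝ) * ‖φ‖ := by
  have hC0 := hC.pos 0 (by norm_num)
  have h := (hC.L2_bound 0 (by norm_num) lam hl φ _ _ (Lp.memLp φ)
    ((isResolvent_ouRes e hα hs hl φ _).1 rfl) (hasSobolevGradient_ouRes e hα hs hl φ)).2
  simp_rw [powNegA_zero] at h
  rwa [← ENNReal.ofReal_le_ofReal_iff (by positivity), ENNReal.ofReal_mul (by positivity),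
    ofReal_norm, ofReal_norm, Lp.enorm_def, Lp.enorm_def]

theorem IsC1b.hasSobolevGradient {u : H → ℝ} (hu : IsC1b u) (μ : Measure H) [IsFiniteMeasure μ] :
    HasSobolevGradient μ u (gradient u) :=
  (hasSobolevGradient_iff μ (hu.memLp μ) (hu.memLp_gradient μ)).2 (mem_sobolevGraph_of_isC1b μ hu)

/-- A function in `L²` with an essential bound has a resolvent in `C¹_b`. -/
theorem IsGradientConstant.exists_isC1b {C : ℝ → ℝ} (hC : IsGradientConstant e α C)
    {ψ : Lp ℝ 2 (invMeasure e α)} {K : ℝ} (hK0 : 0 ≤ K)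
    (hψ : ∀ᵐ x ∂(invMeasure e α), |ψ x| ≤ K) :
    ∃ u : H → ℝ, IsC1b u ∧ u =ᵐ[invMeasure e α] ouRes e hα hs hl ψ ∧ (∀ x, |u x| ≤ K / lam) ∧
      gradient u =ᵐ[invMeasure e α] ouResD e hα hs hl ψ ∧
      ∀ ε ∈ Set.Ico (0 : ℝ) (1 / 2), ∀ x, InDomPowNegA e α ε (gradient u x) ∧
        ‖powNegA e α ε (gradient u x)‖ ≤ C ε / lam ^ (1 / 2 - ε) * K := by
  obtain ⟨ψ', hm, hK, heq⟩ := exists_bounded_version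
    (Lp.aestronglyMeasurable ψ).aemeasurable hK0 hψ
  have hc := isC1b_ouResFun e hα hs hl hm hK
  have hae : ouResFun e α lam ψ' =ᵐ[invMeasure e α] ouRes e hα hs hl ψ := by
    have h1 : ψ = (memLp_of_bounded e α hm hK).toLp ψ' :=
      Lp.ext (heq.trans (MemLp.coeFn_toLp _).symm)
    rw [h1]
    exact (ouRes_toLp_of_bounded e hα hs hl hm hK).symm
  refine ⟨ouResFun e α lam ψ', hc, hae, abs_ouResFun_le e α hl hK,
    ae_eq_ouResD e hα hs hl hae (hc.hasSobolevGradient _), fun ε hε x => ?_⟩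
  obtain ⟨h1, h2⟩ := hC.sup_bound ε hε lam hl ψ' _ ⟨hm, K, hK⟩ hc
    (isResolventOf_ouResFun e hα hs hl hm hK) x
  have hCp := hC.pos ε hε
  exact ⟨h1, h2.trans (mul_le_mul_of_nonneg_left (supNorm_le hK0 (ae_of_all _ hK))
    (by positivity))⟩

variable {B : H → H} (hB : AEStronglyMeasurable B (invMeasure e α)) {b : ℝ}
  (hb : ∀ᵐ x ∂(invMeasure e α), ‖B x‖ ≤ b)

/-- The operator `φ ↦ ⟨B, D(λ - L₂)⁻¹φ⟩` on `L²`. -/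
noncomputable def driftOp : Lp ℝ 2 (invMeasure e α) →L[ℝ] Lp ℝ 2 (invMeasure e α) :=
  (pairing B hB hb).comp (ouResD e hα hs hl)

theorem driftOp_coe (φ : Lp ℝ 2 (invMeasure e α)) : driftOp hα hs hl hB hb φ
    =ᵐ[invMeasure e α] fun x => ⟪B x, ouResD e hα hs hl φ x⟫_ℝ :=
  pairing_coe B hB hb _

theorem isDriftOperator_driftOp :
    IsDriftOperator e α B (ouRes e hα hs hl) (driftOp hα hs hl hB hb) :=
  fun φ => ⟨_, hasSobolevGradient_ouRes e hα hs hl φ, driftOp_coe hα hs hl hB hb φ⟩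

theorem IsGradientConstant.norm_driftOp_le {C : ℝ → ℝ} (hC : IsGradientConstant e α C)
    (hb0 : 0 ≤ b) (hbC : b * (C 0 / lam ^ (1 / 2 - 0 : ℝ)) ≤ 1 / 2)
    (φ : Lp ℝ 2 (invMeasure e α)) : ‖driftOp hα hs hl hB hb φ‖ ≤ 1 / 2 * ‖φ‖ := by
  refine (norm_pairing_le B hB hb _).trans ?_
  refine (mul_le_mul_of_nonneg_left (hC.norm_ouResD_le hα hs hl φ) hb0).trans ?_
  rw [← mul_assoc]
  exact mul_le_mul_of_nonneg_right hbC (norm_nonneg _)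

theorem IsGradientConstant.opNorm_driftOp_le {C : ℝ → ℝ} (hC : IsGradientConstant e α C)
    (hb0 : 0 ≤ b) (hbC : b * (C 0 / lam ^ (1 / 2 - 0 : ℝ)) ≤ 1 / 2) :
    ‖driftOp hα hs hl hB hb‖ ≤ 1 / 2 :=
  ContinuousLinearMap.opNorm_le_bound _ (by norm_num)
    (hC.norm_driftOp_le hα hs hl hB hb hb0 hbC)

theorem IsGradientConstant.isUnit_one_sub_driftOp {C : ℝ → ℝ} (hC : IsGradientConstant e α C)
    (hb0 : 0 ≤ b) (hbC : b * (C 0 / lam ^ (1 / 2 - 0 : ℝ)) ≤ 1 / 2) :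
    IsUnit (1 - driftOp hα hs hl hB hb) :=
  isUnit_one_sub_of_norm_lt_one
    ((hC.opNorm_driftOp_le hα hs hl hB hb hb0 hbC).trans_lt (by norm_num))

/-- The contraction property of the drift operator in `L^∞`, from the sup-norm gradient estimate
with `ε = 0`. -/
theorem IsGradientConstant.ae_abs_driftOp_le {C : ℝ → ℝ} (hC : IsGradientConstant e α C)
    (hb0 : 0 ≤ b) (hbC : b * (C 0 / lam ^ (1 / 2 - 0 : ℝ)) ≤ 1 / 2)
    {φ : Lp ℝ 2 (invMeasure e α)} {K : ℝ} (hK0 : 0 ≤ K)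
    (hφ : ∀ᵐ x ∂(invMeasure e α), |φ x| ≤ K) :
    ∀ᵐ x ∂(invMeasure e α), |driftOp hα hs hl hB hb φ x| ≤ K / 2 := by
  obtain ⟨u, -, -, -, hg, hbd⟩ := hC.exists_isC1b hα hs hl hK0 hφ
  filter_upwards [hg, driftOp_coe hα hs hl hB hb φ, hb] with x h1 h2 h3
  have h4 := (hbd 0 (by norm_num) x).2
  rw [powNegA_zero, h1] at h4
  rw [h2]
  refine (abs_real_inner_le_norm _ _).trans
    ((mul_le_mul h3 h4 (norm_nonneg _) hb0).trans ?_)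
  rw [← mul_assoc]
  exact (mul_le_mul_of_nonneg_right hbC hK0).trans_eq (by ring)

/-- An essential bound for the solution of `ψ - T ψ = F`. -/
theorem IsGradientConstant.ae_abs_le_of_sub_driftOp {C : ℝ → ℝ} (hC : IsGradientConstant e α C)
    (hb0 : 0 ≤ b) (hbC : b * (C 0 / lam ^ (1 / 2 - 0 : ℝ)) ≤ 1 / 2)
    {F ψ : Lp ℝ 2 (invMeasure e α)} {S : ℝ} (hS : 0 ≤ S)
    (hF : ∀ᵐ x ∂(invMeasure e α), |F x| ≤ S) (hψ : ψ - driftOp hα hs hl hB hb ψ = F) :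
    ∀ᵐ x ∂(invMeasure e α), |ψ x| ≤ 2 * S := by
  set T := driftOp hα hs hl hB hb with hT
  have hTn := hC.opNorm_driftOp_le hα hs hl hB hb hb0 hbC
  -- These vectors are the partial sums `∑_{j<n} T^j F` of the Neumann series. They converge in
  -- `L²`, and the essential bound `2S` reproduces itself along them, as `S + 2S/2 = 2S`, so it
  -- holds in the limit.
  have hlim : Tendsto (fun n : ℕ => ψ - (T ^ n) ψ) atTop (𝓝 ψ) := by
    have h0 : Tendsto (fun n : ℕ => (T ^ n) ψ) atTop (𝓝 0) := by
      have hpow : Tendsto (fun n : ℕ => (1 / 2 : ℝ) ^ n * ‖ψ‖) atTop (𝓝 0) := by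
        have := (tendsto_pow_atTop_nhds_zero_of_lt_one (r := (1 / 2 : ℝ)) (by norm_num)
          (by norm_num)).mul_const ‖ψ‖
        rwa [zero_mul] at this
      refine squeeze_zero_norm (fun n => ?_) hpow
      induction n with
      | zero => simp
      | succ n ih =>
        rw [pow_succ', mul_apply_eq_comp, pow_succ', mul_assoc]
        exact (hC.norm_driftOp_le hα hs hl hB hb hb0 hbC _).trans
          (mul_le_mul_of_nonneg_left ih (by norm_num))
    simpa using tendsto_const_nhds.sub h0
  refine ae_abs_le_of_tendsto hlim fun n => ?_
  induction n with
  | zero =>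
    rw [pow_zero, one_apply_eq_self, sub_self]
    filter_upwards [Lp.coeFn_zero ℝ 2 (invMeasure e α)] with x hx
    rw [hx, Pi.zero_apply, abs_zero]
    positivity
  | succ n ih =>
    have h1 : ψ - (T ^ (n + 1)) ψ = F + T (ψ - (T ^ n) ψ) := by
      rw [pow_succ', mul_apply_eq_comp, map_sub, ← hψ]
      abel
    rw [h1]
    filter_upwards [hF, hC.ae_abs_driftOp_le hα hs hl hB hb hb0 hbC (by positivity) ih,
      Lp.coeFn_add F (T (ψ - (T ^ n) ψ))] with x hx1 hx2 hx3
    rw [hx3, Pi.add_apply]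
    exact (abs_add_le _ _).trans (by linarith)

/-- With `φ = λv - L₂v`, that is `v = (λ - L₂)⁻¹φ`, the drift term is `Tφ` and the equation reads
`(1 - T)φ = f`. Existence and uniqueness are both contained in the invertibility of `1 - T`. -/
theorem isSolution_iff (hu : IsUnit (1 - driftOp hα hs hl hB hb)) {f v : H → ℝ}
    (hf : MemLp f 2 (invMeasure e α)) :
    IsSolution e α lam B f v ↔ v =ᵐ[invMeasure e α]
      ouRes e hα hs hl (Ring.inverse (1 - driftOp hα hs hl hB hb) (hf.toLp f)) := by
  set T := driftOp hα hs hl hB hb with hT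
  constructor
  · rintro ⟨Lv, Dv, hgen, hD, heq⟩
    have hφ : MemLp (fun x => lam * v x - Lv x) 2 (invMeasure e α) :=
      (hgen.1.const_mul lam).sub hgen.2.1
    have hres := (isResolventOf_iff e hα hs hl hφ).1 ⟨Lv, hgen, ae_of_all _ fun _ => rfl⟩
    have hDv := ae_eq_ouResD e hα hs hl hres hD
    have h1 : (1 - T) (hφ.toLp _) = hf.toLp f := by
      refine Lp.ext ?_
      rw [sub_apply, one_apply_eq_self]
      filter_upwards [Lp.coeFn_sub (hφ.toLp _) (T (hφ.toLp _)), hφ.coeFn_toLp, hf.coeFn_toLp,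
        driftOp_coe hα hs hl hB hb (hφ.toLp _), hDv, heq] with x hx1 hx2 hx3 hx4 hx5 hx6
      rw [hx1, Pi.sub_apply, hx2, hx3, hT, hx4, ← hx5, hx6]
    rwa [← h1, inverse_apply_apply hu]
  · intro hv
    set ψ := Ring.inverse (1 - T) (hf.toLp f) with hψ
    have h1 : (1 - T) ψ = hf.toLp f := apply_inverse_apply hu _
    have hv' : v =ᵐ[invMeasure e α] ouRes e hα hs hl ((Lp.memLp ψ).toLp ψ) := by
      rwa [Lp.toLp_coeFn]
    obtain ⟨Lv, hgen, heq⟩ := (isResolventOf_iff e hα hs hl (Lp.memLp ψ)).2 hv'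
    refine ⟨Lv, ouResD e hα hs hl ψ, hgen, ?_, ?_⟩
    · rw [hasSobolevGradient_iff _ hgen.1 (Lp.memLp _), Lp.toLp_coeFn]
      have h2 : hgen.1.toLp v = ouRes e hα hs hl ψ := Lp.ext (hgen.1.coeFn_toLp.trans hv)
      rw [h2]
      exact ouResD_mem e hα hs hl ψ
    · rw [sub_apply, one_apply_eq_self] at h1
      have h3 := hf.coeFn_toLp
      rw [← h1] at h3
      filter_upwards [h3, Lp.coeFn_sub ψ (T ψ), driftOp_coe hα hs hl hB hb ψ, heq]
        with x hx1 hx2 hx3 hx4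
      rw [hx4, ← hx1, hx2, Pi.sub_apply, hT, hx3]

/-- The solution of the equation with a drift. -/
theorem IsGradientConstant.exists_solution {C : ℝ → ℝ} (hC : IsGradientConstant e α C)
    (hb0 : 0 ≤ b) (hbC : b * (C 0 / lam ^ (1 / 2 - 0 : ℝ)) ≤ 1 / 2) {f : H → ℝ}
    (hf : MemLp f 2 (invMeasure e α)) {S : ℝ} (hS : 0 ≤ S)
    (hfS : ∀ᵐ x ∂(invMeasure e α), |f x| ≤ S) :
    ∃ u : H → ℝ, IsC1b u ∧ IsSolution e α lam B f u ∧
      (∀ v, IsSolution e α lam B f v → v =ᵐ[invMeasure e α] u) ∧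
      u =ᵐ[invMeasure e α]
        ouRes e hα hs hl (Ring.inverse (1 - driftOp hα hs hl hB hb) (hf.toLp f)) ∧
      gradient u =ᵐ[invMeasure e α]
        ouResD e hα hs hl (Ring.inverse (1 - driftOp hα hs hl hB hb) (hf.toLp f)) ∧
      (∀ x, |u x| ≤ 2 * S / lam) ∧
      ∀ ε ∈ Set.Ico (0 : ℝ) (1 / 2), ∀ x, InDomPowNegA e α ε (gradient u x) ∧
        ‖powNegA e α ε (gradient u x)‖ ≤ 2 * C ε / lam ^ (1 / 2 - ε) * S := by
  have hu := hC.isUnit_one_sub_driftOp hα hs hl hB hb hb0 hbC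
  set ψ := Ring.inverse (1 - driftOp hα hs hl hB hb) (hf.toLp f) with hψ
  have h1 : ψ - driftOp hα hs hl hB hb ψ = hf.toLp f := apply_inverse_apply hu _
  have hF : ∀ᵐ x ∂(invMeasure e α), |hf.toLp f x| ≤ S := by
    filter_upwards [hf.coeFn_toLp, hfS] with x hx hx2
    rwa [hx]
  obtain ⟨u, hu1, hu2, hu3, hu4, hu5⟩ := hC.exists_isC1b hα hs hl (by positivity)
    (hC.ae_abs_le_of_sub_driftOp hα hs hl hB hb hb0 hbC hS hF h1)
  refine ⟨u, hu1, (isSolution_iff hα hs hl hB hb hu hf).2 hu2,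
    fun v hv => ((isSolution_iff hα hs hl hB hb hu hf).1 hv).trans hu2.symm, hu2, hu4, hu3,
    fun ε hε x => ⟨(hu5 ε hε x).1, (hu5 ε hε x).2.trans_eq (by ring)⟩⟩

end Drift

end KolmogorovOU

/-! ### Assembly of the theorem. -/

theorem proposition2p3 {H : Type*} [NormedAddCommGroup H] [InnerProductSpace ℝ H]
    [CompleteSpace H] [TopologicalSpace.SeparableSpace H] [MeasurableSpace H] [BorelSpace H]
    {ι : Type*} (A : H →ₗ.[ℝ] H) (e : HilbertBasis ι ℝ H) (α : ι → ℝ)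
    (hA : Hypothesis1 A e α) :
    -- the constants of the gradient estimates exist, and for any choice of them:
    (∃ C : ℝ → ℝ, IsGradientConstant e α C) ∧
    ∀ C : ℝ → ℝ, IsGradientConstant e α C →
    ∀ (f : H → ℝ) (B : H → H) (fn : ℕ → H → ℝ) (Bn : ℕ → H → H) (M lam : ℝ),
      IsBoundedBorel f → IsBoundedBorel B →
      (∀ n, IsBoundedBorel (fn n)) → (∀ n, IsBoundedBorel (Bn n)) →
      (∀ᵐ x ∂(invMeasure e α), Tendsto (fun n => fn n x) atTop (𝓝 (f x))) →
      (∀ᵐ x ∂(invMeasure e α), Tendsto (fun n => Bn n x) atTop (𝓝 (B x))) →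
      (∀ n, supNorm (invMeasure e α) (fn n) ≤ M) →
      (∀ n, supNorm (invMeasure e α) (Bn n) ≤ M) →
      0 < lam →
      (∀ n, 4 * supNorm (invMeasure e α) (Bn n) ^ 2 * C 0 ^ 2 ≤ lam) →
    ∃ (u : H → ℝ) (un : ℕ → H → ℝ),
      -- `u` is the solution of the limit equation
      (IsC1b u ∧ IsSolution e α lam B f u ∧
        ∀ v, IsSolution e α lam B f v → v =ᵐ[invMeasure e α] u) ∧
      -- `un n` is the unique solution of the approximating equation
      (∀ n, IsC1b (un n) ∧ IsSolution e α lam (Bn n) (fn n) (un n) ∧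
        (∀ v, IsSolution e α lam (Bn n) (fn n) v → v =ᵐ[invMeasure e α] un n) ∧
        (∀ v, IsC1b v → IsSolution e α lam (Bn n) (fn n) v → v = un n)) ∧
      -- `un n = (λ - L₂)⁻¹ (I - T_{n,λ})⁻¹ fn n`
      (∃ G : Lp ℝ 2 (invMeasure e α) →L[ℝ] Lp ℝ 2 (invMeasure e α),
        IsResolvent e α lam G ∧
        ∀ n, ∃ T : Lp ℝ 2 (invMeasure e α) →L[ℝ] Lp ℝ 2 (invMeasure e α),
          IsDriftOperator e α (Bn n) G T ∧ IsUnit (1 - T) ∧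
          ∃ F : Lp ℝ 2 (invMeasure e α), F =ᵐ[invMeasure e α] fn n ∧
            un n =ᵐ[invMeasure e α] G (Ring.inverse (1 - T) F)) ∧
      -- bounds uniform in `n`
      (∀ n x, |un n x| ≤ 2 * M / lam) ∧
      (∀ ε ∈ Set.Ico (0 : ℝ) (1 / 2), ∀ n x, InDomPowNegA e α ε (gradient (un n) x) ∧
        ‖powNegA e α ε (gradient (un n) x)‖ ≤ 2 * C ε / lam ^ (1 / 2 - ε) * M) ∧
      -- convergence in `L²(μ)`
      Tendsto (fun n => eLpNorm (fun x => un n x - u x) 2 (invMeasure e α)) atTop (𝓝 0) ∧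
      Tendsto (fun n => eLpNorm (fun x => gradient (un n) x - gradient u x) 2 (invMeasure e α))
        atTop (𝓝 0) := by
  have hα := hA.pos
  have hs := hA.summable
  have := hA.countable
  have := UniformSpace.secondCountable_of_separable H
  refine ⟨⟨_, isGradientConstant_gamma e hα hs⟩, ?_⟩
  intro C hC f B fn Bn M lam hf hB hfn hBn hflim hBlim hfM hBM hl hlam
  set μ := invMeasure e α with hμ
  have hC0 := hC.pos 0 (by norm_num)
  have hL : 0 < lam ^ (1 / 2 - 0 : ℝ) := by positivity
  have hLsq : (lam ^ (1 / 2 - 0 : ℝ)) ^ 2 = lam := by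
    rw [← Real.rpow_natCast, ← Real.rpow_mul hl.le]
    norm_num
  -- The largest drift bound for which the contraction factor is at most `1/2`. The condition on `λ`
  -- says exactly that every `‖B_n‖₀` is at most `b`, and the almost everywhere limit `B` inherits
  -- the bound.
  set b : ℝ := lam ^ (1 / 2 - 0 : ℝ) / (2 * C 0) with hbdef
  have hb0 : 0 ≤ b := by positivity
  have hbC : b * (C 0 / lam ^ (1 / 2 - 0 : ℝ)) ≤ 1 / 2 := by
    rw [hbdef]
    exact le_of_eq (by field_simp)
  have hM0 : 0 ≤ M := (supNorm_nonneg μ (fn 0)).trans (hfM 0)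
  have hBnb : ∀ n, ∀ᵐ x ∂μ, ‖Bn n x‖ ≤ b := fun n => by
    filter_upwards [ae_norm_le_supNorm μ (hBn n)] with x hx
    refine hx.trans ?_
    rw [hbdef, le_div_iff₀ (by positivity)]
    refine abs_le_of_sq_le_sq' ?_ hL.le |>.2
    rw [hLsq]
    exact le_trans (le_of_eq (by ring)) (hlam n)
  have hBb : ∀ᵐ x ∂μ, ‖B x‖ ≤ b := by
    filter_upwards [hBlim, ae_all_iff.2 hBnb] with x hx hx2
    exact le_of_tendsto' hx.norm hx2
  have hfnb : ∀ n, ∀ᵐ x ∂μ, |fn n x| ≤ M := fun n => by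
    filter_upwards [ae_norm_le_supNorm μ (hfn n)] with x hx
    exact hx.trans (hfM n)
  have hfb : ∀ᵐ x ∂μ, |f x| ≤ M := by
    filter_upwards [hflim, ae_all_iff.2 hfnb] with x hx hx2
    exact le_of_tendsto' hx.abs hx2
  have hBs : AEStronglyMeasurable B μ := hB.1.aestronglyMeasurable
  have hBns : ∀ n, AEStronglyMeasurable (Bn n) μ := fun n => (hBn n).1.aestronglyMeasurable
  have hf2 : MemLp f 2 μ := MemLp.of_bound hf.1.aestronglyMeasurable M hfb
  have hfn2 : ∀ n, MemLp (fn n) 2 μ := fun n =>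
    MemLp.of_bound (hfn n).1.aestronglyMeasurable M (hfnb n)
  obtain ⟨u, hu1, hu2, hu3, hu4, hu5, -, -⟩ :=
    hC.exists_solution hα hs hl hBs hBb hb0 hbC hf2 hM0 hfb
  choose un hun1 hun2 hun3 hun4 hun5 hun6 hun7 using fun n =>
    hC.exists_solution hα hs hl (hBns n) (hBnb n) hb0 hbC (hfn2 n) hM0 (hfnb n)
  have hunit := hC.isUnit_one_sub_driftOp hα hs hl hBs hBb hb0 hbC
  have hunitn := fun n => hC.isUnit_one_sub_driftOp hα hs hl (hBns n) (hBnb n) hb0 hbC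
  have hFlim : Tendsto (fun n => (hfn2 n).toLp (fn n)) atTop (𝓝 (hf2.toLp f)) := by
    rw [Lp.tendsto_Lp_iff_tendsto_eLpNorm'']
    refine tendsto_eLpNorm_two_of_dominated (fun n => (hfn2 n).1.sub hf2.1)
      (memLp_const (2 * M)) (fun n => ?_) hflim
    filter_upwards [hfb, hfnb n] with x h1 h2
    exact (abs_sub _ _).trans (by linarith)
  -- Only strong convergence is available: for fixed `v` the integrands converge almost everywhere
  -- and are dominated by `2b` times the norm of `D(λ - L₂)⁻¹v`.
  have hTlim : ∀ v, Tendsto (fun n => driftOp hα hs hl (hBns n) (hBnb n) v) atTop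
      (𝓝 (driftOp hα hs hl hBs hBb v)) := by
    intro v
    rw [Lp.tendsto_Lp_iff_tendsto_eLpNorm']
    have hg := Lp.memLp (ouResD e hα hs hl v)
    have hi : ∀ {D : H → H}, AEStronglyMeasurable D μ →
        AEStronglyMeasurable (fun x => ⟪D x, ouResD e hα hs hl v x⟫_ℝ) μ :=
      fun hD => hD.inner hg.1
    have h1 := tendsto_eLpNorm_two_of_dominated (μ := μ)
      (f := fun n x => ⟪Bn n x, ouResD e hα hs hl v x⟫_ℝ)
      (g := fun x => ⟪B x, ouResD e hα hs hl v x⟫_ℝ)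
      (fun n => (hi (hBns n)).sub (hi hBs)) (hg.norm.const_mul (2 * b)) (fun n => ?_) ?_
    · refine h1.congr fun n => (eLpNorm_congr_ae ?_).symm
      filter_upwards [driftOp_coe hα hs hl (hBns n) (hBnb n) v, driftOp_coe hα hs hl hBs hBb v]
        with x hx hx2
      rw [Pi.sub_apply, hx, hx2]
    · filter_upwards [hBb, hBnb n] with x hx hx2
      rw [← inner_sub_left]
      refine (norm_inner_le_norm _ _).trans (mul_le_mul_of_nonneg_right ?_ (norm_nonneg _))
      exact (norm_sub_le _ _).trans (by linarith)
    · filter_upwards [hBlim] with x hx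
      exact hx.inner tendsto_const_nhds
  have hψlim := tendsto_inverse_one_sub hunit hunitn
    (fun n => hC.norm_driftOp_le hα hs hl (hBns n) (hBnb n) hb0 hbC) hTlim hFlim
  refine ⟨u, un, ⟨hu1, hu2, hu3⟩, fun n => ⟨hun1 n, hun2 n, hun3 n, fun v hv1 hv2 =>
      hv1.eq_of_ae_eq e hα hs (hun1 n) (hun3 n v hv2)⟩,
    ⟨ouRes e hα hs hl, isResolvent_ouRes e hα hs hl, fun n =>
      ⟨_, isDriftOperator_driftOp hα hs hl (hBns n) (hBnb n), hunitn n, (hfn2 n).toLp (fn n),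
        (hfn2 n).coeFn_toLp, hun4 n⟩⟩, hun6, fun ε hε n x => hun7 n ε hε x, ?_, ?_⟩
  · have h1 := ((ouRes e hα hs hl).continuous.tendsto _).comp hψlim
    rw [Lp.tendsto_Lp_iff_tendsto_eLpNorm'] at h1
    exact h1.congr fun n => (eLpNorm_congr_ae ((hun4 n).sub hu4)).symm
  · have h1 := ((ouResD e hα hs hl).continuous.tendsto _).comp hψlim
    rw [Lp.tendsto_Lp_iff_tendsto_eLpNorm'] at h1
    exact h1.congr fun n => (eLpNorm_congr_ae ((hun5 n).sub hu5)).symm
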